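/- Let $M_1=(E,\mathcal I_1)$ and $M_2=(E,\mathcal I_2)$ be two matroids on a common ground set $E$ of $n$ elements, let $r$ be the maximum size of an independent set of either matroid, and let $T_{ind}\ge 0$ be the running time of one call to an independence oracle of either matroid. For $S\in\mathcal I_1\cap\mathcal I_2$, let $X_1=\{x\in E\setminus S: S+x\in\mathcal I_1\}$ (sources) and $X_2=\{x\in E\setminus S: S+x\in\mathcal I_2\}$ (sinks), and let $D(S)$ be the bipartite digraph on $S\cup(E\setminus S)$ that has, for $y\in S$ and $x\in E\setminus S$, the arc $(y,x)$ if $S-y+x\in\mathcal I_1$ and the arc $(x,y)$ if $S-y+x\in\mathcal I_2$. The basic version of Cunningham's algorithm starts with $S=\emptyset$ and, as long as there is a path from $X_1$ to $X_2$ in $D(S)$, replaces $S$ by $S\,\Delta\,P$ for a shortest such path $P$ (a single vertex if $X_1\cap X_2\neq\emptyset$). Consider the following implementation on a unit-cost random access machine, on which the elements of $E$ are numbered $0,\dots,n-1$ and an oracle query is a list of elements that the program has written into an array. In each iteration, first $X_1$ and $X_2$ are found by querying $S+x$ for all $x\in E\setminus S$ in both matroids. Then a breadth-first search from $X_1$ computes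 the sets $V_d$ of vertices at distance $d=0,1,2,\dots$ from $X_1$ in $D(S)$, until an element of $X_2$ is processed or $V_d=\emptyset$ for an even $d$. * *$d$ even.* For each $v\in V_d$ (not in $X_2$), the unreached elements $u\in S$ with $S-u+v\in\mathcal I_2$ are found as follows. An ordering $s_1,\dots,s_k$ of $S$ is kept in which the set of reached elements of $S$ is a prefix $\{s_1,\dots,s_a\}$. Binary search finds the least $i$ with $\{s_1,\dots,s_i\}+v\notin\mathcal I_2$. If $i\le a$, then $v$ is finished; otherwise $s_i$ becomes reached with parent $v$, it is swapped with $s_{a+1}$, $a$ increases by one, and the search is repeated. * *$d$ odd.* For each unreached $u\in E\setminus S$ it is queried whether $(S\setminus V_d)+u\in\mathcal I_1$. If so, $u$ is put into $V_{d+1}$, and its parent is the $i$-th element of $V_d$, for the least $i$ such that $(S\setminus V_d)+u$ together with the first $i$ elements of $V_d$ is not in $\mathcal I_1$; this $i$ is found by binary search. When an element of $X_2$ is processed, $S$ is replaced by $S\,\Delta\,P$, where $P$ is the path to this element given by the parents. If the search ends without reaching $X_2$, the algorithm stops. Then this implementation always halts; it performs a run of the basic version of Cunningham's algorithm (each solution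 arises from the previous one by a shortest path from $X_1$ to $X_2$, and at the end no such path exists); and the last solution is a common independent set of maximum size. Moreover, there is an absolute constant $C$ such that, whenever $n\ge 1$ and with $\rho=\max(r,2)$ (so $\rho=r$ for $r\ge2$), it makes at most $C\,n\rho\log^2\rho$ oracle calls, and its total running time, including the oracle calls, is at most $C\,n\rho\log^2\rho\,(T_{ind}+\rho)$. That is, the running time is $O(nr\log^2 r\,(T_{ind}+r))$ and the number of oracle calls is $O(nr\log^2 r)$. -/

import Mathlib

/-! ## Matroid intersection: exchange graph, augmenting paths, runs of the basic algorithm -/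

set_option linter.constructorNameAsVariable false

namespace MatroidIntersection

variable {α : Type*}

/-- The elements `x ∉ S` such that `S + x` is independent in `M`.  For the first matroid these are
the sources, for the second one the sinks. -/
def extenders (M : Matroid α) (S : Set α) : Set α :=
  {x | x ∉ S ∧ M.Indep (insert x S)}

/-- The exchange graph of `S`: for `y ∈ S` and `x ∉ S` in the ground set, `(y, x)` is an arc if
`S - y + x` is independent in `M₁`, and `(x, y)` is an arc if `S - y + x` is independent
in `M₂`. -/
def exchangeGraph (M₁ M₂ : Matroid α) (S : Set α) : Digraph α where
  Adj a b :=
    (a ∈ S ∧ b ∈ M₁.E \ S ∧ M₁.Indep (insert b (S \ {a}))) ∨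
    (a ∈ M₂.E \ S ∧ b ∈ S ∧ M₂.Indep (insert a (S \ {b})))

/-- `P` is (the vertex sequence of) a path in the exchange graph of `S` from a source to a sink. -/
structure IsAugmentingPath (M₁ M₂ : Matroid α) (S : Set α) (P : List α) : Prop where
  chain : P.IsChain (exchangeGraph M₁ M₂ S).Adj
  nodup : P.Nodup
  source : ∃ x ∈ P.head?, x ∈ extenders M₁ S
  sink : ∃ x ∈ P.getLast?, x ∈ extenders M₂ S

/-- `P` is a shortest path from a source to a sink. -/
def IsShortestAugmentingPath (M₁ M₂ : Matroid α) (S : Set α) (P : List α) : Prop :=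
  IsAugmentingPath M₁ M₂ S P ∧ ∀ Q, IsAugmentingPath M₁ M₂ S Q → P.length ≤ Q.length

/-- One iteration of the basic algorithm: `S' = S Δ P` for a shortest augmenting path `P`. -/
def Augments (M₁ M₂ : Matroid α) (S S' : Set α) : Prop :=
  ∃ P, IsShortestAugmentingPath M₁ M₂ S P ∧ S' = symmDiff S {x | x ∈ P}

/-- The list of successive solutions of a complete run of the basic algorithm: it starts with the
empty set, each solution arises from the previous one by a shortest augmenting path, and the last
one has no augmenting path. -/
structure IsCunninghamRun (M₁ M₂ : Matroid α) (L : List (Set α)) : Prop where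
  start : L.head? = some ∅
  step : L.IsChain (Augments M₁ M₂)
  final : ∃ S ∈ L.getLast?, ∀ P, ¬ IsAugmentingPath M₁ M₂ S P

/-- `S` is a common independent set of maximum size. -/
def IsMaxCommonIndep (M₁ M₂ : Matroid α) (S : Set α) : Prop :=
  M₁.Indep S ∧ M₂.Indep S ∧ ∀ I, M₁.Indep I → M₂.Indep I → I.encard ≤ S.encard

/-! ## The machine model

A unit-cost random access machine, programmed in a language of while-programs.  Memory consists
of registers and arrays of natural numbers.  Ground-set elements are represented by numbers.  The
two matroids are accessible only through an independence oracle: the query is the list of elements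
in the first `len` cells of an array, and this list must have been written there by the program.
The arithmetic operations are addition, truncated subtraction and halving; the algorithm below only
forms numbers of size `O(n)`. -/

/-- Names of the registers. -/
inductive Reg
  | n | k | a | lo | m | i | v | l | h | mid | x | y | t | u | len | ans | found | more | go
  deriving DecidableEq

/-- Names of the arrays. -/
inductive Arr
  | sol | inS | seen | sink | par | lay | qry
  deriving DecidableEq

/-- Expressions; comparisons return `0` or `1`. -/
inductive Exp
  | lit (k : ℕ)
  | reg (x : Reg)
  | get (A : Arr) (i : Exp)
  | add (e f : Exp)
  | sub (e f : Exp)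
  | half (e : Exp)
  | lt (e f : Exp)
  | eq (e f : Exp)
  | and (e f : Exp)

/-- Programs. -/
inductive Cmd
  | skip
  /-- `x := e` -/
  | set (x : Reg) (e : Exp)
  /-- `A[i] := e` -/
  | store (A : Arr) (i e : Exp)
  | seq (c d : Cmd)
  /-- `if b ≠ 0 then c else d` -/
  | ite (b : Exp) (c d : Cmd)
  /-- `while b ≠ 0 do c` -/
  | loop (b : Exp) (c : Cmd)
  /-- `x := 1` if `{A[0], …, A[len - 1]}` is independent in matroid number `j`,
  otherwise `x := 0` -/
  | call (j : Fin 2) (A : Arr) (len : Exp) (x : Reg)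
  /-- append the list `A[0], …, A[len - 1]` to the output -/
  | emit (A : Arr) (len : Exp)

/-- A state of the machine: contents of registers and arrays, and the lists output so far. -/
structure State where
  reg : Reg → ℕ
  arr : Arr → ℕ → ℕ
  out : List (List ℕ)

/-- Assignment to a register. -/
def State.setReg (s : State) (x : Reg) (w : ℕ) : State :=
  { s with reg := Function.update s.reg x w }

/-- Assignment to an array cell. -/
def State.setArr (s : State) (A : Arr) (i w : ℕ) : State :=
  { s with arr := Function.update s.arr A (Function.update (s.arr A) i w) }

/-- The list `A[0], …, A[len - 1]`. -/
def State.slice (s : State) (A : Arr) (len : ℕ) : List ℕ :=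
  (List.range len).map (s.arr A)

/-- The value of an expression. -/
def Exp.eval (s : State) : Exp → ℕ
  | .lit k => k
  | .reg x => s.reg x
  | .get A i => s.arr A (i.eval s)
  | .add e f => e.eval s + f.eval s
  | .sub e f => e.eval s - f.eval s
  | .half e => e.eval s / 2
  | .lt e f => if e.eval s < f.eval s then 1 else 0
  | .eq e f => if e.eval s = f.eval s then 1 else 0
  | .and e f => if e.eval s ≠ 0 ∧ f.eval s ≠ 0 then 1 else 0

/-- The number of steps for evaluating an expression: one for each operation in it. -/
def Exp.cost : Exp → ℕ
  | .lit _ => 1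
  | .reg _ => 1
  | .get _ i => i.cost + 1
  | .add e f => e.cost + f.cost + 1
  | .sub e f => e.cost + f.cost + 1
  | .half e => e.cost + 1
  | .lt e f => e.cost + f.cost + 1
  | .eq e f => e.cost + f.cost + 1
  | .and e f => e.cost + f.cost + 1

/-- `Exec orc c s s' w q`: with the oracle `orc`, the program `c` started in the state `s` halts in
the state `s'` after `w` elementary steps and `q` oracle calls.  The running time of the oracle
itself is not contained in `w`. -/
inductive Exec (orc : Fin 2 → Set ℕ → Prop) : Cmd → State → State → ℕ → ℕ → Prop
  | skip (s : State) : Exec orc .skip s s 1 0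
  | set (x : Reg) (e : Exp) (s : State) :
      Exec orc (.set x e) s (s.setReg x (e.eval s)) (e.cost + 1) 0
  | store (A : Arr) (i e : Exp) (s : State) :
      Exec orc (.store A i e) s (s.setArr A (i.eval s) (e.eval s)) (i.cost + e.cost + 1) 0
  | seq {c d : Cmd} {s s' s'' : State} {w w' q q' : ℕ}
      (hc : Exec orc c s s' w q) (hd : Exec orc d s' s'' w' q') :
      Exec orc (.seq c d) s s'' (w + w') (q + q')
  | ite_true {b : Exp} {c d : Cmd} {s s' : State} {w q : ℕ}
      (hb : b.eval s ≠ 0) (hc : Exec orc c s s' w q) :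
      Exec orc (.ite b c d) s s' (b.cost + 1 + w) q
  | ite_false {b : Exp} {c d : Cmd} {s s' : State} {w q : ℕ}
      (hb : b.eval s = 0) (hd : Exec orc d s s' w q) :
      Exec orc (.ite b c d) s s' (b.cost + 1 + w) q
  | loop_true {b : Exp} {c : Cmd} {s s' s'' : State} {w w' q q' : ℕ}
      (hb : b.eval s ≠ 0) (hc : Exec orc c s s' w q)
      (hl : Exec orc (.loop b c) s' s'' w' q') :
      Exec orc (.loop b c) s s'' (b.cost + 1 + w + w') (q + q')
  | loop_false {b : Exp} {c : Cmd} {s : State} (hb : b.eval s = 0) :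
      Exec orc (.loop b c) s s (b.cost + 1) 0
  | call_true {j : Fin 2} {A : Arr} {len : Exp} {x : Reg} {s : State}
      (h : orc j {z | z ∈ s.slice A (len.eval s)}) :
      Exec orc (.call j A len x) s (s.setReg x 1) (len.cost + 1) 1
  | call_false {j : Fin 2} {A : Arr} {len : Exp} {x : Reg} {s : State}
      (h : ¬ orc j {z | z ∈ s.slice A (len.eval s)}) :
      Exec orc (.call j A len x) s (s.setReg x 0) (len.cost + 1) 1
  | emit (A : Arr) (len : Exp) (s : State) :
      Exec orc (.emit A len) s { s with out := s.out ++ [s.slice A (len.eval s)] }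
        (len.cost + 1 + len.eval s) 0

/-- The machine is deterministic: final state, number of steps and number of oracle calls are
determined by the program and the initial state. -/
theorem Exec.deterministic {orc : Fin 2 → Set ℕ → Prop} {c : Cmd} {s s₁ s₂ : State}
    {w₁ w₂ q₁ q₂ : ℕ} (h₁ : Exec orc c s s₁ w₁ q₁) (h₂ : Exec orc c s s₂ w₂ q₂) :
    s₁ = s₂ ∧ w₁ = w₂ ∧ q₁ = q₂ := by
  induction h₁ generalizing s₂ w₂ q₂ with
  | skip | set | store | emit => cases h₂; simp
  | seq _ _ ihc ihd =>
    cases h₂ with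
    | seq hc hd =>
      obtain ⟨rfl, rfl, rfl⟩ := ihc hc
      obtain ⟨rfl, rfl, rfl⟩ := ihd hd
      simp
  | ite_true hb _ ih =>
    cases h₂ with
    | ite_true _ hc => obtain ⟨rfl, rfl, rfl⟩ := ih hc; simp
    | ite_false hb' _ => exact absurd hb' hb
  | ite_false hb _ ih =>
    cases h₂ with
    | ite_true hb' _ => exact absurd hb hb'
    | ite_false _ hc => obtain ⟨rfl, rfl, rfl⟩ := ih hc; simp
  | loop_true hb _ _ ihc ihl =>
    cases h₂ with
    | loop_true _ hc hl =>
      obtain ⟨rfl, rfl, rfl⟩ := ihc hc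
      obtain ⟨rfl, rfl, rfl⟩ := ihl hl
      simp
    | loop_false hb' => exact absurd hb' hb
  | loop_false hb =>
    cases h₂ with
    | loop_true hb' _ _ => exact absurd hb hb'
    | loop_false _ => simp
  | call_true h =>
    cases h₂ with
    | call_true _ => simp
    | call_false h' => exact absurd h h'
  | call_false h =>
    cases h₂ with
    | call_true h' => exact absurd h' h
    | call_false _ => simp

/-- The total running time of a run with `w` elementary steps and `q` oracle calls, when the
running time of one oracle call is `T`. -/
def totalTime (T : ℝ) (w q : ℕ) : ℝ := w + T * q

/-- The initial state: the register `n` holds the size of the ground set, the rest of the memory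
is zero, and nothing has been output. -/
def initState (n : ℕ) : State where
  reg := Function.update (fun _ => 0) .n n
  arr := fun _ _ => 0
  out := []

/-- The independence oracle of two matroids whose elements are numbered by `elt`. -/
def indepOracle (M₁ M₂ : Matroid α) (elt : ℕ → α) (j : Fin 2) (Q : Set ℕ) : Prop :=
  (if j = 0 then M₁ else M₂).Indep (elt '' Q)

/-! ## The algorithm -/

namespace Algorithm

open Reg Arr Exp Cmd

/-- Sequential composition of a list of programs. -/
def block (L : List Cmd) : Cmd := L.foldr Cmd.seq Cmd.skip

/-- `for x := 0, …, n - 1 do c` -/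
def forAll (x : Reg) (c : Cmd) : Cmd :=
  block [set x (lit 0), loop (lt (reg x) (reg n)) (block [c, set x (add (reg x) (lit 1))])]

/-- Start a new query with the single element `e`. -/
def startQuery (e : Exp) : Cmd := block [store qry (lit 0) e, set len (lit 1)]

/-- Append the elements `sol[e], …, sol[f - 1]` to the query. -/
def appendRange (e f : Exp) : Cmd :=
  block [set t e,
    loop (lt (reg t) f) (block [
      store qry (reg len) (get sol (reg t)),
      set len (add (reg len) (lit 1)),
      set t (add (reg t) (lit 1))])]

/-- Ask matroid number `j` whether the current query is independent. -/
def ask (j : Fin 2) : Cmd := call j qry (reg len) ans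

/-- Binary search between the registers `l` and `h`, where `test` (whose answer is monotone) tells
whether the number in the register `mid` is still too small.  Leaves the least number that is not
too small in `l`. -/
def binarySearch (test : Cmd) : Cmd :=
  loop (lt (reg l) (reg h)) (block [
    set mid (half (add (reg l) (reg h))),
    test,
    ite (reg ans) (set l (add (reg mid) (lit 1))) (set h (reg mid))])

/-- Find the sources and the sinks.  The sources form the layer at distance `0`, which is stored in
`lay[0], …, lay[m - 1]`.  Reached elements outside `S` are marked in `seen`.  The parent of an
element in the search tree is stored in `par`, with the value `n` for a source. -/
def findSourcesAndSinks : Cmd :=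
  block [set m (lit 0),
    forAll x (block [
      store seen (reg x) (lit 0),
      store sink (reg x) (lit 0),
      ite (get inS (reg x)) skip (block [
        startQuery (reg x), appendRange (lit 0) (reg k),
        ask 1,
        store sink (reg x) (reg ans),
        ask 0,
        ite (reg ans) (block [
          store seen (reg x) (lit 1),
          store par (reg x) (reg n),
          store lay (reg m) (reg x),
          set m (add (reg m) (lit 1))]) skip])])]

/-- Even distance, for the element in register `v`, which is not a sink.  The array `sol` holds an
ordering of `S` of which the `a` elements reached so far form a prefix.  A binary search finds the
least `l` such that the first `l` elements together with `v` are dependent in the second matroid.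
If `l ≤ a`, there are no further neighbours.  Otherwise the `l`-th element is a new neighbour, and
is swapped to the end of the prefix. -/
def exploreEven : Cmd :=
  block [set go (lit 1),
    loop (reg go) (block [
      set l (lit 0), set h (reg k),
      binarySearch (block [startQuery (reg v), appendRange (lit 0) (reg mid), ask 1]),
      ite (lt (reg a) (reg l))
        (block [
          set y (get sol (sub (reg l) (lit 1))),
          store sol (sub (reg l) (lit 1)) (get sol (reg a)),
          store sol (reg a) (reg y),
          store par (reg y) (reg v),
          set a (add (reg a) (lit 1))])
        (set go (lit 0))])]

/-- Process the even layer `lay[0], …, lay[m - 1]`, until a sink is found.  The next (odd) layer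
becomes `sol[lo], …, sol[a - 1]`. -/
def processEvenLayer : Cmd :=
  block [set lo (reg a), set i (lit 0),
    loop (and (lt (reg i) (reg m)) (eq (reg found) (lit 0))) (block [
      set v (get lay (reg i)),
      ite (get sink (reg v)) (set found (lit 1)) exploreEven,
      set i (add (reg i) (lit 1))])]

/-- The query consisting of the element in register `u` and of `S` without the odd layer. -/
def queryWithoutLayer : Cmd :=
  block [startQuery (reg u), appendRange (lit 0) (reg lo), appendRange (reg a) (reg k)]

/-- Process the odd layer `sol[lo], …, sol[a - 1]`.  An unreached element `u` outside `S` is in the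
next layer if `u` and `S` without the odd layer are independent in the first matroid.  In this
case its parent is found by a binary search for the shortest prefix of the odd layer (ending
before position `l`) whose addition makes the set dependent. -/
def processOddLayer : Cmd :=
  block [set m (lit 0),
    forAll u (ite (and (eq (get inS (reg u)) (lit 0)) (eq (get seen (reg u)) (lit 0)))
      (block [
        queryWithoutLayer, ask 0,
        ite (reg ans)
          (block [
            set l (reg lo), set h (reg a),
            binarySearch (block [queryWithoutLayer, appendRange (reg lo) (reg mid), ask 0]),
            store par (reg u) (get sol (sub (reg l) (lit 1))),
            store seen (reg u) (lit 1),
            store lay (reg m) (reg u),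
            set m (add (reg m) (lit 1))])
          skip]) skip)]

/-- Breadth-first search from the sources.  At the end, `found` tells whether a sink was reached;
if so, it is in the register `v`. -/
def search : Cmd :=
  block [set found (lit 0), set a (lit 0),
    findSourcesAndSinks,
    loop (and (eq (reg found) (lit 0)) (lt (lit 0) (reg m))) (block [
      processEvenLayer,
      ite (reg found) skip processOddLayer])]

/-- Replace `S` by `S Δ P`, where `P` is the path to `v` in the search tree, and output the new
solution. -/
def augment : Cmd :=
  block [store inS (reg v) (lit 1),
    loop (lt (get par (reg v)) (reg n)) (block [
      set y (get par (reg v)),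
      store inS (reg y) (lit 0),
      set v (get par (reg y)),
      store inS (reg v) (lit 1)]),
    set k (lit 0),
    forAll x (ite (get inS (reg x))
      (block [store sol (reg k) (reg x), set k (add (reg k) (lit 1))])
      skip),
    emit sol (reg k)]

/-- The implementation of the basic algorithm.  It outputs every solution on its way, starting with
the empty set. -/
def cunningham : Cmd :=
  block [set k (lit 0),
    forAll x (store inS (reg x) (lit 0)),
    emit sol (reg k),
    set more (lit 1),
    loop (reg more) (block [search, ite (reg found) augment (set more (lit 0))])]

end Algorithm

end MatroidIntersection

open MatroidIntersection

/-!
The proof follows the classical analysis of augmenting paths, in a form that fits the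
implementation.  It is carried out for matroids on `{0, …, n - 1}`, to which the given ones are
pulled back.

*The search.*  The neighbours of `v ∉ S` in the exchange graph are found correctly because, if
`A ⊆ S` and `A + y + v` is dependent but `A + v` is not, then `S - y + v` is independent
(`indep_exchange_of_prefix`).  That no neighbour is missed is expressed through spans.  When an even
layer has been processed, its elements are spanned in the second matroid by the reached elements of
`S`; when an odd layer has been processed, the unreached elements outside `S` are spanned in the
first matroid by the unreached elements of `S`.  These two facts, with the levels and the parents,
form `SearchInvariant`, which is preserved by the processing of two consecutive layers
(`SearchInvariant.next`).  An arc from a processed element to an unreached one would contradict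
them.

*Correctness.*  If the search ends without a sink, the spans cover the ground set, and hence every
common independent set has at most `|S|` elements (`encard_le_of_closure_cover`).  If it ends with a
sink, the levels show that the path given by the parents is a shortest one
(`isShortestAugmentingPath_of_levels`).  The exchanges along a shortest path have a triangular
structure in both matroids, and can therefore be carried out simultaneously (`indep_multi_exchange`,
`augment_of_levels`).

*Costs.*  Let `opt` be the maximum size of a common independent set.  Before a sink is found, the
same covering argument, applied to the prefix that ends after the new odd layer and to the rest of
`S` that begins with this layer, gives `opt ≤ |S| + |V_d|` for each odd `d`.  As the odd layers are
disjoint subsets of `S`, there are at most `|S| / (opt - |S|)` of them.  A search costs `O(n)`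
queries for each odd layer, and `O(n)` binary searches of `O(log |S|)` queries each, because a
binary search reaches a new element or is the last one for the element that is explored.  Over all
iterations the numbers of layers add up to a harmonic sum (`sum_div_sub_le`), and the last search
has at most `opt + 1` odd layers.  So there are `O(n ρ log ρ)` queries, each of `O(ρ)` elements,
which is better than required by a logarithmic factor, and `log ρ ≥ log 2` turns it into the bounds
with `log² ρ`.

*The machine.*  `Runs` is a predicate for total correctness with costs.  A single number, in which
an oracle call has weight `R = opt + 1` and a machine step weight `1`, bounds both costs: writing a
query takes `O(R)` steps, so the weighted cost of the program is `O(R)` times the bound for the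
number of calls.
-/

namespace MatroidIntersection
open Set

/-! ### Exchange, spans, and augmentation along shortest paths -/

section Matroid

variable {α : Type*}

/-- If `A ⊆ I ∩ S` spans `x` but `S - y` does not, then the circuit that `x` forms with `A` contains
`y`, so that `x` can replace `y` in `I`. -/
theorem indep_exchange_of_mem_closure {M : Matroid α} {I A S : Set α} {x y : α} (hI : M.Indep I)
    (hAI : A ⊆ I) (hAS : A ⊆ S) (hxA : x ∈ M.closure A) (hx : x ∉ M.closure (S \ {y})) :
    M.Indep (insert x (I \ {y})) := by
  have hxE := M.mem_ground_of_mem_closure hxA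
  have hI' : M.Indep (I \ {y}) := hI.subset sdiff_subset
  rw [hI'.insert_indep_iff]
  refine Or.inl ⟨hxE, fun h => hx ?_⟩
  -- both sets lie in `I`, where spans and intersections commute
  have h1 : x ∈ M.closure (I \ {y} ∩ A) := by
    rw [(hI.subset (union_subset sdiff_subset hAI)).closure_inter_eq_inter_closure]
    exact ⟨h, hxA⟩
  exact M.closure_subset_closure (fun z (hz : z ∈ I \ {y} ∩ A) =>
    (⟨hAS hz.2, hz.1.2⟩ : z ∈ S \ {y})) h1

/-- Correctness of the binary searches: if `A + v` is independent, for a subset `A` of `S`, then an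
element `y` of `S` for which `A + v + y` is dependent can be exchanged with `v`. -/
theorem indep_exchange_of_prefix {M : Matroid α} {S A : Set α} {v y : α} (hS : M.Indep S)
    (hA : A ⊆ S) (hy : y ∈ S) (hv : v ∉ S) (hvA : M.Indep (insert v A))
    (hdep : ¬ M.Indep (insert v (insert y A))) : M.Indep (insert v (S \ {y})) := by
  have hvE : v ∈ M.E := hvA.subset_ground (mem_insert _ _)
  have hyS : insert y A ⊆ S := insert_subset hy hA
  have h1 : v ∈ M.closure (insert y A) := by
    rw [(hS.subset hyS).insert_indep_iff] at hdep
    by_contra h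
    exact hdep (Or.inl ⟨hvE, h⟩)
  refine indep_exchange_of_mem_closure (S := insert y A) hS hyS subset_rfl h1 fun h => ?_
  have h2 : v ∈ M.closure A := M.closure_subset_closure (by grind) h
  exact ((hS.subset hA).notMem_closure_iff_of_notMem (fun h => hv (hA h)) hvE).2 hvA h2

theorem mem_closure_of_not_indep_insert {M : Matroid α} {A : Set α} {v : α} (hA : M.Indep A)
    (hv : v ∈ M.E) (h : ¬ M.Indep (insert v A)) : v ∈ M.closure A := by
  rw [hA.insert_indep_iff] at h
  by_contra h'
  exact h (Or.inl ⟨hv, h'⟩)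

theorem not_indep_insert_of_mem_closure {M : Matroid α} {A B : Set α} {v : α}
    (h : v ∈ M.closure A) (hAB : A ⊆ B) (hv : v ∉ B) : ¬ M.Indep (insert v B) := by
  rw [Matroid.insert_indep_iff]
  rintro ⟨-, h'⟩
  exact (h' hv).2 (M.closure_subset_closure hAB h)

/-- The easy half of the matroid intersection theorem: every common independent set that is
contained in the union of the span of `A` in one matroid and the span of `B` in the other has at
most `|A| + |B|` elements. -/
theorem encard_le_of_closure_cover {M₁ M₂ : Matroid α} {I A B : Set α} (h1 : M₁.Indep I)
    (h2 : M₂.Indep I) (h : I ⊆ M₂.closure A ∪ M₁.closure B) : I.encard ≤ A.encard + B.encard := by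
  have e2 : (I ∩ M₂.closure A).encard ≤ A.encard := by
    refine ((h2.subset inter_subset_left).encard_le_eRk_of_subset inter_subset_right).trans ?_
    rw [Matroid.eRk_closure_eq]
    exact M₂.eRk_le_encard A
  have e1 : (I ∩ M₁.closure B).encard ≤ B.encard := by
    refine ((h1.subset inter_subset_left).encard_le_eRk_of_subset inter_subset_right).trans ?_
    rw [Matroid.eRk_closure_eq]
    exact M₁.eRk_le_encard B
  calc I.encard ≤ (I ∩ M₂.closure A ∪ I ∩ M₁.closure B).encard := by
        apply encard_le_encard
        rw [← inter_union_distrib_left]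
        exact subset_inter subset_rfl h
    _ ≤ _ := (encard_union_le _ _).trans (add_le_add e2 e1)

/-- Several exchanges `y i → x i` at once preserve independence if the matrix of admissible
exchanges is triangular.  The exchanges refer to `S`, which has to span each `x i`, but they are
carried out in an independent set `T` that may have further elements. -/
theorem indep_multi_exchange {M : Matroid α} {S T : Set α} (hT : M.Indep T) (hST : S ⊆ T)
    (x y : ℕ → α) (k : ℕ) (hx : ∀ i < k, x i ∈ M.closure S) (hxS : ∀ i < k, x i ∉ S)
    (hyS : ∀ i < k, y i ∈ S) (hxy : ∀ i < k, M.Indep (insert (x i) (S \ {y i})))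
    (hij : ∀ i j, i < j → j < k → ¬ M.Indep (insert (x j) (S \ {y i}))) :
    M.Indep (T \ y '' Iio k ∪ x '' Iio k) := by
  have hS := hT.subset hST
  induction k with
  | zero => simpa using hT
  | succ k ih =>
    have ih' := ih (fun i hi => hx i (by omega)) (fun i hi => hxS i (by omega))
      (fun i hi => hyS i (by omega)) (fun i hi => hxy i (by omega))
      (fun i j h1 h2 => hij i j h1 (by omega))
    -- the exchanges `y i → x k` with `i < k` are not possible, so `y i` is not needed to span `x k`
    have hpre : ∀ j ≤ k, x k ∈ M.closure (S \ y '' Iio j) := by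
      intro j
      induction j with
      | zero => intro _; simpa using hx k (by omega)
      | succ j ihj =>
        intro hj
        have h1 := ihj (by omega)
        have h2 : x k ∈ M.closure (S \ {y j}) :=
          mem_closure_of_not_indep_insert (hS.subset sdiff_subset)
            (M.mem_ground_of_mem_closure h1) (hij j k (by omega) (by omega))
        have h3 : x k ∈ M.closure ((S \ y '' Iio j) ∩ (S \ {y j})) := by
          rw [(hS.subset (union_subset sdiff_subset sdiff_subset)).closure_inter_eq_inter_closure]
          exact ⟨h1, h2⟩
        refine M.closure_subset_closure ?_ h3
        rintro z ⟨⟨hz, hz1⟩, -, hz2⟩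
        refine ⟨hz, ?_⟩
        rintro ⟨i, hi, rfl⟩
        rcases Nat.lt_succ_iff_lt_or_eq.1 hi with h | rfl
        · exact hz1 ⟨i, h, rfl⟩
        · exact hz2 rfl
    have hk : x k ∉ M.closure (S \ {y k}) := fun h =>
      not_indep_insert_of_mem_closure h subset_rfl (fun h' => hxS k (by omega) h'.1)
        (hxy k (by omega))
    have := indep_exchange_of_mem_closure (A := S \ y '' Iio k) (S := S) (y := y k) ih'
      (fun z hz => Or.inl ⟨hST hz.1, hz.2⟩) sdiff_subset (hpre k le_rfl) hk
    refine this.subset ?_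
    rintro z (⟨hz, hz1⟩ | ⟨i, hi, rfl⟩)
    · refine Or.inr ⟨Or.inl ⟨hz, fun h => hz1 ?_⟩, fun h => hz1 ?_⟩
      · obtain ⟨i, hi, rfl⟩ := h
        exact ⟨i, Nat.lt_succ_of_lt hi, rfl⟩
      · exact ⟨k, Nat.lt_succ_self k, h.symm⟩
    · rcases Nat.lt_succ_iff_lt_or_eq.1 hi with h | rfl
      · refine Or.inr ⟨Or.inr ⟨i, h, rfl⟩, fun h' => hxS i (by omega) ?_⟩
        rw [mem_singleton_iff.1 h']
        exact hyS k (by omega)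
      · exact Or.inl rfl

theorem le_add_length_of_isChain {r : α → α → Prop} {lev : α → ℕ}
    (hr : ∀ a b, r a b → lev b ≤ lev a + 1) (l : List α) (a : α) (h : (a :: l).IsChain r) :
    ∀ b ∈ (a :: l).getLast?, lev b ≤ lev a + l.length := by
  induction l generalizing a with
  | nil => simp
  | cons c l ih =>
    rw [List.isChain_cons_cons] at h
    intro b hb
    have h1 := ih c h.2 b (by simpa using hb)
    have h2 := hr a c h.1
    simp only [List.length_cons]
    omega

theorem exchangeGraph_adj_of_mem {M₁ M₂ : Matroid α} {S : Set α} {a b : α} (ha : a ∈ S) :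
    (exchangeGraph M₁ M₂ S).Adj a b ↔ b ∈ M₁.E \ S ∧ M₁.Indep (insert b (S \ {a})) := by
  simp [exchangeGraph, ha]

theorem exchangeGraph_adj_of_notMem {M₁ M₂ : Matroid α} {S : Set α} {a b : α} (ha : a ∉ S) :
    (exchangeGraph M₁ M₂ S).Adj a b ↔ a ∈ M₂.E ∧ b ∈ S ∧ M₂.Indep (insert a (S \ {b})) := by
  simp [exchangeGraph, ha]

section Levels

/-! In this section, `lev` is a potential on the exchange graph: it vanishes at the sources,
increases by at most one along an arc, and is at least `D` at the sinks.  The existence of a path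
`f 0, …, f D` from a source to a sink then makes this path a shortest one. -/

variable {M₁ M₂ : Matroid α} {S : Set α} {lev : α → ℕ} {D : ℕ} {f : ℕ → α}

theorem level_eq_of_path (hsrc : ∀ x ∈ extenders M₁ S, lev x = 0)
    (harc : ∀ a b, (exchangeGraph M₁ M₂ S).Adj a b → lev b ≤ lev a + 1)
    (hsink : ∀ x ∈ extenders M₂ S, D ≤ lev x) (hf0 : f 0 ∈ extenders M₁ S)
    (hfD : f D ∈ extenders M₂ S) (hf : ∀ i < D, (exchangeGraph M₁ M₂ S).Adj (f i) (f (i + 1))) :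
    ∀ i ≤ D, lev (f i) = i := by
  have h1 : ∀ i ≤ D, lev (f i) ≤ i := by
    intro i
    induction i with
    | zero => intro _; exact (hsrc _ hf0).le
    | succ i ih =>
      intro hi
      have := harc _ _ (hf i (by omega))
      have := ih (by omega)
      omega
  have h2 : ∀ i ≤ D, D ≤ lev (f (D - i)) + i := by
    intro i
    induction i with
    | zero => intro _; exact hsink _ hfD
    | succ i ih =>
      intro hi
      have := harc _ _ (hf (D - (i + 1)) (by omega))
      have := ih (by omega)
      rw [show D - (i + 1) + 1 = D - i by omega] at *
      omega
  intro i hi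
  have := h1 i hi
  have := h2 (D - i) (by omega)
  rw [show D - (D - i) = i by omega] at this
  omega

theorem isShortestAugmentingPath_of_levels (hsrc : ∀ x ∈ extenders M₁ S, lev x = 0)
    (harc : ∀ a b, (exchangeGraph M₁ M₂ S).Adj a b → lev b ≤ lev a + 1)
    (hsink : ∀ x ∈ extenders M₂ S, D ≤ lev x) (hf0 : f 0 ∈ extenders M₁ S)
    (hfD : f D ∈ extenders M₂ S) (hf : ∀ i < D, (exchangeGraph M₁ M₂ S).Adj (f i) (f (i + 1))) :
    IsShortestAugmentingPath M₁ M₂ S ((List.range (D + 1)).map f) := by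
  have hlev := level_eq_of_path hsrc harc hsink hf0 hfD hf
  refine ⟨⟨?_, ?_, ?_, ?_⟩, ?_⟩
  · rw [List.isChain_iff_getElem]
    intro i hi
    simp only [List.length_map, List.length_range] at hi
    simpa using hf i (by omega)
  · refine List.Nodup.map_on ?_ List.nodup_range
    intro i hi j hj hij
    rw [List.mem_range] at hi hj
    rw [← hlev i (by omega), ← hlev j (by omega), hij]
  · exact ⟨f 0, by simp [List.head?_range], hf0⟩
  · exact ⟨f D, by simp [List.getLast?_range], hfD⟩
  · intro Q hQ
    cases Q with
    | nil => simpa using hQ.source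
    | cons a l =>
      obtain ⟨x, hx, hxs⟩ := hQ.source
      obtain ⟨y, hy, hys⟩ := hQ.sink
      obtain rfl : a = x := by simpa using hx
      have h1 := le_add_length_of_isChain harc l a hQ.chain y hy
      have h2 := hsrc a hxs
      have h3 := hsink y hys
      simp only [List.length_map, List.length_range, List.length_cons]
      omega

theorem path_mem_iff (hf0 : f 0 ∈ extenders M₁ S)
    (hf : ∀ i < D, (exchangeGraph M₁ M₂ S).Adj (f i) (f (i + 1))) :
    ∀ i ≤ D, (f i ∈ S ↔ i % 2 = 1) := by
  intro i
  induction i with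
  | zero => intro _; simpa using hf0.1
  | succ i ih =>
    intro hi
    have h1 := hf i (by omega)
    have h2 := ih (by omega)
    by_cases h : f i ∈ S
    · rw [exchangeGraph_adj_of_mem h] at h1
      have := h2.1 h
      simp only [h1.1.2, false_iff]
      omega
    · rw [exchangeGraph_adj_of_notMem h] at h1
      have : i % 2 ≠ 1 := fun h' => h (h2.2 h')
      simp only [h1.2.1, true_iff]
      omega

theorem symmDiff_path_eq (hf0 : f 0 ∈ extenders M₁ S) {j : ℕ}
    (hf : ∀ i < 2 * j, (exchangeGraph M₁ M₂ S).Adj (f i) (f (i + 1))) :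
    symmDiff S {x | x ∈ (List.range (2 * j + 1)).map f} =
      S \ (fun i => f (2 * i + 1)) '' Iio j ∪ (fun i => f (2 * i)) '' Iio (j + 1) := by
  have hS := path_mem_iff hf0 hf
  ext z
  simp only [mem_symmDiff, mem_ofPred_eq, List.mem_map, List.mem_range, mem_union, mem_sdiff,
    mem_image, mem_Iio]
  constructor
  · rintro (⟨hz, h⟩ | ⟨⟨i, hi, rfl⟩, hz⟩)
    · exact Or.inl ⟨hz, fun ⟨i, hi, h'⟩ => h ⟨2 * i + 1, by omega, h'⟩⟩
    · have : i % 2 ≠ 1 := fun h => hz ((hS i (by omega)).2 h)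
      exact Or.inr ⟨i / 2, by omega, by congr 1; omega⟩
  · rintro (⟨hz, h⟩ | ⟨i, hi, rfl⟩)
    · refine Or.inl ⟨hz, ?_⟩
      rintro ⟨i, hi, rfl⟩
      have := (hS i (by omega)).1 hz
      exact h ⟨i / 2, by omega, by congr 1; omega⟩
    · refine Or.inr ⟨⟨2 * i, by omega, rfl⟩, fun h => ?_⟩
      have := (hS (2 * i) (by omega)).1 h
      omega

/-- Augmentation along a shortest path.  In each matroid this is an instance of
`indep_multi_exchange`: an exchange between two elements of the path that are more than one step
apart would be a shortcut. -/
theorem augment_of_levels (h1 : M₁.Indep S) (h2 : M₂.Indep S)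
    (hfin : S.Finite) (hsrc : ∀ x ∈ extenders M₁ S, lev x = 0)
    (harc : ∀ a b, (exchangeGraph M₁ M₂ S).Adj a b → lev b ≤ lev a + 1)
    (hsink : ∀ x ∈ extenders M₂ S, D ≤ lev x) (hf0 : f 0 ∈ extenders M₁ S)
    (hfD : f D ∈ extenders M₂ S) (hf : ∀ i < D, (exchangeGraph M₁ M₂ S).Adj (f i) (f (i + 1))) :
    M₁.Indep (symmDiff S {x | x ∈ (List.range (D + 1)).map f}) ∧
    M₂.Indep (symmDiff S {x | x ∈ (List.range (D + 1)).map f}) ∧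
    (symmDiff S {x | x ∈ (List.range (D + 1)).map f}).ncard = S.ncard + 1 := by
  have hlev := level_eq_of_path hsrc harc hsink hf0 hfD hf
  have hS := path_mem_iff hf0 hf
  have hD : D % 2 = 0 := by
    have := (hS D le_rfl).not.1 hfD.1
    omega
  obtain ⟨j, rfl⟩ : ∃ j, D = 2 * j := ⟨D / 2, by omega⟩
  have hodd : ∀ i < j, f (2 * i + 1) ∈ S := fun i hi => (hS _ (by omega)).2 (by omega)
  have heven : ∀ i ≤ j, f (2 * i) ∉ S := fun i hi h => by
    have := (hS _ (by omega)).1 h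
    omega
  rw [symmDiff_path_eq hf0 hf]
  refine ⟨?_, ?_, ?_⟩
  · -- the source extends `S`, and each later element outside `S` replaces its predecessor
    have hstep : ∀ i < j, f (2 * (i + 1)) ∈ M₁.E \ S ∧
        M₁.Indep (insert (f (2 * (i + 1))) (S \ {f (2 * i + 1)})) := fun i hi => by
      have := hf (2 * i + 1) (by omega)
      rwa [exchangeGraph_adj_of_mem (hodd i hi)] at this
    have := indep_multi_exchange (M := M₁) (S := S) hf0.2 (subset_insert _ _)
      (fun i => f (2 * (i + 1))) (fun i => f (2 * i + 1)) j ?_ (fun i hi => heven _ (by omega))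
      hodd (fun i hi => (hstep i hi).2) ?_
    · refine this.subset ?_
      rintro z (⟨hz, hz'⟩ | ⟨i, hi, rfl⟩)
      · exact Or.inl ⟨mem_insert_of_mem _ hz, hz'⟩
      · rcases i with _ | i
        · refine Or.inl ⟨mem_insert _ _, ?_⟩
          rintro ⟨i, hi, h⟩
          exact hf0.1 (by simpa [← h] using hodd i hi)
        · exact Or.inr ⟨i, Nat.lt_of_succ_lt_succ hi, rfl⟩
    · intro i hi
      refine mem_closure_of_not_indep_insert h1 (hstep i hi).1.1 fun h => ?_
      have := hsrc _ ⟨(hstep i hi).1.2, h⟩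
      rw [hlev _ (by omega)] at this
      omega
    · intro i i' hii' hi' h
      have := harc _ _ ((exchangeGraph_adj_of_mem (M₂ := M₂) (hodd i (by omega))).2
        ⟨(hstep i' hi').1, h⟩)
      rw [hlev _ (by omega), hlev _ (by omega)] at this
      omega
  · have hstep : ∀ i < j, f (2 * i) ∈ M₂.E ∧
        M₂.Indep (insert (f (2 * i)) (S \ {f (2 * i + 1)})) := fun i hi => by
      have := hf (2 * i) (by omega)
      rw [exchangeGraph_adj_of_notMem (heven i hi.le)] at this
      exact ⟨this.1, this.2.2⟩
    -- the sink extends `S`; the pairs are numbered from the sink to the source, which makes the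
    -- matrix of exchanges in the second matroid triangular
    have := indep_multi_exchange (M := M₂) (S := S) hfD.2 (subset_insert _ _)
      (fun i => f (2 * (j - 1 - i))) (fun i => f (2 * (j - 1 - i) + 1)) j ?_
      (fun i hi => heven _ (by omega)) (fun i hi => hodd _ (by omega))
      (fun i hi => (hstep _ (by omega)).2) ?_
    · refine this.subset ?_
      rintro z (⟨hz, hz'⟩ | ⟨i, hi, rfl⟩)
      · refine Or.inl ⟨mem_insert_of_mem _ hz, ?_⟩
        rintro ⟨i, hi, rfl⟩
        rw [mem_Iio] at hi
        exact hz' ⟨j - 1 - i, by rw [mem_Iio]; omega, rfl⟩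
      · rw [mem_Iio] at hi
        rcases Nat.lt_succ_iff_lt_or_eq.1 hi with hi | rfl
        · exact Or.inr ⟨j - 1 - i, by rw [mem_Iio]; omega, by
            change f _ = f _
            congr 2; omega⟩
        · refine Or.inl ⟨mem_insert _ _, ?_⟩
          rintro ⟨i', hi', h⟩
          rw [mem_Iio] at hi'
          exact hfD.1 (by simpa [← h] using hodd (i - 1 - i') (by omega))
    · intro i hi
      refine mem_closure_of_not_indep_insert h2 (hstep _ (by omega)).1 fun h => ?_
      have := hsink _ ⟨heven (j - 1 - i) (by omega), h⟩
      rw [hlev _ (by omega)] at this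
      omega
    · intro i i' hii' hi' h
      have := harc _ _ ((exchangeGraph_adj_of_notMem (M₁ := M₁) (M₂ := M₂)
        (heven (j - 1 - i') (by omega))).2
        ⟨(hstep _ (by omega)).1, hodd (j - 1 - i) (by omega), h⟩)
      rw [hlev _ (by omega), hlev _ (by omega)] at this
      omega
  · have hinj : InjOn f (Iio (2 * j + 1)) := by
      intro a ha b hb hab
      rw [mem_Iio] at ha hb
      rw [← hlev a (by omega), ← hlev b (by omega), hab]
    have c1 : ((fun i => f (2 * i + 1)) '' Iio j).ncard = j := by
      rw [InjOn.ncard_image]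
      · simp [← Nat.card_coe_set_eq]
      · intro a ha b hb hab
        rw [mem_Iio] at ha hb
        have := hinj (by rw [mem_Iio]; omega) (by rw [mem_Iio]; omega) hab
        omega
    have c2 : ((fun i => f (2 * i)) '' Iio (j + 1)).ncard = j + 1 := by
      rw [InjOn.ncard_image]
      · simp [← Nat.card_coe_set_eq]
      · intro a ha b hb hab
        rw [mem_Iio] at ha hb
        have := hinj (by rw [mem_Iio]; omega) (by rw [mem_Iio]; omega) hab
        omega
    have hsub : (fun i => f (2 * i + 1)) '' Iio j ⊆ S := by
      rintro _ ⟨i, hi, rfl⟩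
      exact hodd i hi
    have hle := ncard_le_ncard hsub hfin
    rw [ncard_union_eq _ (hfin.subset sdiff_subset) ((finite_Iio _).image _), c2,
      ncard_sdiff hsub ((finite_Iio _).image _), c1]
    · rw [c1] at hle
      omega
    · rw [Set.disjoint_left]
      rintro z hz ⟨i, hi, rfl⟩
      exact heven i (Nat.lt_succ_iff.1 hi) hz.1

end Levels

end Matroid

/-! ### Numbering the elements -/

section Transfer

variable {α β : Type*} {M₁ M₂ : Matroid α} {elt : β → α} {E S : Set β}

theorem comapOn_indep_iff_of_subset {M : Matroid α} {Q : Set β} (helt : InjOn elt E)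
    (hQ : Q ⊆ E) : (M.comapOn E elt).Indep Q ↔ M.Indep (elt '' Q) := by
  rw [Matroid.comapOn_indep_iff]
  exact ⟨fun h => h.1, fun h => ⟨h, helt.mono hQ, hQ⟩⟩

theorem image_insert_sdiff_singleton (helt : InjOn elt E) (hS : S ⊆ E) {a b : β} (ha : a ∈ E) :
    insert (elt b) (elt '' S \ {elt a}) = elt '' insert b (S \ {a}) := by
  rw [image_insert_eq]
  congr 1
  ext z
  constructor
  · rintro ⟨⟨c, hc, rfl⟩, hca⟩
    exact ⟨c, ⟨hc, fun h => hca (congrArg elt h)⟩, rfl⟩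
  · rintro ⟨c, ⟨hc, hca⟩, rfl⟩
    exact ⟨⟨c, hc, rfl⟩, fun h => hca (helt (hS hc) ha h)⟩

theorem mem_extenders_comapOn_iff {M : Matroid α} (helt : InjOn elt E) (hS : S ⊆ E) {x : β}
    (hx : x ∈ E) : x ∈ extenders (M.comapOn E elt) S ↔ elt x ∈ extenders M (elt '' S) := by
  simp only [extenders, mem_ofPred_eq]
  rw [comapOn_indep_iff_of_subset helt (insert_subset hx hS), image_insert_eq,
    helt.mem_image_iff hS hx]

theorem exchangeGraph_comapOn_adj_iff (h1 : BijOn elt E M₁.E) (h2 : M₁.E = M₂.E) (hS : S ⊆ E)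
    {a b : β} (ha : a ∈ E) (hb : b ∈ E) :
    (exchangeGraph (M₁.comapOn E elt) (M₂.comapOn E elt) S).Adj a b ↔
      (exchangeGraph M₁ M₂ (elt '' S)).Adj (elt a) (elt b) := by
  have helt := h1.injOn
  simp only [exchangeGraph, mem_sdiff, helt.mem_image_iff hS ha, helt.mem_image_iff hS hb,
    image_insert_sdiff_singleton helt hS ha, image_insert_sdiff_singleton helt hS hb,
    Matroid.comapOn_ground_eq, ha, hb, h1.mapsTo ha, h1.mapsTo hb, ← h2,
    comapOn_indep_iff_of_subset helt (insert_subset hb (sdiff_subset.trans hS)),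
    comapOn_indep_iff_of_subset helt (insert_subset ha (sdiff_subset.trans hS))]

/-- The ground set contains the source, and no arc leaves it. -/
theorem IsAugmentingPath.subset_ground {S : Set α} {P : List α}
    (hP : IsAugmentingPath M₁ M₂ S P) (hS : S ⊆ M₁.E) :
    ∀ x ∈ P, x ∈ M₁.E := by
  obtain ⟨hc, -, ⟨x, hx, hxs⟩, -⟩ := hP
  cases P with
  | nil => simp
  | cons a l =>
    obtain rfl : a = x := by simpa using hx
    have ha : a ∈ M₁.E := hxs.2.subset_ground (mem_insert _ _)
    clear hx hxs
    induction l generalizing a with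
    | nil => simpa using ha
    | cons b l ih =>
      rw [List.isChain_cons_cons] at hc
      have hb : b ∈ M₁.E := by
        rcases hc.1 with h | h
        · exact h.2.1.1
        · exact hS h.2.1
      intro z hz
      rcases List.mem_cons.1 hz with rfl | hz
      · exact ha
      · exact ih b hc.2 hb z hz

theorem isAugmentingPath_comapOn_iff (h1 : BijOn elt E M₁.E) (h2 : M₁.E = M₂.E) (hS : S ⊆ E)
    {P : List β} (hP : ∀ x ∈ P, x ∈ E) :
    IsAugmentingPath (M₁.comapOn E elt) (M₂.comapOn E elt) S P ↔
      IsAugmentingPath M₁ M₂ (elt '' S) (P.map elt) := by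
  have helt := h1.injOn
  have e1 : P.IsChain (exchangeGraph (M₁.comapOn E elt) (M₂.comapOn E elt) S).Adj ↔
      (P.map elt).IsChain (exchangeGraph M₁ M₂ (elt '' S)).Adj := by
    rw [List.isChain_iff_getElem, List.isChain_iff_getElem]
    simp only [List.length_map, List.getElem_map]
    refine forall_congr' fun i => forall_congr' fun hi => ?_
    exact exchangeGraph_comapOn_adj_iff h1 h2 hS (hP _ (List.getElem_mem _))
      (hP _ (List.getElem_mem _))
  have e2 : P.Nodup ↔ (P.map elt).Nodup :=
    ⟨fun h => h.map_on fun a ha b hb hab => helt (hP a ha) (hP b hb) hab, fun h => h.of_map _⟩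
  have e3 : (∃ x ∈ P.head?, x ∈ extenders (M₁.comapOn E elt) S) ↔
      ∃ x ∈ (P.map elt).head?, x ∈ extenders M₁ (elt '' S) := by
    cases P with
    | nil => simp
    | cons a l => simp [mem_extenders_comapOn_iff helt hS (hP a (by simp))]
  have e4 : (∃ x ∈ P.getLast?, x ∈ extenders (M₂.comapOn E elt) S) ↔
      ∃ x ∈ (P.map elt).getLast?, x ∈ extenders M₂ (elt '' S) := by
    cases h : P.getLast? with
    | none => simp [h]
    | some a =>
      simp [h, mem_extenders_comapOn_iff helt hS (hP a (List.mem_of_getLast? h))]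
  exact ⟨fun h => ⟨e1.1 h.1, e2.1 h.2, e3.1 h.3, e4.1 h.4⟩,
    fun h => ⟨e1.2 h.1, e2.2 h.2, e3.2 h.3, e4.2 h.4⟩⟩

theorem IsAugmentingPath.exists_eq_map {Q : List α} (h1 : BijOn elt E M₁.E) (h2 : M₁.E = M₂.E)
    (hS : S ⊆ E) (hQ : IsAugmentingPath M₁ M₂ (elt '' S) Q) :
    ∃ P : List β, P.map elt = Q ∧ (∀ x ∈ P, x ∈ E) ∧
      IsAugmentingPath (M₁.comapOn E elt) (M₂.comapOn E elt) S P := by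
  have hE := hQ.subset_ground (h1.image_eq ▸ image_mono hS)
  have : ∃ P : List β, P.map elt = Q ∧ ∀ x ∈ P, x ∈ E := by
    clear hQ
    induction Q with
    | nil => exact ⟨[], by simp⟩
    | cons a l ih =>
      obtain ⟨P, hP, hPE⟩ := ih fun x hx => hE x (by simp [hx])
      obtain ⟨b, hb, rfl⟩ := h1.surjOn (hE a (by simp))
      exact ⟨b :: P, by simp [hP], by simpa [hb] using hPE⟩
  obtain ⟨P, rfl, hPE⟩ := this
  exact ⟨P, rfl, hPE, (isAugmentingPath_comapOn_iff h1 h2 hS hPE).2 hQ⟩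

theorem Augments.image {S' : Set β} (h1 : BijOn elt E M₁.E) (h2 : M₁.E = M₂.E) (hS : S ⊆ E)
    (h : Augments (M₁.comapOn E elt) (M₂.comapOn E elt) S S') :
    Augments M₁ M₂ (elt '' S) (elt '' S') := by
  obtain ⟨P, ⟨hP, hmin⟩, rfl⟩ := h
  have hPE : ∀ x ∈ P, x ∈ E := hP.subset_ground hS
  refine ⟨P.map elt, ⟨(isAugmentingPath_comapOn_iff h1 h2 hS hPE).1 hP, fun Q hQ => ?_⟩, ?_⟩
  · obtain ⟨P', rfl, -, hP'⟩ := hQ.exists_eq_map h1 h2 hS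
    simpa using hmin P' hP'
  · ext z
    have helt := h1.injOn
    simp only [mem_image, mem_symmDiff, mem_ofPred_eq, List.mem_map]
    constructor
    · rintro ⟨x, (⟨hx, hxP⟩ | ⟨hxP, hx⟩), rfl⟩
      · refine Or.inl ⟨⟨x, hx, rfl⟩, fun ⟨y, hy, hyx⟩ => hxP ?_⟩
        rwa [← helt (hPE y hy) (hS hx) hyx]
      · refine Or.inr ⟨⟨x, hxP, rfl⟩, fun ⟨y, hy, hyx⟩ => hx ?_⟩
        rwa [← helt (hS hy) (hPE x hxP) hyx]
    · rintro (⟨⟨x, hx, rfl⟩, h⟩ | ⟨⟨x, hx, rfl⟩, h⟩)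
      · exact ⟨x, Or.inl ⟨hx, fun h' => h ⟨x, h', rfl⟩⟩, rfl⟩
      · exact ⟨x, Or.inr ⟨hx, fun h' => h ⟨x, h', rfl⟩⟩, rfl⟩

end Transfer

/-! ### Program logic with costs -/

section Machine

/-- The registers that a program may write. -/
def Cmd.regs : Cmd → List Reg
  | .skip => []
  | .set x _ => [x]
  | .store _ _ _ => []
  | .seq c d => c.regs ++ d.regs
  | .ite _ c d => c.regs ++ d.regs
  | .loop _ c => c.regs
  | .call _ _ _ x => [x]
  | .emit _ _ => []

/-- The arrays that a program may write. -/
def Cmd.arrs : Cmd → List Arr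
  | .skip => []
  | .set _ _ => []
  | .store A _ _ => [A]
  | .seq c d => c.arrs ++ d.arrs
  | .ite _ c d => c.arrs ++ d.arrs
  | .loop _ c => c.arrs
  | .call _ _ _ _ => []
  | .emit _ _ => []

/-- Whether a program contains no output command. -/
def Cmd.silent : Cmd → Bool
  | .seq c d => c.silent && d.silent
  | .ite _ c d => c.silent && d.silent
  | .loop _ c => c.silent
  | .emit _ _ => false
  | _ => true

/-- The states `s` and `s'` have the same output and differ at most in the registers `rs` and in
the arrays `as`. -/
structure State.EqExcept (rs : List Reg) (as : List Arr) (s s' : State) : Prop where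
  reg : ∀ x, x ∉ rs → s'.reg x = s.reg x
  arr : ∀ A, A ∉ as → s'.arr A = s.arr A
  out : s'.out = s.out

variable {rs rs' : List Reg} {as as' : List Arr} {s s' s'' : State}

theorem State.EqExcept.rfl : State.EqExcept rs as s s :=
  ⟨fun _ _ => .refl _, fun _ _ => .refl _, .refl _⟩

theorem State.EqExcept.trans (h : State.EqExcept rs as s s') (h' : State.EqExcept rs as s' s'') :
    State.EqExcept rs as s s'' :=
  ⟨fun x hx => (h'.reg x hx).trans (h.reg x hx), fun A hA => (h'.arr A hA).trans (h.arr A hA),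
    h'.out.trans h.out⟩

theorem State.EqExcept.mono (h : State.EqExcept rs as s s') (hr : ∀ x ∈ rs, x ∈ rs')
    (ha : ∀ A ∈ as, A ∈ as') : State.EqExcept rs' as' s s' :=
  ⟨fun x hx => h.reg x fun h' => hx (hr x h'), fun A hA => h.arr A fun h' => hA (ha A h'), h.out⟩

variable {orc : Fin 2 → Set ℕ → Prop} {R : ℕ}

theorem Exec.eqExcept {c : Cmd} {w q : ℕ} (h : Exec orc c s s' w q) (hc : c.silent = true) :
    State.EqExcept c.regs c.arrs s s' := by
  induction h with
  | skip => exact .rfl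
  | set x e s =>
    refine ⟨fun y hy => ?_, fun _ _ => rfl, rfl⟩
    simp only [Cmd.regs, List.mem_singleton] at hy
    simp [State.setReg, hy]
  | store A i e s =>
    refine ⟨fun _ _ => rfl, fun B hB => ?_, rfl⟩
    simp only [Cmd.arrs, List.mem_singleton] at hB
    simp [State.setArr, hB]
  | seq _ _ ih1 ih2 =>
    simp only [Cmd.silent, Bool.and_eq_true] at hc
    exact ((ih1 hc.1).mono (fun x hx => List.mem_append_left _ hx)
      fun x hx => List.mem_append_left _ hx).trans
      ((ih2 hc.2).mono (fun x hx => List.mem_append_right _ hx)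
      fun x hx => List.mem_append_right _ hx)
  | ite_true _ _ ih =>
    simp only [Cmd.silent, Bool.and_eq_true] at hc
    exact (ih hc.1).mono (fun x hx => List.mem_append_left _ hx)
      fun x hx => List.mem_append_left _ hx
  | ite_false _ _ ih =>
    simp only [Cmd.silent, Bool.and_eq_true] at hc
    exact (ih hc.2).mono (fun x hx => List.mem_append_right _ hx)
      fun x hx => List.mem_append_right _ hx
  | loop_true _ _ _ ih1 ih2 => exact (ih1 hc).trans (ih2 hc)
  | loop_false _ => exact .rfl
  | @call_true j A len x s _ =>
    refine ⟨fun y hy => ?_, fun _ _ => rfl, rfl⟩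
    simp only [Cmd.regs, List.mem_singleton] at hy
    simp [State.setReg, hy]
  | @call_false j A len x s _ =>
    refine ⟨fun y hy => ?_, fun _ _ => rfl, rfl⟩
    simp only [Cmd.regs, List.mem_singleton] at hy
    simp [State.setReg, hy]
  | emit => simp [Cmd.silent] at hc

/-- Total correctness with costs: started in the state `s`, the program `c` halts in some state
`s'` after some number `w` of steps and `q` of oracle calls such that `Q s' (w + R * q)` holds.
The single number `w + R * q` bounds both costs. -/
def Runs (orc : Fin 2 → Set ℕ → Prop) (R : ℕ) (c : Cmd) (s : State) (Q : State → ℕ → Prop) :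
    Prop :=
  ∃ s' w q, Exec orc c s s' w q ∧ Q s' (w + R * q)

variable {c d : Cmd} {b : Exp} {Q Q' : State → ℕ → Prop}

theorem Runs.mono (h : Runs orc R c s Q) (hQ : ∀ s' t, Q s' t → Q' s' t) : Runs orc R c s Q' := by
  obtain ⟨s', w, q, he, hq⟩ := h
  exact ⟨s', w, q, he, hQ _ _ hq⟩

theorem Runs.frame (h : Runs orc R c s Q) (hc : c.silent = true) :
    Runs orc R c s fun s' t => Q s' t ∧ State.EqExcept c.regs c.arrs s s' := by
  obtain ⟨s', w, q, he, hq⟩ := h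
  exact ⟨s', w, q, he, hq, he.eqExcept hc⟩

theorem runs_skip_iff : Runs orc R .skip s Q ↔ Q s 1 := by
  constructor
  · rintro ⟨s', w, q, ⟨⟩, hQ⟩
    simpa using hQ
  · exact fun h => ⟨_, _, _, .skip s, by simpa using h⟩

theorem runs_set_iff {x : Reg} {e : Exp} :
    Runs orc R (.set x e) s Q ↔ Q (s.setReg x (e.eval s)) (e.cost + 1) := by
  constructor
  · rintro ⟨s', w, q, ⟨⟩, hQ⟩
    simpa using hQ
  · exact fun h => ⟨_, _, _, .set x e s, by simpa using h⟩

theorem runs_store_iff {A : Arr} {i e : Exp} :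
    Runs orc R (.store A i e) s Q ↔
      Q (s.setArr A (i.eval s) (e.eval s)) (i.cost + e.cost + 1) := by
  constructor
  · rintro ⟨s', w, q, ⟨⟩, hQ⟩
    simpa using hQ
  · exact fun h => ⟨_, _, _, .store A i e s, by simpa using h⟩

theorem runs_emit_iff {A : Arr} {e : Exp} :
    Runs orc R (.emit A e) s Q ↔
      Q { s with out := s.out ++ [s.slice A (e.eval s)] } (e.cost + 1 + e.eval s) := by
  constructor
  · rintro ⟨s', w, q, ⟨⟩, hQ⟩
    simpa using hQ
  · exact fun h => ⟨_, _, _, .emit A e s, by simpa using h⟩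

theorem runs_seq_iff :
    Runs orc R (.seq c d) s Q ↔
      Runs orc R c s fun s' t => Runs orc R d s' fun s'' t' => Q s'' (t + t') := by
  constructor
  · rintro ⟨s', _, _, h, hQ⟩
    cases h with
    | seq hc hd => exact ⟨_, _, _, hc, _, _, _, hd, by convert hQ using 1; ring⟩
  · rintro ⟨s', _, _, hc, _, _, _, hd, hQ⟩
    exact ⟨_, _, _, .seq hc hd, by convert hQ using 1; ring⟩

theorem runs_ite_iff :
    Runs orc R (.ite b c d) s Q ↔
      (b.eval s ≠ 0 → Runs orc R c s fun s' t => Q s' (b.cost + 1 + t)) ∧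
      (b.eval s = 0 → Runs orc R d s fun s' t => Q s' (b.cost + 1 + t)) := by
  constructor
  · rintro ⟨s', _, _, h, hQ⟩
    cases h with
    | ite_true hb hc =>
      exact ⟨fun _ => ⟨_, _, _, hc, by simpa [add_assoc] using hQ⟩, fun h => absurd h hb⟩
    | ite_false hb hc =>
      exact ⟨fun h => absurd hb h, fun _ => ⟨_, _, _, hc, by simpa [add_assoc] using hQ⟩⟩
  · rintro ⟨h1, h2⟩
    by_cases hb : b.eval s = 0
    · obtain ⟨_, _, _, hc, hQ⟩ := h2 hb
      exact ⟨_, _, _, .ite_false hb hc, by simpa [add_assoc] using hQ⟩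
    · obtain ⟨_, _, _, hc, hQ⟩ := h1 hb
      exact ⟨_, _, _, .ite_true hb hc, by simpa [add_assoc] using hQ⟩

open Classical in
theorem runs_call {j : Fin 2} {A : Arr} {e : Exp} {x : Reg}
    (h : Q (s.setReg x (if orc j {z | z ∈ s.slice A (e.eval s)} then 1 else 0))
      (e.cost + 1 + R)) : Runs orc R (.call j A e x) s Q := by
  by_cases ho : orc j {z | z ∈ s.slice A (e.eval s)}
  · rw [if_pos ho] at h
    exact ⟨_, _, _, .call_true ho, by simpa using h⟩
  · rw [if_neg ho] at h
    exact ⟨_, _, _, .call_false ho, by simpa using h⟩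

/-- The rule for loops.  The invariant `I i s t` may depend on a number `i`, which decreases, on
the state, and on the cost `t` so far, so that amortized bounds can be part of it. -/
theorem Runs.loop (I : ℕ → State → ℕ → Prop) {i : ℕ} (h0 : I i s 0)
    (step : ∀ i s t, I i s t → b.eval s ≠ 0 →
      Runs orc R c s fun s' t' => ∃ i' < i, I i' s' (t + (b.cost + 1 + t')))
    (exit : ∀ i s t, I i s t → b.eval s = 0 → Q s (t + (b.cost + 1))) :
    Runs orc R (.loop b c) s Q := by
  suffices H : ∀ i s t, I i s t →
      Runs orc R (.loop b c) s fun s' t' => Q s' (t + t') by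
    simpa using H i s 0 h0
  intro i
  induction i using Nat.strong_induction_on with
  | _ i ih =>
    intro s t hI
    by_cases hb : b.eval s = 0
    · exact ⟨_, _, _, .loop_false hb, by simpa using exit i s t hI hb⟩
    · obtain ⟨s1, w1, q1, hc, i', hi', hI'⟩ := step i s t hI hb
      obtain ⟨s2, w2, q2, hl, hQ⟩ := ih i' hi' s1 _ hI'
      exact ⟨s2, _, _, .loop_true hb hc hl, by convert hQ using 1; ring⟩

/-- The rule for loops, with the information that only the variables written by the body change. -/
theorem Runs.loop_frame (hc : c.silent = true) (I : ℕ → State → ℕ → Prop) {i : ℕ} (h0 : I i s 0)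
    (step : ∀ i s' t, I i s' t → State.EqExcept c.regs c.arrs s s' → b.eval s' ≠ 0 →
      Runs orc R c s' fun s'' t' => ∃ i' < i, I i' s'' (t + (b.cost + 1 + t')))
    (exit : ∀ i s' t, I i s' t → State.EqExcept c.regs c.arrs s s' → b.eval s' = 0 →
      Q s' (t + (b.cost + 1))) :
    Runs orc R (.loop b c) s Q := by
  refine Runs.loop (fun i s' t => I i s' t ∧ State.EqExcept c.regs c.arrs s s') ⟨h0, .rfl⟩ ?_ ?_
  · rintro i s' t ⟨hI, he⟩ hb
    refine ((step i s' t hI he hb).frame hc).mono ?_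
    rintro s'' t' ⟨⟨i', hi', hI'⟩, he'⟩
    exact ⟨i', hi', hI', he.trans he'⟩
  · rintro i s' t ⟨hI, he⟩ hb
    exact exit i s' t hI he hb

@[simp] theorem State.setReg_reg (s : State) (x y : Reg) (w : ℕ) :
    (s.setReg x w).reg y = if y = x then w else s.reg y := by
  simp [State.setReg, Function.update_apply]

@[simp] theorem State.setReg_arr (s : State) (x : Reg) (A : Arr) (w : ℕ) :
    (s.setReg x w).arr A = s.arr A := rfl

@[simp] theorem State.setReg_out (s : State) (x : Reg) (w : ℕ) : (s.setReg x w).out = s.out := rfl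

@[simp] theorem State.setArr_reg (s : State) (A : Arr) (i w : ℕ) (x : Reg) :
    (s.setArr A i w).reg x = s.reg x := rfl

@[simp] theorem State.setArr_arr (s : State) (A B : Arr) (i w : ℕ) :
    (s.setArr A i w).arr B = if B = A then Function.update (s.arr A) i w else s.arr B := by
  simp only [State.setArr, Function.update_apply]

@[simp] theorem State.setArr_out (s : State) (A : Arr) (i w : ℕ) :
    (s.setArr A i w).out = s.out := rfl

theorem State.eqExcept_setReg (h : State.EqExcept rs as s s') {x : Reg} (hx : x ∈ rs) (w : ℕ) :
    State.EqExcept rs as s (s'.setReg x w) := by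
  refine ⟨fun y hy => ?_, h.arr, h.out⟩
  have hyx : y ≠ x := by
    rintro rfl
    exact hy hx
  rw [State.setReg_reg, if_neg hyx, h.reg y hy]

end Machine

section Blocks

open Algorithm

variable {orc : Fin 2 → Set ℕ → Prop} {R : ℕ} {s : State} {Q : State → ℕ → Prop}

theorem runs_block_nil : Runs orc R (block []) s Q ↔ Q s 1 := runs_skip_iff

theorem runs_block_cons {c : Cmd} {L : List Cmd} :
    Runs orc R (block (c :: L)) s Q ↔
      Runs orc R c s fun s' t => Runs orc R (block L) s' fun s'' t' => Q s'' (t + t') :=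
  runs_seq_iff

/-- The rule for `forAll`.  The invariant `I j s t` holds before the iteration with number `j`, in
the state `s` and with cost `t` so far. -/
theorem Runs.forAll {x : Reg} {c : Cmd} (hc : c.silent = true) (hxn : x ≠ .n)
    (hx : x ∉ c.regs) (hn : Reg.n ∉ c.regs) (I : ℕ → State → ℕ → Prop)
    (h0 : I 0 (s.setReg x 0) 0)
    (step : ∀ s' t, I (s'.reg x) s' t → s'.reg x < s.reg .n →
      State.EqExcept (x :: c.regs) c.arrs s s' →
      Runs orc R c s' fun s'' t' =>
        I (s'.reg x + 1) (s''.setReg x (s'.reg x + 1)) (t + t' + 9))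
    (exit : ∀ s' t, I (s.reg .n) s' t → State.EqExcept (x :: c.regs) c.arrs s s' → Q s' (t + 7)) :
    Runs orc R (forAll x c) s Q := by
  unfold Algorithm.forAll
  rw [runs_block_cons, runs_set_iff, runs_block_cons]
  refine Runs.loop (fun i s' t => I (s'.reg x) s' t ∧ i + s'.reg x = s.reg .n ∧
    s'.reg .n = s.reg .n ∧ State.EqExcept (x :: c.regs) c.arrs s s') (i := s.reg .n) ?_ ?_ ?_
  · refine ⟨?_, ?_, ?_, ?_⟩
    · simpa [State.setReg_reg, Exp.eval] using h0
    · simp [State.setReg_reg, Exp.eval]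
    · simp [State.setReg_reg, hxn.symm]
    · exact State.eqExcept_setReg .rfl (by simp) _
  · rintro i s' t ⟨hI, hi, hn', he⟩ hb
    have hlt : s'.reg x < s.reg .n := by
      by_contra h
      simp [Exp.eval, hn', h] at hb
    rw [runs_block_cons]
    refine ((step s' t hI hlt he).frame hc).mono ?_
    rintro s'' t' ⟨hI', he'⟩
    rw [runs_block_cons, runs_set_iff, runs_block_nil]
    have hx' := he'.reg x hx
    have hn'' := he'.reg .n hn
    refine ⟨i - 1, by omega, ?_, ?_, ?_, ?_⟩
    · simp only [Exp.eval, hx', State.setReg_reg, if_true, Exp.cost]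
      convert hI' using 1
      ring
    · simp only [Exp.eval, hx', State.setReg_reg, if_true]
      omega
    · simp [State.setReg_reg, hxn.symm, hn'', hn']
    · exact State.eqExcept_setReg (he.trans (he'.mono (fun y hy => List.mem_cons_of_mem _ hy)
        fun A hA => hA)) (by simp) _
  · rintro i s' t ⟨hI, hi, hn', he⟩ hb
    have hlt : ¬ s'.reg x < s.reg .n := by
      intro h
      simp [Exp.eval, hn', h] at hb
    rw [runs_block_nil]
    have hxe : s'.reg x = s.reg .n := by omega
    rw [hxe] at hI
    convert exit s' t hI he using 1
    simp only [Exp.cost]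
    omega

end Blocks

/-! ### Queries and binary search -/

section Queries

open Algorithm

attribute [local simp] Exp.eval Exp.cost

variable {orc : Fin 2 → Set ℕ → Prop} {R : ℕ} {s : State} {Q : State → ℕ → Prop}

/-- The set of elements in the current query. -/
def State.query (s : State) : Set ℕ := {z | z ∈ s.slice .qry (s.reg .len)}

theorem State.mem_query_iff {z : ℕ} : z ∈ s.query ↔ ∃ i < s.reg .len, s.arr .qry i = z := by
  simp [State.query, State.slice]

theorem runs_startQuery {e : Exp}
    (h : ∀ s', s'.query = {e.eval s} → State.EqExcept [.len] [.qry] s s' →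
      Q s' (e.cost + 5)) : Runs orc R (startQuery e) s Q := by
  unfold startQuery
  simp only [runs_block_cons, runs_store_iff, runs_set_iff, runs_block_nil]
  convert h _ ?_ ?_ using 1
  · simp only [Exp.cost]; omega
  · ext z
    simp [State.mem_query_iff, eq_comm]
  · refine ⟨fun x hx => ?_, fun A hA => ?_, rfl⟩
    · simp only [List.mem_singleton] at hx
      simp [hx]
    · simp only [List.mem_singleton] at hA
      simp [hA]

theorem runs_appendRange {e : Exp} {y : Reg} (hy1 : y ≠ .t) (hy2 : y ≠ .len)
    (h : ∀ s', s'.query = s.query ∪ s.arr .sol '' Ico (e.eval s) (s.reg y) →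
      State.EqExcept [.t, .len] [.qry] s s' →
      Q s' (e.cost + 6 + 17 * (s.reg y - e.eval s))) :
    Runs orc R (appendRange e (.reg y)) s Q := by
  unfold appendRange
  simp only [runs_block_cons, runs_set_iff, runs_block_nil]
  refine Runs.loop_frame rfl (fun i s' t => i + s'.reg .t = e.eval s + (s.reg y - e.eval s) ∧
    e.eval s ≤ s'.reg .t ∧ s'.query = s.query ∪ s.arr .sol '' Ico (e.eval s) (s'.reg .t) ∧
    t = 17 * (s'.reg .t - e.eval s)) (i := s.reg y - e.eval s) ?_ ?_ ?_
  · refine ⟨by simp; omega, by simp, ?_, by simp⟩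
    ext z
    simp [State.mem_query_iff]
  · rintro i s' t ⟨hi, hle, hq, ht⟩ he hb
    have hy : s'.reg y = s.reg y := by
      rw [he.reg y (by simp [Cmd.regs, block, hy1, hy2])]
      simp [hy1]
    have hsol : s'.arr .sol = s.arr .sol := by
      rw [he.arr .sol (by simp [Cmd.arrs, block])]
      simp
    have hlt : s'.reg .t < s.reg y := by
      by_contra h
      simp [hy, h] at hb
    simp only [runs_block_cons, runs_set_iff, runs_store_iff, runs_block_nil]
    refine ⟨i - 1, by omega, ?_, ?_, ?_, ?_⟩
    · simp; omega
    · simp; omega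
    · ext z
      have hq' := Set.ext_iff.1 hq z
      simp only [State.mem_query_iff, mem_union, mem_image, mem_Ico] at hq' ⊢
      simp only [State.setReg_reg, State.setArr_reg, State.setReg_arr, State.setArr_arr, Exp.eval,
        Function.update_apply, hsol, reduceCtorEq, if_false, if_true]
      constructor
      · rintro ⟨j, hj, hz⟩
        by_cases hjl : j = s'.reg .len
        · rw [if_pos hjl] at hz
          exact Or.inr ⟨s'.reg .t, ⟨hle, by omega⟩, hz⟩
        · rw [if_neg hjl] at hz
          rcases hq'.1 ⟨j, by omega, hz⟩ with h1 | ⟨u, hu, hz⟩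
          · exact Or.inl h1
          · exact Or.inr ⟨u, ⟨hu.1, by omega⟩, hz⟩
      · have key : (∃ i < s'.reg .len, s'.arr .qry i = z) →
            ∃ i < s'.reg .len + 1, (if i = s'.reg .len then s.arr .sol (s'.reg .t)
              else s'.arr .qry i) = z := by
          rintro ⟨j, hj, hz⟩
          exact ⟨j, by omega, by rwa [if_neg (by omega)]⟩
        rintro (h1 | ⟨u, hu, hz⟩)
        · exact key (hq'.2 (Or.inl h1))
        · by_cases hut : u = s'.reg .t
          · exact ⟨s'.reg .len, by omega, by rw [if_pos rfl, ← hut, hz]⟩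
          · exact key (hq'.2 (Or.inr ⟨u, ⟨hu.1, by omega⟩, hz⟩))
    · simp; omega
  · rintro i s' t ⟨hi, hle, hq, ht⟩ he hb
    have hy : s'.reg y = s.reg y := by
      rw [he.reg y (by simp [Cmd.regs, block, hy1, hy2])]
      simp [hy1]
    have hlt : ¬ s'.reg .t < s.reg y := by
      intro h
      simp [hy, h] at hb
    convert h s' ?_ ?_ using 1
    · rw [ht]; simp; omega
    · rw [hq]
      congr 2
      ext z
      simp only [mem_Ico]
      omega
    · refine (State.eqExcept_setReg .rfl (x := .t) (by simp) _).trans (he.mono ?_ ?_)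
      · simp [Cmd.regs, block]
      · simp [Cmd.arrs, block]

theorem runs_ask {j : Fin 2}
    (h : ∀ w, (w ≠ 0 ↔ orc j s.query) → Q (s.setReg .ans w) (R + 2)) :
    Runs orc R (ask j) s Q := by
  classical
  unfold ask
  refine runs_call ?_
  change Q _ (1 + 1 + R)
  rw [show 1 + 1 + R = R + 2 by omega]
  refine h _ ?_
  change _ ↔ orc j {z | z ∈ s.slice .qry (s.reg .len)}
  split_ifs with ho
  · exact ⟨fun _ => ho, fun _ => one_ne_zero⟩
  · exact ⟨fun h => absurd rfl h, fun h => absurd h ho⟩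

/-- Halving the length of an interval decreases the number of remaining steps of a binary search. -/
theorem size_add_one_le {m k : ℕ} (hm : 0 < m) (hk : k ≤ m / 2) :
    Nat.size k + 1 ≤ Nat.size m := by
  have h1 := Nat.lt_size_self m
  have h2 : 0 < Nat.size m := Nat.size_pos.2 hm
  have h3 : Nat.size k ≤ Nat.size m - 1 := by
    rw [Nat.size_le]
    have : 2 ^ Nat.size m = 2 * 2 ^ (Nat.size m - 1) := by
      rw [← pow_succ']
      congr 1
      omega
    omega
  omega

/-- Binary search for the least `i` with `¬ p i` between the registers `l` and `h`, where `test`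
decides `p` at the register `mid`. -/
theorem runs_binarySearch {test : Cmd} (htest : test.silent = true)
    (hregs : ∀ x ∈ test.regs, x ∈ [Reg.t, .len, .ans]) (harrs : ∀ A ∈ test.arrs, A ∈ [Arr.qry])
    (p : ℕ → Prop) (B : ℕ) (hp : ∀ i j, i ≤ j → p j → p i) (hlh : s.reg .l ≤ s.reg .h)
    (hrun : ∀ s', State.EqExcept [.l, .h, .mid, .t, .len, .ans] [.qry] s s' →
      s.reg .l ≤ s'.reg .mid → s'.reg .mid < s.reg .h →
      Runs orc R test s' fun s'' t => (s''.reg .ans ≠ 0 ↔ p (s'.reg .mid)) ∧ t ≤ B)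
    (h : ∀ s' t, s.reg .l ≤ s'.reg .l → s'.reg .l ≤ s.reg .h →
      (∀ i, s.reg .l ≤ i → i < s'.reg .l → p i) → (s'.reg .l < s.reg .h → ¬ p (s'.reg .l)) →
      State.EqExcept [.l, .h, .mid, .t, .len, .ans] [.qry] s s' →
      t ≤ (B + 20) * Nat.size (s.reg .h - s.reg .l) + 4 → Q s' t) :
    Runs orc R (binarySearch test) s Q := by
  have hr : ∀ x, x ∉ [Reg.t, .len, .ans] → x ∉ test.regs := fun x hx hx' => hx (hregs x hx')
  unfold binarySearch
  refine Runs.loop_frame (by simp [Cmd.silent, block, htest])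
    (fun i s' t => i = s'.reg .h - s'.reg .l ∧ s.reg .l ≤ s'.reg .l ∧ s'.reg .l ≤ s'.reg .h ∧
      s'.reg .h ≤ s.reg .h ∧ (∀ i, s.reg .l ≤ i → i < s'.reg .l → p i) ∧
      (s'.reg .h < s.reg .h → ¬ p (s'.reg .h)) ∧
      State.EqExcept [.l, .h, .mid, .t, .len, .ans] [.qry] s s' ∧
      t + (B + 20) * Nat.size i ≤ (B + 20) * Nat.size (s.reg .h - s.reg .l))
    (i := s.reg .h - s.reg .l) ?_ ?_ ?_
  · exact ⟨rfl, le_rfl, hlh, le_rfl, fun i h1 h2 => absurd h2 (by omega),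
      fun h => absurd h (by omega), .rfl, by simp⟩
  · rintro i s' t ⟨hi, h1, h2, h3, hpl, hph, he, ht⟩ - hb
    have hlt : s'.reg .l < s'.reg .h := by
      by_contra h
      simp [h] at hb
    simp only [runs_block_cons, runs_set_iff, runs_block_nil]
    have he1 := State.eqExcept_setReg he (x := .mid) (by simp) ((s'.reg .l + s'.reg .h) / 2)
    have hmid : (s'.setReg .mid ((s'.reg .l + s'.reg .h) / 2)).reg .mid =
      (s'.reg .l + s'.reg .h) / 2 := by simp
    refine ((hrun (s'.setReg .mid ((s'.reg .l + s'.reg .h) / 2)) he1 (by omega)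
      (by omega)).frame htest).mono ?_
    rintro s1 t1 ⟨⟨hans, ht1⟩, he2⟩
    rw [hmid] at hans
    have el : s1.reg .l = s'.reg .l := by rw [he2.reg .l (hr _ (by simp))]; simp
    have eh : s1.reg .h = s'.reg .h := by rw [he2.reg .h (hr _ (by simp))]; simp
    have em : s1.reg .mid = (s'.reg .l + s'.reg .h) / 2 := by
      rw [he2.reg .mid (hr _ (by simp))]; simp
    have he3 : State.EqExcept [.l, .h, .mid, .t, .len, .ans] [.qry] s s1 :=
      he1.trans (he2.mono (fun x hx => by have := hregs x hx; simp at this ⊢; tauto)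
        fun A hA => harrs A hA)
    -- each step at least halves the interval
    have hcost : ∀ i' ≤ i / 2, ∀ t', t' ≤ B + 20 →
        t + t' + (B + 20) * Nat.size i' ≤ (B + 20) * Nat.size (s.reg .h - s.reg .l) := by
      intro i' hi' t' ht'
      have := Nat.mul_le_mul_left (B + 20) (size_add_one_le (m := i) (by omega) hi')
      rw [Nat.mul_add] at this
      omega
    rw [runs_ite_iff]
    constructor
    · intro hb
      have hpm := hans.1 (by simpa using hb)
      rw [runs_set_iff]
      refine ⟨i - ((s'.reg .l + s'.reg .h) / 2 + 1 - s'.reg .l), by omega, ?_, ?_, ?_, ?_, ?_, ?_,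
        ?_, ?_⟩
      · simp [eh, em]; omega
      · simp [em]; omega
      · simp [eh, em]; omega
      · simpa [eh] using h3
      · simp only [State.setReg_reg, if_true, Exp.eval, em]
        intro i hi1 hi2
        exact hp _ _ (by omega) hpm
      · simpa [eh] using hph
      · exact State.eqExcept_setReg he3 (by simp) _
      · refine hcost _ (by omega) _ ?_
        simp; omega
    · intro hb
      have hpm : ¬ p ((s'.reg .l + s'.reg .h) / 2) := fun h => by
        have := hans.2 h
        exact this (by simpa using hb)
      rw [runs_set_iff]
      refine ⟨(s'.reg .l + s'.reg .h) / 2 - s'.reg .l, by omega, ?_, ?_, ?_, ?_, ?_, ?_,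
        ?_, ?_⟩
      · simp [el, em]
      · simpa [el] using h1
      · simp [el, em]; omega
      · simp [em]; omega
      · simpa [el] using hpl
      · simpa [em] using fun _ => hpm
      · exact State.eqExcept_setReg he3 (by simp) _
      · refine hcost _ (by omega) _ ?_
        simp; omega
  · rintro i s' t ⟨hi, h1, h2, h3, hpl, hph, he, ht⟩ - hb
    have hlt : ¬ s'.reg .l < s'.reg .h := by
      intro h
      simp [h] at hb
    have heq : s'.reg .h = s'.reg .l := by omega
    rw [heq] at h3 hph
    refine h s' _ h1 h3 hpl hph he ?_
    simp
    omega

end Queries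

/-! ### Sources and sinks -/

section Sources

open Algorithm

attribute [local simp] Exp.eval Exp.cost

/-- The oracle `orc` answers queries about the matroids `N₁` and `N₂` on `{0, …, n - 1}`. -/
structure IsOracle (orc : Fin 2 → Set ℕ → Prop) (N₁ N₂ : Matroid ℕ) (n : ℕ) : Prop where
  ground₁ : N₁.E = Iio n
  ground₂ : N₂.E = Iio n
  zero_iff : ∀ Q ⊆ Iio n, orc 0 Q ↔ N₁.Indep Q
  one_iff : ∀ Q ⊆ Iio n, orc 1 Q ↔ N₂.Indep Q

/-- The state `s` represents the common independent set `S`, by its characteristic function in the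
array `inS` and by an ordering in the array `sol`. -/
structure Represents (N₁ N₂ : Matroid ℕ) (n : ℕ) (S : Set ℕ) (s : State) : Prop where
  n_eq : s.reg .n = n
  inS_iff : ∀ x < n, s.arr .inS x ≠ 0 ↔ x ∈ S
  injOn : InjOn (s.arr .sol) (Iio (s.reg .k))
  image : s.arr .sol '' Iio (s.reg .k) = S
  subset : S ⊆ Iio n
  indep₁ : N₁.Indep S
  indep₂ : N₂.Indep S

variable {orc : Fin 2 → Set ℕ → Prop} {N₁ N₂ : Matroid ℕ} {n R : ℕ} {S : Set ℕ}
  {s s' : State} {Q : State → ℕ → Prop}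

theorem Represents.congr (h : Represents N₁ N₂ n S s) (h1 : s'.reg .n = s.reg .n)
    (h2 : s'.reg .k = s.reg .k) (h3 : s'.arr .inS = s.arr .inS) (h4 : s'.arr .sol = s.arr .sol) :
    Represents N₁ N₂ n S s' :=
  ⟨h1 ▸ h.n_eq, h3 ▸ h.inS_iff, h2 ▸ h4 ▸ h.injOn, by rw [h2, h4]; exact h.image, h.subset,
    h.indep₁, h.indep₂⟩

theorem Represents.mem (h : Represents N₁ N₂ n S s) {i : ℕ} (hi : i < s.reg .k) :
    s.arr .sol i ∈ S := h.image ▸ mem_image_of_mem _ hi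

theorem Represents.image_subset (h : Represents N₁ N₂ n S s) {I : Set ℕ}
    (hI : I ⊆ Iio (s.reg .k)) : s.arr .sol '' I ⊆ S := h.image ▸ image_mono hI

theorem Represents.encard (h : Represents N₁ N₂ n S s) : S.encard = s.reg .k := by
  rw [← h.image, h.injOn.encard_image, ← (finite_Iio _).cast_ncard_eq]
  simp [← Nat.card_coe_set_eq]

theorem Represents.ncard (h : Represents N₁ N₂ n S s) : S.ncard = s.reg .k := by
  rw [Set.ncard, h.encard]
  rfl

theorem Represents.k_le (h : Represents N₁ N₂ n S s) : s.reg .k ≤ n := by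
  rw [← h.ncard]
  simpa [← Nat.card_coe_set_eq] using ncard_le_ncard h.subset (finite_Iio n)

/-- The elements below `j` that are marked as reached. -/
def State.seenBelow (s : State) (j : ℕ) : Finset ℕ :=
  (Finset.range j).filter fun x => s.arr .seen x ≠ 0

theorem State.mem_seenBelow {j x : ℕ} : x ∈ s.seenBelow j ↔ x < j ∧ s.arr .seen x ≠ 0 := by
  simp [State.seenBelow]

theorem State.seenBelow_succ_of_eq_zero {j : ℕ} (h : ∀ x < j, s'.arr .seen x = s.arr .seen x)
    (hj : s'.arr .seen j = 0) : s'.seenBelow (j + 1) = s.seenBelow j := by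
  ext x
  simp only [State.mem_seenBelow]
  rcases lt_trichotomy x j with hx | rfl | hx
  · rw [h x hx]
    simp only [hx, true_and, Nat.lt_succ_of_lt hx]
  · simp [hj]
  · constructor <;> intro h <;> omega

theorem State.seenBelow_succ_of_ne_zero {j : ℕ} (h : ∀ x < j, s'.arr .seen x = s.arr .seen x)
    (hj : s'.arr .seen j ≠ 0) : s'.seenBelow (j + 1) = insert j (s.seenBelow j) := by
  ext x
  simp only [State.mem_seenBelow, Finset.mem_insert]
  rcases lt_trichotomy x j with hx | rfl | hx
  · rw [h x hx]
    simp only [hx, true_and, Nat.lt_succ_of_lt hx, hx.ne, false_or]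
  · simp [hj]
  · constructor <;> intro h <;> omega

theorem State.seenBelow_zero : s.seenBelow 0 = ∅ := by
  ext x
  simp [State.mem_seenBelow]

theorem State.notMem_seenBelow_self {j : ℕ} : j ∉ s.seenBelow j := by
  simp [State.mem_seenBelow]

theorem image_update_Iio_succ (f : ℕ → ℕ) (m x : ℕ) :
    Function.update f m x '' Iio (m + 1) = insert x (f '' Iio m) := by
  ext z
  simp only [mem_image, mem_Iio, mem_insert_iff]
  constructor
  · rintro ⟨i, hi, rfl⟩
    by_cases h : i = m
    · simp [h]
    · rw [Function.update_of_ne h]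
      exact Or.inr ⟨i, by omega, rfl⟩
  · rintro (rfl | ⟨i, hi, rfl⟩)
    · exact ⟨m, by omega, by simp⟩
    · exact ⟨i, by omega, by rw [Function.update_of_ne (by omega)]⟩

/-- Finding the sources and the sinks costs `O(n)` queries of `O(k)` elements each.  Afterwards the
reached elements outside `S` are the sources, which form the first layer. -/
theorem runs_findSourcesAndSinks (ho : IsOracle orc N₁ N₂ n) (hs : Represents N₁ N₂ n S s)
    (hR : s.reg .k < R)
    (h : ∀ s' t, (∀ x < n, s'.arr .seen x ≠ 0 ↔ x ∈ extenders N₁ S) →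
      (∀ x < n, x ∉ S → (s'.arr .sink x ≠ 0 ↔ N₂.Indep (insert x S))) →
      (∀ x ∈ extenders N₁ S, s'.arr .par x = n) →
      s'.arr .lay '' Iio (s'.reg .m) = s'.seenBelow n →
      s'.reg .m = (s'.seenBelow n).card →
      State.EqExcept [.m, .x, .t, .len, .ans] [.seen, .sink, .par, .lay, .qry] s s' →
      t ≤ 100 * R * n + 20 → Q s' t) :
    Runs orc R findSourcesAndSinks s Q := by
  unfold findSourcesAndSinks
  rw [runs_block_cons, runs_set_iff, runs_block_cons]
  refine Runs.forAll (by decide) (by decide) (by decide) (by decide) (fun j s' t =>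
    (∀ x < j, s'.arr .seen x ≠ 0 ↔ x ∈ extenders N₁ S) ∧
    (∀ x < j, x ∉ S → (s'.arr .sink x ≠ 0 ↔ N₂.Indep (insert x S))) ∧
    (∀ x < j, x ∈ extenders N₁ S → s'.arr .par x = n) ∧
    s'.arr .lay '' Iio (s'.reg .m) = s'.seenBelow j ∧
    s'.reg .m = (s'.seenBelow j).card ∧ t ≤ 100 * R * j) ?_ ?_ ?_
  · simp [State.seenBelow_zero]
  · rintro s' t ⟨h1, h2, h3, h4, h5, ht⟩ hxn he
    have he0 : State.EqExcept [.m, .x, .t, .len, .ans] [.seen, .sink, .par, .lay, .qry] s s' :=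
      (State.eqExcept_setReg .rfl (by simp) _).trans (he.mono (by decide) (by decide))
    have hs' : Represents N₁ N₂ n S s' := hs.congr (he0.reg _ (by decide)) (he0.reg _ (by decide))
      (he0.arr _ (by decide)) (he0.arr _ (by decide))
    have hk : s'.reg .k = s.reg .k := he0.reg _ (by decide)
    simp only [State.setReg_reg, reduceCtorEq, if_false, hs.n_eq] at hxn
    clear he he0
    generalize hj : s'.reg .x = j at *
    have hcost : 100 * R * (j + 1) = 100 * R * j + 100 * R := by ring
    simp only [runs_block_cons, runs_store_iff, runs_block_nil, runs_ite_iff]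
    constructor
    · -- an element of `S`
      intro hb
      have hjS : j ∈ S := by
        rw [← hs'.inS_iff j hxn]
        simpa [hj] using hb
      have hje : j ∉ extenders N₁ S := fun h => h.1 hjS
      rw [runs_skip_iff]
      refine ⟨?_, ?_, ?_, ?_, ?_, ?_⟩
      · intro x hx
        rcases Nat.lt_succ_iff_lt_or_eq.1 hx with hx | rfl
        · simpa [hj, hx.ne] using h1 x hx
        · simp [hj, hje]
      · intro x hx hxS
        rcases Nat.lt_succ_iff_lt_or_eq.1 hx with hx | rfl
        · simpa [hj, hx.ne] using h2 x hx hxS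
        · exact absurd hjS hxS
      · intro x hx hxe
        rcases Nat.lt_succ_iff_lt_or_eq.1 hx with hx | rfl
        · simpa using h3 x hx hxe
        · exact absurd hxe hje
      · rw [State.seenBelow_succ_of_eq_zero (s := s')]
        · simpa using h4
        · intro x hx; simp [hj, hx.ne]
        · simp [hj]
      · rw [State.seenBelow_succ_of_eq_zero (s := s')]
        · simpa using h5
        · intro x hx; simp [hj, hx.ne]
        · simp [hj]
      · simp; omega
    · -- an element outside `S`
      intro hb
      have hjS : j ∉ S := by
        rw [← hs'.inS_iff j hxn]
        simpa [hj] using hb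
      have hjsub : insert j S ⊆ Iio n := insert_subset hxn hs.subset
      refine runs_startQuery fun s1 hq1 he1 => ?_
      refine runs_appendRange (by decide) (by decide) fun s2 hq2 he2 => ?_
      have hq : s2.query = insert j S := by
        have e1 : s1.arr .sol = s'.arr .sol := by rw [he1.arr _ (by decide)]; simp
        have e2 : s1.reg .k = s'.reg .k := by rw [he1.reg _ (by decide)]; simp
        rw [hq2, hq1, e1, e2]
        simp only [Exp.eval, ← Nat.bot_eq_zero, Set.Ico_bot, hs'.image, hj]
        simp [hj]
      have he12 := (he1.mono (rs' := [.t, .len]) (as' := [.qry]) (by decide) (by decide)).trans he2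
      have ek : s1.reg .k = s.reg .k := by rw [he1.reg _ (by decide)]; simp [hk]
      clear hq1 hq2 he1 he2
      refine runs_ask fun w2 hw2 => ?_
      refine runs_ask fun w1 hw1 => ?_
      rw [hq, ho.one_iff _ hjsub] at hw2
      have hq' : ((s2.setReg .ans w2).setArr .sink ((s2.setReg .ans w2).reg .x)
          ((s2.setReg .ans w2).reg .ans)).query = insert j S := by
        rw [← hq]
        ext z
        simp [State.mem_query_iff]
      simp only [Exp.eval] at hw1
      rw [hq', ho.zero_iff _ hjsub] at hw1
      clear hq' hq
      have ex : s2.reg .x = j := by rw [he12.reg _ (by decide)]; simp [hj]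
      have en : s2.reg .n = n := by rw [he12.reg _ (by decide)]; simp [hs'.n_eq]
      have em : s2.reg .m = s'.reg .m := by rw [he12.reg _ (by decide)]; simp
      have eseen : s2.arr .seen = Function.update (s'.arr .seen) j 0 := by
        rw [he12.arr _ (by decide)]; simp [hj]
      have esink : s2.arr .sink = Function.update (s'.arr .sink) j 0 := by
        rw [he12.arr _ (by decide)]; simp [hj]
      have epar : s2.arr .par = s'.arr .par := by
        rw [he12.arr _ (by decide)]; simp
      have elay : s2.arr .lay = s'.arr .lay := by
        rw [he12.arr _ (by decide)]; simp
      have hje : j ∈ extenders N₁ S ↔ N₁.Indep (insert j S) := by simp [extenders, hjS]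
      simp only [State.setReg_reg, if_true, Exp.eval, runs_skip_iff]
      constructor
      · intro hb
        have hj1 : N₁.Indep (insert j S) := hw1.1 hb
        rw [runs_set_iff]
        refine ⟨?_, ?_, ?_, ?_, ?_, ?_⟩
        · intro x hx
          rcases Nat.lt_succ_iff_lt_or_eq.1 hx with hx | rfl
          · simpa [ex, hx.ne, eseen] using h1 x hx
          · simp [ex, hje, hj1]
        · intro x hx hxS
          rcases Nat.lt_succ_iff_lt_or_eq.1 hx with hx | rfl
          · simpa [ex, hx.ne, esink] using h2 x hx hxS
          · simpa [ex] using hw2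
        · intro x hx hxe
          rcases Nat.lt_succ_iff_lt_or_eq.1 hx with hx | rfl
          · simpa [ex, hx.ne, epar] using h3 x hx hxe
          · simp [ex, en]
        · rw [State.seenBelow_succ_of_ne_zero (s := s')]
          · simp [ex, elay, em, image_update_Iio_succ, h4]
          · intro x hx; simp [ex, hx.ne, eseen]
          · simp [ex]
        · rw [State.seenBelow_succ_of_ne_zero (s := s'),
            Finset.card_insert_of_notMem State.notMem_seenBelow_self]
          · simp [em, h5]
          · intro x hx; simp [ex, hx.ne, eseen]
          · simp [ex]
        · simp [ek]; omega
      · intro hb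
        have hj1 : ¬ N₁.Indep (insert j S) := fun h => hw1.2 h hb
        refine ⟨?_, ?_, ?_, ?_, ?_, ?_⟩
        · intro x hx
          rcases Nat.lt_succ_iff_lt_or_eq.1 hx with hx | rfl
          · simpa [ex, hx.ne, eseen] using h1 x hx
          · simp [hje, hj1, eseen]
        · intro x hx hxS
          rcases Nat.lt_succ_iff_lt_or_eq.1 hx with hx | rfl
          · simpa [ex, hx.ne, esink] using h2 x hx hxS
          · simpa [ex] using hw2
        · intro x hx hxe
          rcases Nat.lt_succ_iff_lt_or_eq.1 hx with hx | rfl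
          · simpa [ex, hx.ne, epar] using h3 x hx hxe
          · exact absurd (hje.1 hxe) hj1
        · rw [State.seenBelow_succ_of_eq_zero (s := s')]
          · simpa [elay, em] using h4
          · intro x hx; simp [hx.ne, eseen]
          · simp [eseen]
        · rw [State.seenBelow_succ_of_eq_zero (s := s')]
          · simp [em, h5]
          · intro x hx; simp [hx.ne, eseen]
          · simp [eseen]
        · simp [ek]; omega
  · rintro s' t ⟨h1, h2, h3, h4, h5, ht⟩ he
    have he0 : State.EqExcept [.m, .x, .t, .len, .ans] [.seen, .sink, .par, .lay, .qry] s s' :=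
      (State.eqExcept_setReg .rfl (by simp) _).trans (he.mono (by decide) (by decide))
    have en : (s.setReg .m (Exp.eval s (.lit 0))).reg .n = n := by simp [hs.n_eq]
    rw [runs_block_nil]
    rw [en] at h1 h2 h3 h4 h5 ht
    refine h s' _ h1 h2 (fun x hx => h3 x ?_ hx) h4 h5 he0 ?_
    · have := hx.2.subset_ground (mem_insert _ _)
      rwa [ho.ground₁] at this
    · simp; omega

end Sources

/-! ### Layers at even distance -/

section Even

open Algorithm

attribute [local simp] Exp.eval Exp.cost

variable {orc : Fin 2 → Set ℕ → Prop} {N₁ N₂ : Matroid ℕ} {n R : ℕ} {S : Set ℕ}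
  {s s' : State} {Q : State → ℕ → Prop}

theorem Exp.eval_lt_ne_zero_iff {e f : Exp} : (Exp.lt e f).eval s ≠ 0 ↔ e.eval s < f.eval s := by
  rw [Exp.eval]
  split_ifs with h <;> simp only [h, ne_eq, not_true_eq_false, one_ne_zero, not_false_eq_true]

theorem Exp.eval_eq_ne_zero_iff {e f : Exp} : (Exp.eq e f).eval s ≠ 0 ↔ e.eval s = f.eval s := by
  rw [Exp.eval]
  split_ifs with h <;> simp only [h, ne_eq, not_true_eq_false, one_ne_zero, not_false_eq_true]

theorem Exp.eval_and_ne_zero_iff {e f : Exp} :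
    (Exp.and e f).eval s ≠ 0 ↔ e.eval s ≠ 0 ∧ f.eval s ≠ 0 := by
  rw [Exp.eval]
  split_ifs with h <;> simp only [h, ne_eq, not_true_eq_false, one_ne_zero, not_false_eq_true,
    and_self]

theorem image_Iio_succ (f : ℕ → ℕ) (m : ℕ) : f '' Iio (m + 1) = insert (f m) (f '' Iio m) := by
  rw [← Order.succ_eq_add_one, Order.Iio_succ_eq_insert, image_insert_eq]

theorem update_update_eq_comp_swap (f : ℕ → ℕ) (p q : ℕ) :
    Function.update (Function.update f p (f q)) q (f p) = f ∘ Equiv.swap p q := by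
  ext i
  by_cases hq : i = q
  · simp [hq]
  · by_cases hp : i = p
    · subst hp
      simp [Function.update_of_ne hq]
    · simp [Function.update_of_ne hq, Function.update_of_ne hp, Equiv.swap_apply_of_ne_of_ne hp hq]

theorem image_swap_eq {T : Set ℕ} {p q : ℕ} (hp : p ∈ T) (hq : q ∈ T) :
    Equiv.swap p q '' T = T := by
  have h : ∀ x ∈ T, Equiv.swap p q x ∈ T := by
    intro x hx
    by_cases h1 : x = p
    · simpa [h1] using hq
    · by_cases h2 : x = q
      · simpa [h2] using hp
      · rwa [Equiv.swap_apply_of_ne_of_ne h1 h2]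
  ext z
  constructor
  · rintro ⟨x, hx, rfl⟩
    exact h x hx
  · intro hz
    exact ⟨_, h z hz, by simp⟩

theorem Represents.swap (hs : Represents N₁ N₂ n S s) {p q : ℕ} (hp : p < s.reg .k)
    (hq : q < s.reg .k) (h1 : s'.reg .n = s.reg .n) (h2 : s'.reg .k = s.reg .k)
    (h3 : s'.arr .inS = s.arr .inS) (h4 : s'.arr .sol = s.arr .sol ∘ Equiv.swap p q) :
    Represents N₁ N₂ n S s' := by
  refine ⟨h1 ▸ hs.n_eq, h3 ▸ hs.inS_iff, ?_, ?_, hs.subset, hs.indep₁, hs.indep₂⟩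
  · rw [h2, h4]
    refine hs.injOn.comp (Equiv.injective _).injOn ?_
    rw [mapsTo_iff_image_subset, image_swap_eq (T := Iio (s.reg .k)) hp hq]
  · rw [h2, h4, image_comp, image_swap_eq (T := Iio (s.reg .k)) hp hq, hs.image]

/-- Exploring an element `v` that is not a sink reaches all its remaining neighbours, in the sense
that the new prefix spans `v` in the second matroid.  Every binary search but the last one reaches a
new element, so the cost is amortized by the increase of the prefix. -/
theorem runs_exploreEven (ho : IsOracle orc N₁ N₂ n) (hs : Represents N₁ N₂ n S s)
    (hR : s.reg .k < R) (hvS : s.reg .v ∉ S) (hvn : s.reg .v < n)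
    (hdep : ¬ N₂.Indep (insert (s.reg .v) S)) (ha : s.reg .a ≤ s.reg .k)
    (h : ∀ s' t, Represents N₁ N₂ n S s' → s.reg .a ≤ s'.reg .a → s'.reg .a ≤ s.reg .k →
      (∀ i < s.reg .a, s'.arr .sol i = s.arr .sol i) →
      s.reg .v ∈ N₂.closure (s'.arr .sol '' Iio (s'.reg .a)) →
      (∀ i, s.reg .a ≤ i → i < s'.reg .a → s'.arr .par (s'.arr .sol i) = s.reg .v ∧
        N₂.Indep (insert (s.reg .v) (S \ {s'.arr .sol i}))) →
      (∀ x, (∀ i, s.reg .a ≤ i → i < s'.reg .a → x ≠ s'.arr .sol i) →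
        s'.arr .par x = s.arr .par x) →
      State.EqExcept [.l, .h, .mid, .t, .len, .ans, .y, .a, .go] [.qry, .sol, .par] s s' →
      t ≤ 100 * R * (Nat.size (s.reg .k) + 1) * (s'.reg .a - s.reg .a + 1) + 10 → Q s' t) :
    Runs orc R exploreEven s Q := by
  unfold exploreEven
  rw [runs_block_cons, runs_set_iff, runs_block_cons]
  generalize hB : 100 * R * (Nat.size (s.reg .k) + 1) = B at h
  have hB' : (34 * R + 20) * Nat.size (s.reg .k) + 60 ≤ B := by
    rw [← hB]
    nlinarith [Nat.zero_le (Nat.size (s.reg .k)), Nat.mul_le_mul_right (Nat.size (s.reg .k))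
      (show 1 ≤ R by omega)]
  -- the last round leaves the prefix as it is, but sets `go` to zero
  refine Runs.loop (fun i s' t => i = s.reg .k - s'.reg .a + s'.reg .go ∧ s'.reg .go ≤ 1 ∧
    Represents N₁ N₂ n S s' ∧ s.reg .a ≤ s'.reg .a ∧ s'.reg .a ≤ s.reg .k ∧
    (∀ i < s.reg .a, s'.arr .sol i = s.arr .sol i) ∧
    (s'.reg .go = 0 → s.reg .v ∈ N₂.closure (s'.arr .sol '' Iio (s'.reg .a))) ∧
    (∀ i, s.reg .a ≤ i → i < s'.reg .a → s'.arr .par (s'.arr .sol i) = s.reg .v ∧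
      N₂.Indep (insert (s.reg .v) (S \ {s'.arr .sol i}))) ∧
    (∀ x, (∀ i, s.reg .a ≤ i → i < s'.reg .a → x ≠ s'.arr .sol i) →
      s'.arr .par x = s.arr .par x) ∧
    State.EqExcept [.l, .h, .mid, .t, .len, .ans, .y, .a, .go] [.qry, .sol, .par] s s' ∧
    t + B * s'.reg .go ≤ B * (s'.reg .a - s.reg .a + 1)) (i := s.reg .k - s.reg .a + 1) ?_ ?_ ?_
  · refine ⟨by simp, by simp, hs.congr (by simp) (by simp) (by simp) (by simp), by simp,
      by simpa using ha, by simp, by simp, ?_, by simp, State.eqExcept_setReg .rfl (by simp) _,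
      by simp⟩
    intro i h1 h2
    simp at h2
    omega
  · rintro i s1 t ⟨hi, hgo, hs1, ha1, ha2, hpre, -, hpar, hpar', he, ht⟩ hb
    replace hgo : s1.reg .go = 1 := by
      have : s1.reg .go ≠ 0 := hb
      omega
    have ek : s1.reg .k = s.reg .k := he.reg _ (by decide)
    have ev : s1.reg .v = s.reg .v := he.reg _ (by decide)
    simp only [runs_block_cons, runs_set_iff, runs_block_nil]
    have hsub : ∀ i ≤ s.reg .k, s1.arr .sol '' Iio i ⊆ S := fun i hi =>
      hs1.image_subset (Iio_subset_Iio (hi.trans ek.ge))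
    have hind : ∀ i ≤ s.reg .k, N₂.Indep (s1.arr .sol '' Iio i) := fun i hi =>
      hs1.indep₂.subset (hsub i hi)
    -- binary search for the longest prefix that is extended by `v`
    refine runs_binarySearch rfl (by decide) (by decide)
      (fun i => N₂.Indep (insert (s.reg .v) (s1.arr .sol '' Iio i))) (34 * R)
      (fun i j hij hj => hj.subset (insert_subset_insert (image_mono (Iio_subset_Iio hij))))
      (by simp) ?_ ?_
    · intro s2 he2 h1 h2
      have e1 : s2.reg .v = s.reg .v := by rw [he2.reg _ (by decide)]; simp [ev]
      have e2 : s2.arr .sol = s1.arr .sol := by rw [he2.arr _ (by decide)]; simp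
      simp only [State.setReg_reg, if_true, Exp.eval, reduceCtorEq, if_false, ek] at h2
      simp only [runs_block_cons, runs_block_nil]
      refine runs_startQuery fun s3 hq3 he3 => ?_
      refine runs_appendRange (by decide) (by decide) fun s4 hq4 he4 => ?_
      refine runs_ask fun w hw => ?_
      have e3 : s3.reg .mid = s2.reg .mid := he3.reg _ (by decide)
      have e4 : s3.arr .sol = s1.arr .sol := (he3.arr _ (by decide)).trans e2
      have hq : s4.query = insert (s.reg .v) (s1.arr .sol '' Iio (s2.reg .mid)) := by
        rw [hq4, hq3, e3, e4]
        simp only [Exp.eval, ← Nat.bot_eq_zero, Set.Ico_bot, e1]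
        rfl
      rw [hq, ho.one_iff _ (insert_subset hvn ((hsub _ h2.le).trans hs.subset))] at hw
      refine ⟨by simpa using hw, ?_⟩
      rw [e3]
      simp
      omega
    · intro s2 t2 hl1 hl2 hlt hge he2 ht2
      have el : ((s1.setReg .l 0).setReg .h (s1.reg .k)).reg .l = 0 := by simp
      have eh : ((s1.setReg .l 0).setReg .h (s1.reg .k)).reg .h = s.reg .k := by simp [ek]
      simp only [Exp.eval, State.setReg_reg, reduceCtorEq, if_false, if_true, ek]
        at hl1 hl2 hlt hge ht2
      -- if the search ends at `k`, this holds because `v` is not a sink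
      have hdepl : ¬ N₂.Indep (insert (s.reg .v) (s1.arr .sol '' Iio (s2.reg .l))) := by
        rcases hl2.lt_or_eq with h | h
        · exact hge h
        · rw [h, ← ek, hs1.image]
          exact hdep
      have he1 : State.EqExcept [.l, .h, .mid, .t, .len, .ans] [.qry] s1 s2 :=
        (State.eqExcept_setReg (State.eqExcept_setReg .rfl (by simp) _) (by simp) _).trans he2
      have e2a : s2.reg .a = s1.reg .a := he1.reg _ (by decide)
      have e2k : s2.reg .k = s.reg .k := (he1.reg _ (by decide)).trans ek
      have e2n : s2.reg .n = s1.reg .n := he1.reg _ (by decide)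
      have e2g : s2.reg .go = 1 := (he1.reg _ (by decide)).trans hgo
      have e2v : s2.reg .v = s.reg .v := (he1.reg _ (by decide)).trans ev
      have e2s : s2.arr .sol = s1.arr .sol := he1.arr _ (by decide)
      have e2p : s2.arr .par = s1.arr .par := he1.arr _ (by decide)
      have e2i : s2.arr .inS = s1.arr .inS := he1.arr _ (by decide)
      have hes2 : State.EqExcept [.l, .h, .mid, .t, .len, .ans, .y, .a, .go] [.qry, .sol, .par]
        s s2 := he.trans (he1.mono (by decide) (by decide))
      clear he1 he2
      simp only [runs_ite_iff, runs_block_cons, runs_set_iff, runs_store_iff, runs_block_nil]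
      constructor
      · intro hb
        have hal : s1.reg .a < s2.reg .l := by
          by_contra h
          simp [e2a, h] at hb
        obtain ⟨p, hp⟩ : ∃ p, s2.reg .l = p + 1 := ⟨s2.reg .l - 1, by omega⟩
        have hpS : s1.arr .sol p ∈ S := hs1.mem (by omega)
        have harc : N₂.Indep (insert (s.reg .v) (S \ {s1.arr .sol p})) := by
          refine indep_exchange_of_prefix hs.indep₂ (hsub p (by omega)) hpS hvS
            (hlt p (by omega) (by omega)) ?_
          rwa [hp, image_Iio_succ] at hdepl
        refine ⟨i - 1, by omega, ?_⟩
        simp only [State.setReg_reg, State.setReg_arr, State.setArr_reg, State.setArr_arr,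
          Exp.eval, reduceCtorEq, if_false, if_true, e2s, hp, e2a, e2g, e2p, e2v,
          Nat.add_sub_cancel, update_update_eq_comp_swap]
        -- the swap moves the new element to position `a`, and leaves the old prefix unchanged
        have hval : (s1.arr .sol ∘ Equiv.swap p (s1.reg .a)) (s1.reg .a) = s1.arr .sol p := by simp
        have hold : ∀ i < s1.reg .a,
            (s1.arr .sol ∘ Equiv.swap p (s1.reg .a)) i = s1.arr .sol i := by
          intro i hi
          rw [Function.comp_apply, Equiv.swap_apply_of_ne_of_ne (by omega) (by omega)]
        refine ⟨by omega, le_rfl, ?_, by omega, by omega, ?_, by simp, ?_, ?_, ?_, ?_⟩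
        · exact hs1.swap (p := p) (q := s1.reg .a) (by omega) (by omega) (by simp [e2n])
            (by simp [e2k, ek]) (by simp [e2i])
            (by simp [e2s, update_update_eq_comp_swap])
        · intro i hi
          rw [hold i (by omega), hpre i hi]
        · intro i hi1 hi2
          rcases Nat.lt_succ_iff_lt_or_eq.1 hi2 with hi2 | rfl
          · rw [hold i hi2, Function.update_of_ne]
            · exact hpar i hi1 hi2
            · intro h
              have := hs1.injOn (by rw [mem_Iio]; omega) (by rw [mem_Iio]; omega) h
              omega
          · rw [hval, Function.update_self]
            exact ⟨rfl, harc⟩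
        · intro x hx
          rw [Function.update_of_ne, hpar' x fun i h1 h2 => hold i h2 ▸ hx i h1 (by omega)]
          exact hval ▸ hx _ ha1 (by omega)
        · refine ⟨fun x hx => ?_, fun A hA => ?_, hes2.out⟩
          · have := hes2.reg x hx
            simp only [List.mem_cons, not_or] at hx
            simp [hx, this]
          · have := hes2.arr A hA
            simp only [List.mem_cons, not_or] at hA
            simp [hA, this]
        · have : B * (s1.reg .a + 1 - s.reg .a + 1) = B * (s1.reg .a - s.reg .a + 1) + B := by
            rw [show s1.reg .a + 1 - s.reg .a = s1.reg .a - s.reg .a + 1 by omega]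
            ring
          rw [hgo] at ht
          simp only [Exp.cost, Nat.sub_zero] at ht2 ⊢
          omega
      · intro hb
        have hal : s2.reg .l ≤ s1.reg .a := by
          by_contra h
          simp [e2a, not_le.1 h] at hb
        refine ⟨s.reg .k - s1.reg .a, by omega, ?_⟩
        simp only [State.setReg_reg, State.setReg_arr, Exp.eval, reduceCtorEq, if_false, if_true,
          e2s, e2a, e2p]
        refine ⟨by omega, by omega, hs1.congr (by simp [e2n]) (by simp [e2k, ek]) (by simp [e2i])
          (by simp [e2s]), ha1, ha2, hpre, fun _ => ?_, hpar, hpar',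
          State.eqExcept_setReg hes2 (by simp) _, ?_⟩
        · refine N₂.closure_subset_closure (image_mono (Iio_subset_Iio hal)) ?_
          refine mem_closure_of_not_indep_insert (hind _ hl2) ?_ hdepl
          rw [ho.ground₂]
          exact hvn
        · rw [hgo] at ht
          simp only [Exp.cost, Nat.sub_zero] at ht2 ⊢
          omega
  · rintro i s1 t ⟨hi, hgo, hs1, ha1, ha2, hpre, hcl, hpar, hpar', he, ht⟩ hb
    have hgo : s1.reg .go = 0 := hb
    rw [runs_block_nil]
    refine h s1 _ hs1 ha1 ha2 hpre (hcl hgo) hpar hpar' he ?_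
    simp
    omega

/-- Processing an even layer costs one binary search for each new element of `S`, and one for each
element of the layer. -/
theorem runs_processEvenLayer (ho : IsOracle orc N₁ N₂ n) (hs : Represents N₁ N₂ n S s)
    (hR : s.reg .k < R) (ha : s.reg .a ≤ s.reg .k) (hfound : s.reg .found = 0)
    (hlay : ∀ i < s.reg .m, s.arr .lay i < n ∧ s.arr .lay i ∉ S)
    (hsink : ∀ x < n, x ∉ S → (s.arr .sink x ≠ 0 ↔ N₂.Indep (insert x S)))
    (h : ∀ s' t, Represents N₁ N₂ n S s' → s'.reg .lo = s.reg .a → s.reg .a ≤ s'.reg .a →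
      s'.reg .a ≤ s.reg .k → (∀ i < s.reg .a, s'.arr .sol i = s.arr .sol i) →
      (s'.reg .found = 0 → ∀ i < s.reg .m, ¬ N₂.Indep (insert (s.arr .lay i) S) ∧
        s.arr .lay i ∈ N₂.closure (s'.arr .sol '' Iio (s'.reg .a))) →
      (s'.reg .found ≠ 0 → N₂.Indep (insert (s'.reg .v) S) ∧
        ∃ i < s.reg .m, s.arr .lay i = s'.reg .v) →
      (∀ p, s.reg .a ≤ p → p < s'.reg .a →
        (∃ i < s.reg .m, s.arr .lay i = s'.arr .par (s'.arr .sol p)) ∧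
        N₂.Indep (insert (s'.arr .par (s'.arr .sol p)) (S \ {s'.arr .sol p}))) →
      (∀ x, (∀ i, s.reg .a ≤ i → i < s'.reg .a → x ≠ s'.arr .sol i) →
        s'.arr .par x = s.arr .par x) →
      State.EqExcept [.l, .h, .mid, .t, .len, .ans, .y, .a, .go, .lo, .i, .v, .found]
        [.qry, .sol, .par] s s' →
      t ≤ 140 * R * (Nat.size (s.reg .k) + 1) * (s'.reg .a - s.reg .a + s.reg .m) + 20 → Q s' t) :
    Runs orc R processEvenLayer s Q := by
  unfold processEvenLayer
  rw [runs_block_cons, runs_set_iff, runs_block_cons, runs_set_iff, runs_block_cons]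
  generalize hB : 140 * R * (Nat.size (s.reg .k) + 1) = B at h
  have hB' : 100 * R * (Nat.size (s.reg .k) + 1) + 40 ≤ B := by
    rw [← hB]
    nlinarith [Nat.zero_le (R * Nat.size (s.reg .k))]
  generalize hB1 : 100 * R * (Nat.size (s.reg .k) + 1) = B1 at hB'
  refine Runs.loop (fun i s' t => i = s.reg .m - s'.reg .i ∧ s'.reg .i ≤ s.reg .m ∧
    s'.reg .lo = s.reg .a ∧ Represents N₁ N₂ n S s' ∧ s.reg .a ≤ s'.reg .a ∧
    s'.reg .a ≤ s.reg .k ∧ (∀ i < s.reg .a, s'.arr .sol i = s.arr .sol i) ∧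
    (s'.reg .found = 0 → ∀ i < s'.reg .i, ¬ N₂.Indep (insert (s.arr .lay i) S) ∧
      s.arr .lay i ∈ N₂.closure (s'.arr .sol '' Iio (s'.reg .a))) ∧
    (s'.reg .found ≠ 0 → N₂.Indep (insert (s'.reg .v) S) ∧
      ∃ i < s.reg .m, s.arr .lay i = s'.reg .v) ∧
    (∀ p, s.reg .a ≤ p → p < s'.reg .a →
      (∃ i < s.reg .m, s.arr .lay i = s'.arr .par (s'.arr .sol p)) ∧
      N₂.Indep (insert (s'.arr .par (s'.arr .sol p)) (S \ {s'.arr .sol p}))) ∧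
    (∀ x, (∀ i, s.reg .a ≤ i → i < s'.reg .a → x ≠ s'.arr .sol i) →
      s'.arr .par x = s.arr .par x) ∧
    State.EqExcept [.l, .h, .mid, .t, .len, .ans, .y, .a, .go, .lo, .i, .v, .found]
      [.qry, .sol, .par] s s' ∧
    t ≤ B * (s'.reg .a - s.reg .a + s'.reg .i)) (i := s.reg .m) ?_ ?_ ?_
  · refine ⟨by simp, by simp, by simp, hs.congr (by simp) (by simp) (by simp) (by simp), by simp,
      by simpa using ha, by simp, by simp, by simp [hfound], ?_, by simp,
      State.eqExcept_setReg (State.eqExcept_setReg .rfl (by simp) _) (by simp) _, by simp⟩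
    intro i h1 h2
    simp at h2
    omega
  · rintro i s1 t ⟨hi, him, hlo, hs1, ha1, ha2, hpre, hf0, -, hpar, hpar', he, ht⟩ hb
    have em : s1.reg .m = s.reg .m := he.reg _ (by decide)
    have elay : s1.arr .lay = s.arr .lay := he.arr _ (by decide)
    have esink : s1.arr .sink = s.arr .sink := he.arr _ (by decide)
    have ek : s1.reg .k = s.reg .k := he.reg _ (by decide)
    have hb' : s1.reg .i < s.reg .m ∧ s1.reg .found = 0 := by
      rw [Exp.eval_and_ne_zero_iff, Exp.eval_lt_ne_zero_iff, Exp.eval_eq_ne_zero_iff] at hb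
      simpa [em] using hb
    obtain ⟨him', hf⟩ := hb'
    obtain ⟨hvn, hvS⟩ := hlay _ him'
    simp only [runs_block_cons, runs_set_iff, runs_block_nil, runs_ite_iff]
    constructor
    · intro hb
      have hsk : N₂.Indep (insert (s.arr .lay (s1.reg .i)) S) := by
        rw [← hsink _ hvn hvS]
        simpa [elay, esink] using hb
      refine ⟨i - 1, by omega, ?_⟩
      refine ⟨by simp; omega, by simp; omega, by simpa using hlo,
        hs1.congr (by simp) (by simp) (by simp) (by simp), by simpa using ha1, by simpa using ha2,
        by simpa using hpre, by simp, fun _ => ⟨by simpa [elay] using hsk,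
        s1.reg .i, him', by simp [elay]⟩, by simpa using hpar, by simpa using hpar',
        State.eqExcept_setReg (State.eqExcept_setReg (State.eqExcept_setReg he (by simp) _)
          (by simp) _) (by simp) _, ?_⟩
      simp
      rw [← add_assoc, Nat.mul_succ]
      omega
    · intro hb
      have hsk : ¬ N₂.Indep (insert (s.arr .lay (s1.reg .i)) S) := by
        rw [← hsink _ hvn hvS]
        simpa [elay, esink] using hb
      have ev : (s1.setReg .v (Exp.eval s1 (.get .lay (.reg .i)))).reg .v =
          s.arr .lay (s1.reg .i) := by simp [elay]
      refine runs_exploreEven ho (S := S) (hs1.congr (by simp) (by simp) (by simp) (by simp))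
        (by simpa [ek] using hR) (by rwa [ev]) (by rwa [ev]) (by rwa [ev])
        (by simpa [ek] using ha2) ?_
      simp only [ev]
      intro s2 t2 hs2 h1 h2 h3 h4 h5 h6 he2 ht2
      simp only [State.setReg_reg, State.setReg_arr, reduceCtorEq, if_false, ek]
        at h1 h2 h3 h5 h6 ht2
      replace he2 : State.EqExcept [.l, .h, .mid, .t, .len, .ans, .y, .a, .go, .v]
          [.qry, .sol, .par] s1 s2 :=
        (State.eqExcept_setReg .rfl (by simp) _).trans (he2.mono (by decide) (by decide))
      have e2i : s2.reg .i = s1.reg .i := he2.reg _ (by decide)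
      have e2f : s2.reg .found = 0 := (he2.reg _ (by decide)).trans hf
      have hne : ∀ p < s1.reg .a, ∀ i, s1.reg .a ≤ i → i < s2.reg .a →
          s1.arr .sol p ≠ s2.arr .sol i := by
        intro p hp i hi1 hi2 h
        rw [← h3 p hp] at h
        have e2k : s2.reg .k = s.reg .k := (he2.reg _ (by decide)).trans ek
        have := hs2.injOn (by rw [mem_Iio]; omega) (by rw [mem_Iio]; omega) h
        omega
      refine ⟨i - 1, by omega, ?_⟩
      simp only [State.setReg_reg, State.setReg_arr, reduceCtorEq, if_false, if_true, Exp.eval, e2i,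
        e2f]
      refine ⟨by omega, by omega, (he2.reg _ (by decide)).trans hlo,
        hs2.congr (by simp) (by simp) (by simp) (by simp), by omega, h2,
        fun i hi => (h3 i (by omega)).trans (hpre i hi), fun _ j hj => ?_, by simp, ?_, ?_,
        State.eqExcept_setReg (he.trans (he2.mono (by decide) (by decide))) (by simp) _, ?_⟩
      · rcases Nat.lt_succ_iff_lt_or_eq.1 hj with hj | rfl
        · refine ⟨(hf0 hf j hj).1, N₂.closure_subset_closure ?_ (hf0 hf j hj).2⟩
          rintro _ ⟨p, hp, rfl⟩
          rw [mem_Iio] at hp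
          exact ⟨p, by rw [mem_Iio]; omega, h3 p hp⟩
        · exact ⟨hsk, h4⟩
      · intro p hp1 hp2
        rcases lt_or_ge p (s1.reg .a) with hp | hp
        · rw [h3 p hp, h6 _ (hne p hp)]
          exact hpar p hp1 hp
        · rw [(h5 p hp hp2).1]
          exact ⟨⟨s1.reg .i, him', rfl⟩, (h5 p hp hp2).2⟩
      · intro x hx
        rw [h6 x fun i hi1 hi2 => hx i (by omega) hi2]
        exact hpar' x fun i hi1 hi2 => h3 i hi2 ▸ hx i hi1 (by omega)
      · rw [hB1] at ht2
        have e : s2.reg .a - s.reg .a + (s1.reg .i + 1) =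
          (s1.reg .a - s.reg .a + s1.reg .i) + (s2.reg .a - s1.reg .a + 1) := by omega
        have e' := Nat.mul_le_mul_right (s2.reg .a - s1.reg .a + 1) hB'
        rw [e, Nat.mul_add B]
        rw [Nat.add_mul] at e'
        simp only [Exp.cost]
        omega
  · rintro i s1 t ⟨hi, him, hlo, hs1, ha1, ha2, hpre, hf0, hf1, hpar, hpar', he, ht⟩ hb
    have em : s1.reg .m = s.reg .m := he.reg _ (by decide)
    rw [runs_block_nil]
    refine h s1 _ hs1 hlo ha1 ha2 hpre (fun hf => ?_) hf1 hpar hpar' he ?_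
    · have : s1.reg .i = s.reg .m := by
        have : ¬ s1.reg .i < s.reg .m := by
          intro h
          simp [em, h, hf] at hb
        omega
      rw [← this]
      exact hf0 hf
    · have := Nat.mul_le_mul_left B (Nat.add_le_add_left him (s1.reg .a - s.reg .a))
      simp
      omega

end Even

/-! ### Layers at odd distance -/

section Odd

open Algorithm

attribute [local simp] Exp.eval Exp.cost

variable {orc : Fin 2 → Set ℕ → Prop} {N₁ N₂ : Matroid ℕ} {n R : ℕ} {S : Set ℕ}
  {s s' : State} {Q : State → ℕ → Prop}

theorem runs_queryWithoutLayer (ha : s.reg .lo ≤ s.reg .a) (hk : s.reg .a ≤ s.reg .k)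
    (h : ∀ s' t, s'.query =
        insert (s.reg .u) (s.arr .sol '' (Iio (s.reg .lo) ∪ Ico (s.reg .a) (s.reg .k))) →
      State.EqExcept [.t, .len] [.qry] s s' → t ≤ 17 * s.reg .k + 30 → Q s' t) :
    Runs orc R queryWithoutLayer s Q := by
  unfold queryWithoutLayer
  simp only [runs_block_cons, runs_block_nil]
  refine runs_startQuery fun s1 hq1 he1 => ?_
  refine runs_appendRange (by decide) (by decide) fun s2 hq2 he2 => ?_
  refine runs_appendRange (by decide) (by decide) fun s3 hq3 he3 => ?_
  have he1' := he1.mono (rs' := [.t, .len]) (as' := [.qry]) (by decide) (by decide)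
  have e2 := he1'.trans he2
  have es1 : s1.arr .sol = s.arr .sol := he1.arr _ (by decide)
  have es2 : s2.arr .sol = s.arr .sol := e2.arr _ (by decide)
  have el1 : s1.reg .lo = s.reg .lo := he1.reg _ (by decide)
  have ea2 : s2.reg .a = s.reg .a := e2.reg _ (by decide)
  have ek2 : s2.reg .k = s.reg .k := e2.reg _ (by decide)
  refine h s3 _ ?_ (e2.trans he3) ?_
  · rw [hq3, hq2, hq1, es1, es2, el1]
    simp only [Exp.eval, ← Nat.bot_eq_zero, Set.Ico_bot, ea2, ek2, image_union,
      singleton_union, insert_union]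
  · simp [el1, ea2, ek2]
    omega

theorem image_union_Ico_succ (f : ℕ → ℕ) (T : Set ℕ) {lo i : ℕ} (h : lo ≤ i) :
    f '' (T ∪ Ico lo (i + 1)) = insert (f i) (f '' (T ∪ Ico lo i)) := by
  rw [← image_insert_eq]
  congr 1
  ext z
  simp only [mem_union, mem_Ico, mem_insert_iff]
  constructor
  · rintro (h1 | h1)
    · exact Or.inr (Or.inl h1)
    · by_cases hz : z = i
      · exact Or.inl hz
      · exact Or.inr (Or.inr (by omega))
  · rintro (rfl | h1 | h1)
    · exact Or.inr (by omega)
    · exact Or.inl h1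
    · exact Or.inr (by omega)

/-- If `u` is spanned by the elements of `S` from position `lo` on, and cannot be added to `S`
without the layer at the positions `lo, …, a - 1`, then `u` is spanned by the elements from position
`a` on: the spans of two subsets of an independent set meet in the span of their intersection. -/
theorem Represents.mem_closure_of_not_indep (hs : Represents N₁ N₂ n S s) (hE : N₁.E = Iio n)
    {u lo a : ℕ} (hu : u < n) (hlo : lo ≤ a) (ha : a ≤ s.reg .k)
    (hcl : u ∈ N₁.closure (s.arr .sol '' Ico lo (s.reg .k)))
    (h : ¬ N₁.Indep (insert u (s.arr .sol '' (Iio lo ∪ Ico a (s.reg .k))))) :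
    u ∈ N₁.closure (s.arr .sol '' Ico a (s.reg .k)) := by
  have h1 : Iio lo ∪ Ico a (s.reg .k) ⊆ Iio (s.reg .k) := by
    intro z
    simp only [mem_union, mem_Iio, mem_Ico]
    omega
  have h2 : Ico lo (s.reg .k) ⊆ Iio (s.reg .k) := fun z hz => hz.2
  have h3 : u ∈ N₁.closure (s.arr .sol '' (Iio lo ∪ Ico a (s.reg .k))) :=
    mem_closure_of_not_indep_insert (hs.indep₁.subset (hs.image_subset h1)) (hE ▸ hu) h
  have h4 : u ∈ N₁.closure (s.arr .sol '' (Iio lo ∪ Ico a (s.reg .k)) ∩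
      s.arr .sol '' Ico lo (s.reg .k)) := by
    rw [(hs.indep₁.subset (union_subset (hs.image_subset h1)
      (hs.image_subset h2))).closure_inter_eq_inter_closure]
    exact ⟨h3, hcl⟩
  rw [← hs.injOn.image_inter h1 h2] at h4
  refine N₁.closure_subset_closure (image_mono ?_) h4
  intro z
  simp only [mem_inter_iff, mem_union, mem_Iio, mem_Ico]
  omega

/-- Processing an odd layer costs one query for each element, and one binary search for each newly
reached element.  The elements that remain unreached are spanned, in the first matroid, by the
unreached elements of `S`. -/
theorem runs_processOddLayer (ho : IsOracle orc N₁ N₂ n) (hs : Represents N₁ N₂ n S s)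
    (hR : s.reg .k < R) (hlo : s.reg .lo ≤ s.reg .a) (ha : s.reg .a ≤ s.reg .k)
    (hcl : ∀ u < n, u ∉ S → s.arr .seen u = 0 →
      u ∈ N₁.closure (s.arr .sol '' Ico (s.reg .lo) (s.reg .k)))
    (h : ∀ s' t,
      s'.arr .lay '' Iio (s'.reg .m) = {u | u < n ∧ s'.arr .seen u ≠ 0 ∧ s.arr .seen u = 0} →
      s'.reg .m + (s.seenBelow n).card = (s'.seenBelow n).card →
      (∀ u, s.arr .seen u ≠ 0 → s'.arr .seen u ≠ 0) →
      (∀ u < n, s'.arr .seen u ≠ 0 → s.arr .seen u = 0 → u ∉ S ∧ ∃ p, s.reg .lo ≤ p ∧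
        p < s.reg .a ∧ s'.arr .par u = s.arr .sol p ∧
        N₁.Indep (insert u (S \ {s.arr .sol p}))) →
      (∀ u, s'.arr .seen u = 0 ∨ s.arr .seen u ≠ 0 → s'.arr .par u = s.arr .par u) →
      (∀ u < n, u ∉ S → s'.arr .seen u = 0 →
        u ∈ N₁.closure (s.arr .sol '' Ico (s.reg .a) (s.reg .k))) →
      State.EqExcept [.m, .u, .t, .len, .ans, .l, .h, .mid] [.qry, .par, .seen, .lay] s s' →
      t ≤ 100 * R * n + 140 * R * (Nat.size (s.reg .k) + 1) * s'.reg .m + 20 → Q s' t) :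
    Runs orc R processOddLayer s Q := by
  unfold processOddLayer
  rw [runs_block_cons, runs_set_iff, runs_block_cons]
  generalize hB : 140 * R * (Nat.size (s.reg .k) + 1) = B at h
  have hB' : (85 * R + 20) * Nat.size (s.reg .k) + 60 ≤ B := by
    rw [← hB]
    nlinarith [Nat.zero_le (Nat.size (s.reg .k)), Nat.mul_le_mul_right (Nat.size (s.reg .k))
      (show 1 ≤ R by omega)]
  refine Runs.forAll (by decide) (by decide) (by decide) (by decide) (fun j s' t =>
    s'.arr .lay '' Iio (s'.reg .m) = {u | u < j ∧ s'.arr .seen u ≠ 0 ∧ s.arr .seen u = 0} ∧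
    s'.reg .m + (s.seenBelow n).card = (s'.seenBelow n).card ∧
    (∀ u, j ≤ u → s'.arr .seen u = s.arr .seen u) ∧
    (∀ u, s.arr .seen u ≠ 0 → s'.arr .seen u ≠ 0) ∧
    (∀ u < j, s'.arr .seen u ≠ 0 → s.arr .seen u = 0 → u ∉ S ∧ ∃ p, s.reg .lo ≤ p ∧
      p < s.reg .a ∧ s'.arr .par u = s.arr .sol p ∧
      N₁.Indep (insert u (S \ {s.arr .sol p}))) ∧
    (∀ u, s'.arr .seen u = 0 ∨ s.arr .seen u ≠ 0 → s'.arr .par u = s.arr .par u) ∧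
    (∀ u < j, u ∉ S → s'.arr .seen u = 0 →
      u ∈ N₁.closure (s.arr .sol '' Ico (s.reg .a) (s.reg .k))) ∧
    t ≤ 100 * R * j + B * s'.reg .m) ?_ ?_ ?_
  · refine ⟨by simp, ?_, by simp, by simp, by simp, by simp, by simp, by simp⟩
    change _ = (s.seenBelow n).card
    simp
  · rintro s1 t ⟨h1, h2, h3, h4, h5, h6, h7, ht⟩ hun he
    have he0 : State.EqExcept [.m, .u, .t, .len, .ans, .l, .h, .mid] [.qry, .par, .seen, .lay] s
        s1 := (State.eqExcept_setReg .rfl (by simp) _).trans (he.mono (by decide) (by decide))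
    have hs1 : Represents N₁ N₂ n S s1 := hs.congr (he0.reg _ (by decide)) (he0.reg _ (by decide))
      (he0.arr _ (by decide)) (he0.arr _ (by decide))
    have ek : s1.reg .k = s.reg .k := he0.reg _ (by decide)
    have ea : s1.reg .a = s.reg .a := he0.reg _ (by decide)
    have elo : s1.reg .lo = s.reg .lo := he0.reg _ (by decide)
    have esol : s1.arr .sol = s.arr .sol := he0.arr _ (by decide)
    have einS : s1.arr .inS = s.arr .inS := he0.arr _ (by decide)
    simp only [State.setReg_reg, reduceCtorEq, if_false, hs.n_eq] at hun
    clear he he0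
    generalize hj : s1.reg .u = j at *
    have hcost : 100 * R * (j + 1) = 100 * R * j + 100 * R := by ring
    rw [runs_ite_iff]
    have hcond : ((Exp.eq (.get .inS (.reg .u)) (.lit 0)).and
        (.eq (.get .seen (.reg .u)) (.lit 0))).eval s1 ≠ 0 ↔ j ∉ S ∧ s1.arr .seen j = 0 := by
      rw [Exp.eval_and_ne_zero_iff, Exp.eval_eq_ne_zero_iff, Exp.eval_eq_ne_zero_iff,
        ← hs1.inS_iff j hun]
      simp [hj]
    -- the case in which nothing is added to the next layer
    have hskip : ∀ s2 t', State.EqExcept [.t, .len, .ans, .u] [.qry] s1 s2 → t' ≤ 90 * R →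
        (j ∉ S → s1.arr .seen j = 0 →
          j ∈ N₁.closure (s.arr .sol '' Ico (s.reg .a) (s.reg .k))) →
        s2.arr .lay '' Iio (s2.reg .m) =
          {u | u < j + 1 ∧ s2.arr .seen u ≠ 0 ∧ s.arr .seen u = 0} ∧
        s2.reg .m + (s.seenBelow n).card = (s2.seenBelow n).card ∧
        (∀ u, j + 1 ≤ u → s2.arr .seen u = s.arr .seen u) ∧
        (∀ u, s.arr .seen u ≠ 0 → s2.arr .seen u ≠ 0) ∧
        (∀ u < j + 1, s2.arr .seen u ≠ 0 → s.arr .seen u = 0 → u ∉ S ∧ ∃ p, s.reg .lo ≤ p ∧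
          p < s.reg .a ∧ s2.arr .par u = s.arr .sol p ∧
          N₁.Indep (insert u (S \ {s.arr .sol p}))) ∧
        (∀ u, s2.arr .seen u = 0 ∨ s.arr .seen u ≠ 0 → s2.arr .par u = s.arr .par u) ∧
        (∀ u < j + 1, u ∉ S → s2.arr .seen u = 0 →
          u ∈ N₁.closure (s.arr .sol '' Ico (s.reg .a) (s.reg .k))) ∧
        t + t' + 9 ≤ 100 * R * (j + 1) + B * s2.reg .m := by
      intro s2 t' he2 ht' hj'
      have em : s2.reg .m = s1.reg .m := he2.reg _ (by decide)
      have elay : s2.arr .lay = s1.arr .lay := he2.arr _ (by decide)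
      have eseen : s2.arr .seen = s1.arr .seen := he2.arr _ (by decide)
      have epar : s2.arr .par = s1.arr .par := he2.arr _ (by decide)
      simp only [State.seenBelow, em, elay, eseen, epar] at *
      refine ⟨?_, h2, fun u hu => h3 u (by omega), h4, ?_, h6, ?_, by omega⟩
      · rw [h1]
        ext u
        simp only [mem_ofPred_eq]
        have := h3 j le_rfl
        constructor
        · exact fun h => ⟨by omega, h.2⟩
        · rintro ⟨hu, hu1, hu2⟩
          rcases Nat.lt_succ_iff_lt_or_eq.1 hu with hu | rfl
          · exact ⟨hu, hu1, hu2⟩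
          · exact absurd (this.trans hu2) hu1
      · intro u hu hu1 hu2
        rcases Nat.lt_succ_iff_lt_or_eq.1 hu with hu | rfl
        · exact h5 u hu hu1 hu2
        · exact absurd ((h3 u le_rfl).trans hu2) hu1
      · intro u hu huS hu0
        rcases Nat.lt_succ_iff_lt_or_eq.1 hu with hu | rfl
        · exact h7 u hu huS hu0
        · exact hj' huS hu0
    constructor
    · intro hb
      obtain ⟨hjS, hj0⟩ := hcond.1 hb
      rw [runs_block_cons]
      refine runs_queryWithoutLayer (by omega) (by omega) fun s2 t2 hq2 he2 ht2 => ?_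
      rw [runs_block_cons]
      refine runs_ask fun w hw => ?_
      rw [runs_block_cons, runs_ite_iff]
      have hsubk : ∀ i ≤ s.reg .a, Iio (s.reg .lo) ∪ Ico (s.reg .a) (s.reg .k) ∪
          Ico (s.reg .lo) i ⊆ Iio (s.reg .k) := by
        intro i hi z
        simp only [mem_union, mem_Iio, mem_Ico]
        omega
      have hsub : ∀ i ≤ s.reg .a, s.arr .sol '' (Iio (s.reg .lo) ∪ Ico (s.reg .a) (s.reg .k) ∪
          Ico (s.reg .lo) i) ⊆ S := fun i hi => hs.image_subset (hsubk i hi)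
      have hsub0 := hsub (s.reg .lo) hlo
      rw [Ico_self, union_empty] at hsub0
      rw [hq2, hj, ek, ea, elo, esol,
        ho.zero_iff _ (insert_subset hun (hsub0.trans hs.subset))] at hw
      constructor
      · intro hb
        have hind := hw.1 (by simpa using hb)
        simp only [runs_block_cons, runs_set_iff]
        have he2' : State.EqExcept [.t, .len, .ans, .l, .h] [.qry] s1
            (((s2.setReg .ans w).setReg .l ((s2.setReg .ans w).reg .lo)).setReg .h
              (((s2.setReg .ans w).setReg .l ((s2.setReg .ans w).reg .lo)).reg .a)) :=
          State.eqExcept_setReg (State.eqExcept_setReg (State.eqExcept_setReg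
            (he2.mono (by decide) (by decide)) (by simp) _) (by simp) _) (by simp) _
        have el3 : (((s2.setReg .ans w).setReg .l ((s2.setReg .ans w).reg .lo)).setReg .h
            (((s2.setReg .ans w).setReg .l ((s2.setReg .ans w).reg .lo)).reg .a)).reg .l =
            s.reg .lo := by
          simp [he2.reg, elo]
        have eh3 : (((s2.setReg .ans w).setReg .l ((s2.setReg .ans w).reg .lo)).setReg .h
            (((s2.setReg .ans w).setReg .l ((s2.setReg .ans w).reg .lo)).reg .a)).reg .h =
            s.reg .a := by
          simp [he2.reg, ea]
        simp only [Exp.eval]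
        generalize ((s2.setReg .ans w).setReg .l ((s2.setReg .ans w).reg .lo)).setReg .h
            (((s2.setReg .ans w).setReg .l ((s2.setReg .ans w).reg .lo)).reg .a) = s3 at *
        refine runs_binarySearch rfl (by decide) (by decide)
          (fun i => N₁.Indep (insert j (s.arr .sol '' (Iio (s.reg .lo) ∪
            Ico (s.reg .a) (s.reg .k) ∪ Ico (s.reg .lo) i)))) (85 * R)
          (fun i i' hii' hi' => hi'.subset (insert_subset_insert (image_mono
            (union_subset_union_right _ (Ico_subset_Ico_right hii')))))
          (by omega) ?_ ?_
        · intro s4 he4 hm1 hm2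
          rw [el3] at hm1
          rw [eh3] at hm2
          have he14 : State.EqExcept [.l, .h, .mid, .t, .len, .ans] [.qry] s1 s4 :=
            (he2'.mono (by decide) (by decide)).trans he4
          have ek4 : s4.reg .k = s.reg .k := (he14.reg _ (by decide)).trans ek
          have ea4 : s4.reg .a = s.reg .a := (he14.reg _ (by decide)).trans ea
          have elo4 : s4.reg .lo = s.reg .lo := (he14.reg _ (by decide)).trans elo
          have eu4 : s4.reg .u = j := (he14.reg _ (by decide)).trans hj
          have esol4 : s4.arr .sol = s.arr .sol := (he14.arr _ (by decide)).trans esol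
          simp only [runs_block_cons, runs_block_nil]
          refine runs_queryWithoutLayer (by omega) (by omega) fun s5 t5 hq5 he5 ht5 => ?_
          refine runs_appendRange (by decide) (by decide) fun s6 hq6 he6 => ?_
          refine runs_ask fun w6 hw6 => ?_
          have elo5 : s5.reg .lo = s.reg .lo := (he5.reg _ (by decide)).trans elo4
          have emid5 : s5.reg .mid = s4.reg .mid := he5.reg _ (by decide)
          have esol5 : s5.arr .sol = s.arr .sol := (he5.arr _ (by decide)).trans esol4
          have hq : s6.query = insert j (s.arr .sol '' (Iio (s.reg .lo) ∪
              Ico (s.reg .a) (s.reg .k) ∪ Ico (s.reg .lo) (s4.reg .mid))) := by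
            rw [hq6, hq5, esol5, esol4, emid5, eu4, ea4, ek4, elo4, insert_union,
              image_union _ (_ ∪ _)]
            simp only [Exp.eval, elo5]
          rw [hq, ho.zero_iff _ (insert_subset hun ((hsub _ hm2.le).trans hs.subset))] at hw6
          refine ⟨by simpa using hw6, ?_⟩
          rw [emid5]
          simp
          omega
        · intro s4 t4 hl1 hl2 hlt hge he4 ht4
          rw [el3] at hl1
          rw [eh3] at hl2
          rw [el3] at hlt
          rw [eh3] at hge
          rw [el3, eh3] at ht4
          have hcl1 : j ∈ N₁.closure (s.arr .sol '' Ico (s.reg .lo) (s.reg .k)) :=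
            hcl j hun hjS ((h3 j le_rfl).symm.trans hj0)
          have hdep : ¬ N₁.Indep (insert j (s.arr .sol '' (Iio (s.reg .lo) ∪
              Ico (s.reg .a) (s.reg .k) ∪ Ico (s.reg .lo) (s4.reg .l)))) := by
            rcases hl2.lt_or_eq with h | h
            · exact hge h
            · rw [h]
              refine not_indep_insert_of_mem_closure hcl1 (image_mono ?_) fun h' =>
                hjS (hsub _ le_rfl h')
              intro z
              simp only [mem_union, mem_Iio, mem_Ico]
              omega
          -- already the query without the layer has shown that `u` extends the empty prefix
          have hpos : s.reg .lo < s4.reg .l := by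
            refine lt_of_le_of_ne hl1 fun h => hdep ?_
            rwa [← h, Ico_self, union_empty]
          obtain ⟨p, hp⟩ : ∃ p, s4.reg .l = p + 1 := ⟨s4.reg .l - 1, by omega⟩
          have harc : N₁.Indep (insert j (S \ {s.arr .sol p})) := by
            refine indep_exchange_of_prefix hs.indep₁ (hsub p (by omega)) (hs.mem (by omega)) hjS
              (hlt p (by omega) (by omega)) ?_
            rwa [hp, image_union_Ico_succ _ _ (by omega)] at hdep
          have he14 : State.EqExcept [.l, .h, .mid, .t, .len, .ans] [.qry] s1 s4 :=
            (he2'.mono (by decide) (by decide)).trans he4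
          have eu : s4.reg .u = j := (he14.reg _ (by decide)).trans hj
          have em : s4.reg .m = s1.reg .m := he14.reg _ (by decide)
          have elay : s4.arr .lay = s1.arr .lay := he14.arr _ (by decide)
          have eseen : s4.arr .seen = s1.arr .seen := he14.arr _ (by decide)
          have epar : s4.arr .par = s1.arr .par := he14.arr _ (by decide)
          have esol4 : s4.arr .sol = s.arr .sol := (he14.arr _ (by decide)).trans esol
          simp only [runs_store_iff, runs_block_nil]
          clear he14 he4 he2' he2
          have hs0 : s.arr .seen j = 0 := (h3 j le_rfl).symm.trans hj0
          simp only [State.setReg_reg, State.setReg_arr, State.setArr_reg, State.setArr_arr,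
            Exp.eval, reduceCtorEq, if_false, if_true, eu, em, elay, eseen, epar, esol4, hp,
            Nat.add_sub_cancel]
          refine ⟨?_, ?_, ?_, ?_, ?_, ?_, ?_, ?_⟩
          · rw [image_update_Iio_succ, h1]
            ext u
            simp only [mem_insert_iff, mem_ofPred_eq, Function.update_apply]
            constructor
            · rintro (rfl | ⟨hu, hu1, hu2⟩)
              · exact ⟨by omega, by simp, hs0⟩
              · exact ⟨by omega, by rwa [if_neg (by omega)], hu2⟩
            · rintro ⟨hu, hu1, hu2⟩
              by_cases huj : u = j
              · exact Or.inl huj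
              · rw [if_neg huj] at hu1
                exact Or.inr ⟨by omega, hu1, hu2⟩
          · have : ∀ s' : State, s'.arr .seen = Function.update (s1.arr .seen) j 1 →
                (s'.seenBelow n).card = (s1.seenBelow n).card + 1 := by
              intro s' hs'
              rw [← Finset.card_insert_of_notMem (a := j) (by simp [State.mem_seenBelow, hj0])]
              congr 1
              ext u
              simp only [State.mem_seenBelow, Finset.mem_insert, hs', Function.update_apply]
              by_cases huj : u = j
              · simp [huj, hun]
              · simp [huj]
            refine Eq.trans ?_ (this _ ?_).symm
            · omega
            · simp [eseen]
          · intro u hu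
            rw [Function.update_of_ne (by omega)]
            exact h3 u (by omega)
          · intro u hu
            by_cases huj : u = j
            · simp [huj]
            · rw [Function.update_of_ne huj]
              exact h4 u hu
          · intro u hu hu1 hu2
            rcases Nat.lt_succ_iff_lt_or_eq.1 hu with hu | rfl
            · rw [Function.update_of_ne hu.ne] at hu1 ⊢
              exact h5 u hu hu1 hu2
            · exact ⟨hjS, p, by omega, by omega, by simp, harc⟩
          · intro u hu
            by_cases huj : u = j
            · subst huj
              simp [hs0] at hu
            · rw [Function.update_of_ne huj] at hu ⊢
              exact h6 u hu
          · intro u hu huS hu0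
            rcases Nat.lt_succ_iff_lt_or_eq.1 hu with hu | rfl
            · rw [Function.update_of_ne hu.ne] at hu0
              exact h7 u hu huS hu0
            · simp at hu0
          · have := Nat.mul_le_mul_left (85 * R + 20)
              (Nat.size_le_size (show s.reg .a - s.reg .lo ≤ s.reg .k by omega))
            rw [Nat.mul_add B]
            simp only [Exp.cost]
            omega
      · intro hb
        have hind := hw.not.1 (by simpa using hb)
        rw [runs_skip_iff, runs_block_nil]
        refine hskip _ _ ?_ ?_ ?_
        · exact State.eqExcept_setReg (State.eqExcept_setReg
            (he2.mono (by decide) (by decide)) (by simp) _) (by simp) _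
        · simp
          omega
        · intro _ hj0
          exact hs.mem_closure_of_not_indep ho.ground₁ hun hlo ha
            (hcl j hun hjS ((h3 j le_rfl).symm.trans hj0)) hind
    · intro hb
      rw [runs_skip_iff]
      refine hskip _ _ ?_ ?_ ?_
      · exact State.eqExcept_setReg .rfl (by simp) _
      · simp
        omega
      · intro hjS hj0
        exact absurd hb (hcond.2 ⟨hjS, hj0⟩)
  · rintro s1 t ⟨h1, h2, h3, h4, h5, h6, h7, ht⟩ he
    have he0 : State.EqExcept [.m, .u, .t, .len, .ans, .l, .h, .mid] [.qry, .par, .seen, .lay] s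
        s1 := (State.eqExcept_setReg .rfl (by simp) _).trans (he.mono (by decide) (by decide))
    have en : (s.setReg .m (Exp.eval s (.lit 0))).reg .n = n := by simp [hs.n_eq]
    rw [en] at h1 h5 h7 ht
    rw [runs_block_nil]
    refine h s1 _ h1 h2 h4 h5 h6 h7 he0 ?_
    simp
    omega

end Odd

/-! ### The invariant of the breadth-first search -/

section Search

variable {N₁ N₂ : Matroid ℕ} {n : ℕ} {S I : Set ℕ} {opt j : ℕ} {lev : ℕ → ℕ} {s s₁ s₂ : State}

/-- The element `x` has been reached by the search. -/
def State.Reached (s : State) (n x : ℕ) : Prop :=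
  (x < n ∧ s.arr .seen x ≠ 0) ∨ x ∈ s.arr .sol '' Iio (s.reg .a)

/-- The invariant of the breadth-first search before the layer at distance `2 * j` is processed.
The number `lev x` is the distance of a reached element `x` from the sources.  The fields
`closure₁` and `closure₂` are certificates for the fact that no arc leaves the part of the graph
that has been explored.  The field `rank` says that the `j` odd layers found so far have at least
`opt - k` elements each, where `k` and `opt` are the sizes of `S` and of another common independent
set. -/
structure SearchInvariant (N₁ N₂ : Matroid ℕ) (n : ℕ) (S : Set ℕ) (opt : ℕ) (lev : ℕ → ℕ) (j : ℕ)
    (s : State) : Prop where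
  represents : Represents N₁ N₂ n S s
  a_le : s.reg .a ≤ s.reg .k
  sink_iff : ∀ x < n, x ∉ S → (s.arr .sink x ≠ 0 ↔ N₂.Indep (insert x S))
  notMem_of_seen : ∀ x < n, s.arr .seen x ≠ 0 → x ∉ S
  source : ∀ x ∈ extenders N₁ S, s.arr .seen x ≠ 0 ∧ lev x = 0 ∧ s.arr .par x = n
  source_of_lev : ∀ x, s.Reached n x → lev x = 0 → x ∈ extenders N₁ S
  parent : ∀ x, s.Reached n x → lev x ≠ 0 → s.Reached n (s.arr .par x) ∧
    lev x = lev (s.arr .par x) + 1 ∧ (exchangeGraph N₁ N₂ S).Adj (s.arr .par x) x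
  lev_seen : ∀ x < n, s.arr .seen x ≠ 0 → lev x ≤ 2 * j
  lev_sol : ∀ p < s.reg .a, lev (s.arr .sol p) < 2 * j
  layer : s.arr .lay '' Iio (s.reg .m) = {x | x < n ∧ s.arr .seen x ≠ 0 ∧ lev x = 2 * j}
  arc : ∀ x y, s.Reached n x → lev x < 2 * j → (exchangeGraph N₁ N₂ S).Adj x y →
    s.Reached n y ∧ lev y ≤ lev x + 1
  closure₂ : ∀ x < n, s.arr .seen x ≠ 0 → lev x < 2 * j →
    x ∈ N₂.closure (s.arr .sol '' Iio (s.reg .a))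
  closure₁ : ∀ x < n, x ∉ S → s.arr .seen x = 0 →
    x ∈ N₁.closure (s.arr .sol '' Ico (s.reg .a) (s.reg .k))
  rank : j * opt ≤ s.reg .a + j * s.reg .k
  le_add_one : j ≤ s.reg .a + 1
  le_of_pos : 0 < s.reg .m → j ≤ s.reg .a

/-- A breadth-first search tree that ends with the sink in the register `v`, at distance `D` from
the sources.  The number `lev x` is the distance of `x` from the sources if this is at most `D`,
and `D + 1` otherwise. -/
structure SearchTree (N₁ N₂ : Matroid ℕ) (n : ℕ) (S : Set ℕ) (lev : ℕ → ℕ) (D : ℕ) (s : State) :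
    Prop where
  mem_sinks : s.reg .v ∈ extenders N₂ S
  lev_v : lev (s.reg .v) = D
  lev_source : ∀ x ∈ extenders N₁ S, lev x = 0
  le_lev_sink : ∀ x ∈ extenders N₂ S, D ≤ lev x
  arc : ∀ x y, (exchangeGraph N₁ N₂ S).Adj x y → lev y ≤ lev x + 1
  source_of_lev : ∀ x, lev x = 0 → x ∈ extenders N₁ S ∧ s.arr .par x = n
  parent : ∀ x, lev x ≠ 0 → lev x ≤ D → s.arr .par x < n ∧ lev x = lev (s.arr .par x) + 1 ∧
    (exchangeGraph N₁ N₂ S).Adj (s.arr .par x) x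

theorem Represents.image_Ico (hs : Represents N₁ N₂ n S s) {a : ℕ} (ha : a ≤ s.reg .k) :
    s.arr .sol '' Ico a (s.reg .k) = S \ s.arr .sol '' Iio a := by
  have h : Ico a (s.reg .k) = Iio (s.reg .k) \ Iio a := by
    ext z
    simp only [mem_Ico, mem_sdiff, mem_Iio]
    omega
  rw [h, hs.injOn.image_sdiff_subset (Iio_subset_Iio ha), hs.image]

theorem State.encard_image_Iio_le (s : State) (a : ℕ) :
    (s.arr .sol '' Iio a).encard ≤ a := by
  refine (encard_image_le _ _).trans ?_
  rw [← (finite_Iio _).cast_ncard_eq]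
  simp [← Nat.card_coe_set_eq]

theorem State.encard_image_Ico_le (s : State) (a k : ℕ) :
    (s.arr .sol '' Ico a k).encard ≤ (k - a : ℕ) := by
  refine (encard_image_le _ _).trans ?_
  rw [← (finite_Ico _ _).cast_ncard_eq]
  simp [← Nat.card_coe_set_eq]

theorem Represents.eq_of_sol_eq (hs : Represents N₁ N₂ n S s) {p q : ℕ} (hp : p < s.reg .k)
    (hq : q < s.reg .k) (h : s.arr .sol p = s.arr .sol q) : p = q := hs.injOn hp hq h

theorem image_Iio_congr {f g : ℕ → ℕ} {a : ℕ} (h : ∀ i < a, f i = g i) :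
    f '' Iio a = g '' Iio a := image_congr fun i hi => h i hi

/-- If every element outside `S` is spanned by the prefix of length `a` of the ordering of `S` in
the second matroid, or by the elements from position `lo ≤ a` on in the first matroid, then this
bounds the size of every common independent set. -/
theorem Represents.encard_le_of_closure (hs : Represents N₁ N₂ n S s) (h1 : N₁.Indep I)
    (h2 : N₂.Indep I) {lo a : ℕ} (hlo : lo ≤ a)
    (h : ∀ x ∈ I, x ∉ S → x ∈ N₂.closure (s.arr .sol '' Iio a) ∨
      x ∈ N₁.closure (s.arr .sol '' Ico lo (s.reg .k))) :
    I.encard ≤ (a + (s.reg .k - lo) : ℕ) := by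
  have hcov : I ⊆ N₂.closure (s.arr .sol '' Iio a) ∪
      N₁.closure (s.arr .sol '' Ico lo (s.reg .k)) := by
    intro x hx
    by_cases hxS : x ∈ S
    · rw [← hs.image] at hxS
      obtain ⟨p, hp, rfl⟩ := hxS
      rw [mem_Iio] at hp
      rcases lt_or_ge p a with hpa | hpa
      · exact Or.inl (N₂.mem_closure_of_mem' (mem_image_of_mem _ hpa)
          (hs.indep₂.subset_ground (hs.mem hp)))
      · exact Or.inr (N₁.mem_closure_of_mem' (mem_image_of_mem _ ⟨by omega, hp⟩)
          (hs.indep₁.subset_ground (hs.mem hp)))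
    · exact h x hx hxS
  refine (encard_le_of_closure_cover h1 h2 hcov).trans ?_
  push_cast
  exact add_le_add (State.encard_image_Iio_le s a) (State.encard_image_Ico_le s lo _)

theorem SearchInvariant.lt_of_reached (h : SearchInvariant N₁ N₂ n S opt lev j s) {x : ℕ}
    (hx : s.Reached n x) : x < n := by
  rcases hx with hx | ⟨p, hp, rfl⟩
  · exact hx.1
  · exact h.represents.subset (h.represents.mem (lt_of_lt_of_le hp h.a_le))

theorem SearchInvariant.seen_of_reached (h : SearchInvariant N₁ N₂ n S opt lev j s) {x : ℕ}
    (hx : s.Reached n x) (hxS : x ∉ S) : s.arr .seen x ≠ 0 := by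
  rcases hx with hx | ⟨p, hp, rfl⟩
  · exact hx.2
  · exact absurd (h.represents.mem (lt_of_lt_of_le hp h.a_le)) hxS

theorem SearchInvariant.mem_sol_of_reached (h : SearchInvariant N₁ N₂ n S opt lev j s) {x : ℕ}
    (hx : s.Reached n x) (hxS : x ∈ S) : x ∈ s.arr .sol '' Iio (s.reg .a) := by
  rcases hx with hx | hx
  · exact absurd hxS (h.notMem_of_seen x hx.1 hx.2)
  · exact hx

theorem SearchInvariant.lev_le_of_reached (h : SearchInvariant N₁ N₂ n S opt lev j s) {x : ℕ}
    (hx : s.Reached n x) : lev x ≤ 2 * j := by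
  rcases hx with hx | ⟨p, hp, rfl⟩
  · exact h.lev_seen x hx.1 hx.2
  · exact (h.lev_sol p hp).le

theorem SearchInvariant.initial (hs : Represents N₁ N₂ n S s) (hE : N₁.E = Iio n)
    (ha : s.reg .a = 0) (h1 : ∀ x < n, s.arr .seen x ≠ 0 ↔ x ∈ extenders N₁ S)
    (h2 : ∀ x < n, x ∉ S → (s.arr .sink x ≠ 0 ↔ N₂.Indep (insert x S)))
    (h3 : ∀ x ∈ extenders N₁ S, s.arr .par x = n)
    (h4 : s.arr .lay '' Iio (s.reg .m) = s.seenBelow n) :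
    SearchInvariant N₁ N₂ n S opt (fun _ => 0) 0 s where
  represents := hs
  a_le := by omega
  sink_iff := h2
  notMem_of_seen x hx h := ((h1 x hx).1 h).1
  source x hx := by
    have hxn : x < n := by
      have := hx.2.subset_ground (mem_insert _ _)
      rwa [hE] at this
    exact ⟨(h1 x hxn).2 hx, rfl, h3 x hx⟩
  source_of_lev x hx _ := by
    rcases hx with hx | ⟨p, hp, rfl⟩
    · exact (h1 x hx.1).1 hx.2
    · rw [mem_Iio] at hp
      omega
  parent x _ h := absurd rfl h
  lev_seen _ _ _ := le_rfl
  lev_sol p hp := by omega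
  layer := by
    rw [h4]
    ext x
    simp [State.mem_seenBelow]
  arc x y _ h := by omega
  closure₂ x _ _ h := by omega
  closure₁ x hx hxS h := by
    rw [ha, ← Nat.bot_eq_zero, Set.Ico_bot, hs.image]
    refine mem_closure_of_not_indep_insert hs.indep₁ (by rwa [hE]) fun hi => ?_
    exact (h1 x hx).2 ⟨hxS, hi⟩ h
  rank := by omega
  le_add_one := by omega
  le_of_pos := by omega

/-- What processing an even layer in the state `s` achieves, up to the state `s₁`. -/
structure EvenLayerStep (N₁ N₂ : Matroid ℕ) (n : ℕ) (S : Set ℕ) (s s₁ : State) : Prop where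
  represents : Represents N₁ N₂ n S s₁
  lo_eq : s₁.reg .lo = s.reg .a
  a_le : s.reg .a ≤ s₁.reg .a
  a_le_k : s₁.reg .a ≤ s.reg .k
  k_eq : s₁.reg .k = s.reg .k
  seen_eq : s₁.arr .seen = s.arr .seen
  sink_eq : s₁.arr .sink = s.arr .sink
  sol_eq : ∀ i < s.reg .a, s₁.arr .sol i = s.arr .sol i
  closure : s₁.reg .found = 0 → ∀ i < s.reg .m, ¬ N₂.Indep (insert (s.arr .lay i) S) ∧
    s.arr .lay i ∈ N₂.closure (s₁.arr .sol '' Iio (s₁.reg .a))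
  found : s₁.reg .found ≠ 0 → N₂.Indep (insert (s₁.reg .v) S) ∧
    ∃ i < s.reg .m, s.arr .lay i = s₁.reg .v
  parent : ∀ p, s.reg .a ≤ p → p < s₁.reg .a →
    (∃ i < s.reg .m, s.arr .lay i = s₁.arr .par (s₁.arr .sol p)) ∧
    N₂.Indep (insert (s₁.arr .par (s₁.arr .sol p)) (S \ {s₁.arr .sol p}))
  par_eq : ∀ x, (∀ i, s.reg .a ≤ i → i < s₁.reg .a → x ≠ s₁.arr .sol i) →
    s₁.arr .par x = s.arr .par x

/-- What processing an odd layer in the state `s` achieves, up to the state `s₁`. -/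
structure OddLayerStep (N₁ : Matroid ℕ) (n : ℕ) (S : Set ℕ) (s s₁ : State) : Prop where
  n_eq : s₁.reg .n = s.reg .n
  k_eq : s₁.reg .k = s.reg .k
  a_eq : s₁.reg .a = s.reg .a
  inS_eq : s₁.arr .inS = s.arr .inS
  sol_eq : s₁.arr .sol = s.arr .sol
  sink_eq : s₁.arr .sink = s.arr .sink
  layer : s₁.arr .lay '' Iio (s₁.reg .m) =
    {u | u < n ∧ s₁.arr .seen u ≠ 0 ∧ s.arr .seen u = 0}
  card : s₁.reg .m + (s.seenBelow n).card = (s₁.seenBelow n).card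
  seen_mono : ∀ u, s.arr .seen u ≠ 0 → s₁.arr .seen u ≠ 0
  parent : ∀ u < n, s₁.arr .seen u ≠ 0 → s.arr .seen u = 0 → u ∉ S ∧ ∃ p, s.reg .lo ≤ p ∧
    p < s.reg .a ∧ s₁.arr .par u = s.arr .sol p ∧ N₁.Indep (insert u (S \ {s.arr .sol p}))
  par_eq : ∀ u, s₁.arr .seen u = 0 ∨ s.arr .seen u ≠ 0 → s₁.arr .par u = s.arr .par u
  closure : ∀ u < n, u ∉ S → s₁.arr .seen u = 0 →
    u ∈ N₁.closure (s.arr .sol '' Ico (s.reg .a) (s.reg .k))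

theorem EvenLayerStep.image_subset (he : EvenLayerStep N₁ N₂ n S s s₁) :
    s.arr .sol '' Iio (s.reg .a) ⊆ s₁.arr .sol '' Iio (s₁.reg .a) := by
  rintro _ ⟨p, hp, rfl⟩
  rw [mem_Iio] at hp
  exact ⟨p, lt_of_lt_of_le hp he.a_le, he.sol_eq p hp⟩

theorem EvenLayerStep.image_Ico_eq (he : EvenLayerStep N₁ N₂ n S s s₁)
    (h : SearchInvariant N₁ N₂ n S opt lev j s) :
    s₁.arr .sol '' Ico (s.reg .a) (s.reg .k) = s.arr .sol '' Ico (s.reg .a) (s.reg .k) := by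
  have h1 := he.represents.image_Ico (a := s.reg .a) (by rw [he.k_eq]; exact h.a_le)
  rw [he.k_eq] at h1
  rw [h1, h.represents.image_Ico h.a_le, image_Iio_congr he.sol_eq]

theorem EvenLayerStep.not_reached (he : EvenLayerStep N₁ N₂ n S s s₁)
    (h : SearchInvariant N₁ N₂ n S opt lev j s) {p : ℕ} (hp : s.reg .a ≤ p)
    (hp' : p < s₁.reg .a) : ¬ s.Reached n (s₁.arr .sol p) := by
  have hk := he.a_le_k
  have hpk : p < s₁.reg .k := by rw [he.k_eq]; omega
  intro hr
  obtain ⟨q, hq, hqp⟩ := h.mem_sol_of_reached hr (he.represents.mem hpk)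
  rw [mem_Iio] at hq
  rw [← he.sol_eq q hq] at hqp
  have := he.represents.eq_of_sol_eq (by rw [he.k_eq]; omega) hpk hqp
  omega

theorem EvenLayerStep.par_eq_of_reached (he : EvenLayerStep N₁ N₂ n S s s₁)
    (h : SearchInvariant N₁ N₂ n S opt lev j s) {x : ℕ} (hx : s.Reached n x) :
    s₁.arr .par x = s.arr .par x := by
  refine he.par_eq x fun i hi hi' hxi => ?_
  rw [hxi] at hx
  exact he.not_reached h hi hi' hx

/-- When a sink has been found, the unreached elements get the level `2 * j + 1`.  No sink has a
smaller level than the one found, since the elements of the earlier even layers are spanned by a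
subset of `S` in the second matroid. -/
theorem SearchInvariant.exists_searchTree (h : SearchInvariant N₁ N₂ n S opt lev j s)
    (he : EvenLayerStep N₁ N₂ n S s s₁) (hE : N₁.E = Iio n) (hf : s₁.reg .found ≠ 0) :
    ∃ lev, SearchTree N₁ N₂ n S lev (2 * j) s₁ := by
  classical
  obtain ⟨hv, i, hi, hiv⟩ := he.found hf
  have hlay : s₁.reg .v ∈ s.arr .lay '' Iio (s.reg .m) := ⟨i, hi, hiv⟩
  rw [h.layer] at hlay
  obtain ⟨hvn, hvs, hvl⟩ := hlay
  have hvr : s.Reached n (s₁.reg .v) := Or.inl ⟨hvn, hvs⟩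
  refine ⟨fun x => if s.Reached n x then lev x else 2 * j + 1, ⟨⟨h.notMem_of_seen _ hvn hvs, hv⟩,
    by simp [hvr, hvl], ?_, ?_, ?_, ?_, ?_⟩⟩
  · intro x hx
    obtain ⟨h1, h2, -⟩ := h.source x hx
    by_cases hr : s.Reached n x
    · simp [hr, h2]
    · refine absurd (Or.inl ⟨?_, h1⟩) hr
      have := hx.2.subset_ground (mem_insert _ _)
      rwa [hE] at this
  · intro x hx
    by_cases hr : s.Reached n x
    · simp only [hr, if_true]
      by_contra hlt
      have := h.closure₂ x (h.lt_of_reached hr) (h.seen_of_reached hr hx.1) (by omega)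
      exact not_indep_insert_of_mem_closure this
        (h.represents.image_subset (Iio_subset_Iio h.a_le)) hx.1 hx.2
    · simp [hr]
  · intro x y hxy
    have hy : (if s.Reached n y then lev y else 2 * j + 1) ≤ 2 * j + 1 := by
      split_ifs with hr
      · have := h.lev_le_of_reached hr
        omega
      · exact le_rfl
    by_cases hr : s.Reached n x
    · rcases lt_or_ge (lev x) (2 * j) with hl | hl
      · obtain ⟨h1, h2⟩ := h.arc x y hr hl hxy
        simpa [hr, h1] using h2
      · simp only [hr, if_true]
        omega
    · simp only [hr, if_false]
      omega
  · intro x hx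
    by_cases hr : s.Reached n x
    · simp only [hr, if_true] at hx
      have hx' := h.source_of_lev x hr hx
      refine ⟨hx', ?_⟩
      rw [he.par_eq_of_reached h hr]
      exact (h.source x hx').2.2
    · simp [hr] at hx
  · intro x hx hx'
    by_cases hr : s.Reached n x
    · simp only [hr, if_true] at hx ⊢
      obtain ⟨h1, h2, h3⟩ := h.parent x hr hx
      rw [he.par_eq_of_reached h hr]
      simp only [h1, if_true]
      exact ⟨h.lt_of_reached h1, h2, h3⟩
    · simp [hr] at hx'

/-- Processing an even and an odd layer without finding a sink preserves the invariant.  The new odd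
layer has at least `opt - k` elements: the elements of `S` that had been reached after it was found
span the reached elements outside `S` in the second matroid, those that had not been reached before
it was found span the others in the first matroid, and these two parts of `S` have the new layer in
common. -/
theorem SearchInvariant.next (h : SearchInvariant N₁ N₂ n S opt lev j s)
    (he : EvenLayerStep N₁ N₂ n S s s₁) (ho : OddLayerStep N₁ n S s₁ s₂)
    (hE₁ : N₁.E = Iio n) (hE₂ : N₂.E = Iio n) (hf : s₁.reg .found = 0) (hm : 0 < s.reg .m)
    (hI₁ : N₁.Indep I) (hI₂ : N₂.Indep I) (hopt : I.encard = opt) :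
    ∃ lev, SearchInvariant N₁ N₂ n S opt lev (j + 1) s₂ := by
  classical
  have hk₁ := he.k_eq
  have hak := he.a_le_k
  have hlo := he.a_le
  have hja := h.le_of_pos hm
  have hmem : ∀ p < s₁.reg .a, s₁.arr .sol p ∈ S := fun p hp => he.represents.mem (by omega)
  -- every element outside `S` that was reached before is spanned by the new prefix
  have hlay : ∀ x < n, s.arr .seen x ≠ 0 → x ∈ N₂.closure (s₁.arr .sol '' Iio (s₁.reg .a)) := by
    intro x hx hxs
    rcases (h.lev_seen x hx hxs).lt_or_eq with hl | hl
    · exact N₂.closure_subset_closure he.image_subset (h.closure₂ x hx hxs hl)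
    · have : x ∈ s.arr .lay '' Iio (s.reg .m) := by
        rw [h.layer]
        exact ⟨hx, hxs, hl⟩
      obtain ⟨i, hi, rfl⟩ := this
      exact (he.closure hf i hi).2
  have hnew : ∀ x < n, s₂.arr .seen x ≠ 0 → x ∉ S := by
    intro x hx hxs
    by_cases h0 : s₁.arr .seen x = 0
    · exact (ho.parent x hx hxs h0).1
    · rw [he.seen_eq] at h0
      exact h.notMem_of_seen x hx h0
  have hreach : ∀ x, s.Reached n x → s₂.Reached n x := by
    rintro x (⟨hx, hxs⟩ | hx)
    · exact Or.inl ⟨hx, ho.seen_mono x (by rwa [he.seen_eq])⟩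
    · refine Or.inr ?_
      rw [ho.sol_eq, ho.a_eq]
      exact he.image_subset hx
  have hpar : ∀ x, x ∈ S ∨ s.Reached n x → s₂.Reached n x → s₂.arr .par x = s₁.arr .par x := by
    intro x hx hx2
    refine ho.par_eq x ?_
    by_contra hcon
    push Not at hcon
    rcases hx2 with hx2 | ⟨p, hp, rfl⟩
    · rcases hx with hx | hx
      · exact hnew x hx2.1 hx2.2 hx
      · exact h.seen_of_reached hx (hnew x hx2.1 hx2.2) (by rw [← he.seen_eq]; exact hcon.2)
    · rw [mem_Iio, ho.a_eq] at hp
      rw [ho.sol_eq] at hcon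
      exact hnew _ (he.represents.subset (hmem p hp)) hcon.1 (hmem p hp)
  -- the newly reached elements are at distance `2 * j + 1` in `S`, and `2 * j + 2` outside
  set lev' : ℕ → ℕ := fun x => if s.Reached n x then lev x else if x ∈ S then 2 * j + 1
    else 2 * j + 2 with hlev'
  have hl1 : ∀ x, s.Reached n x → lev' x = lev x := fun x hx => by simp [hlev', hx]
  have hl2 : ∀ x, ¬ s.Reached n x → x ∈ S → lev' x = 2 * j + 1 := fun x hx hxS => by
    simp [hlev', hx, hxS]
  have hl3 : ∀ x, ¬ s.Reached n x → x ∉ S → lev' x = 2 * j + 2 := fun x hx hxS => by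
    simp [hlev', hx, hxS]
  have hl4 : ∀ x ∈ S, lev' x ≤ 2 * j + 1 := fun x hx => by
    by_cases hr : s.Reached n x
    · rw [hl1 x hr]
      have := h.lev_le_of_reached hr
      omega
    · rw [hl2 x hr hx]
  have hl5 : ∀ x, lev' x ≤ 2 * j + 2 := fun x => by
    by_cases hxS : x ∈ S
    · have := hl4 x hxS
      omega
    · by_cases hr : s.Reached n x
      · rw [hl1 x hr]
        have := h.lev_le_of_reached hr
        omega
      · rw [hl3 x hr hxS]
  have hsrc_lt : ∀ x ∈ extenders N₁ S, x < n := fun x hx => by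
    have := hx.2.subset_ground (mem_insert _ _)
    rwa [hE₁] at this
  refine ⟨lev', ?_⟩
  constructor
  case represents =>
    exact he.represents.congr ho.n_eq ho.k_eq ho.inS_eq ho.sol_eq
  case a_le =>
    rw [ho.a_eq, ho.k_eq]
    omega
  case sink_iff =>
    rw [ho.sink_eq, he.sink_eq]
    exact h.sink_iff
  case notMem_of_seen =>
    exact hnew
  case source =>
    intro x hx
    obtain ⟨h1, h2, h3⟩ := h.source x hx
    have hr : s.Reached n x := Or.inl ⟨hsrc_lt x hx, h1⟩
    refine ⟨ho.seen_mono x (by rwa [he.seen_eq]), by rw [hl1 x hr, h2], ?_⟩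
    rw [hpar x (Or.inr hr) (hreach x hr), he.par_eq_of_reached h hr, h3]
  case source_of_lev =>
    intro x hx hx0
    by_cases hr : s.Reached n x
    · exact h.source_of_lev x hr (by rwa [hl1 x hr] at hx0)
    · by_cases hxS : x ∈ S
      · rw [hl2 x hr hxS] at hx0
        omega
      · rw [hl3 x hr hxS] at hx0
        omega
  case parent =>
    intro x hx hx0
    by_cases hr : s.Reached n x
    · rw [hl1 x hr] at hx0 ⊢
      obtain ⟨h1, h2, h3⟩ := h.parent x hr hx0
      rw [hpar x (Or.inr hr) hx, he.par_eq_of_reached h hr, hl1 _ h1]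
      exact ⟨hreach _ h1, h2, h3⟩
    · by_cases hxS : x ∈ S
      · rw [hpar x (Or.inl hxS) hx, hl2 x hr hxS]
        rcases hx with hx | ⟨p, hp, rfl⟩
        · exact absurd hxS (hnew x hx.1 hx.2)
        · rw [ho.a_eq, mem_Iio] at hp
          rw [ho.sol_eq] at hr hxS ⊢
          have hpa : s.reg .a ≤ p := by
            by_contra hpa
            exact hr (Or.inr ⟨p, not_le.1 hpa, (he.sol_eq p (not_le.1 hpa)).symm⟩)
          obtain ⟨⟨i, hi, hip⟩, h2⟩ := he.parent p hpa hp
          have : s₁.arr .par (s₁.arr .sol p) ∈ s.arr .lay '' Iio (s.reg .m) := ⟨i, hi, hip⟩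
          rw [h.layer] at this
          obtain ⟨h3, h4, h5⟩ := this
          have hr' : s.Reached n (s₁.arr .par (s₁.arr .sol p)) := Or.inl ⟨h3, h4⟩
          refine ⟨hreach _ hr', by rw [hl1 _ hr', h5], ?_⟩
          rw [exchangeGraph_adj_of_notMem (h.notMem_of_seen _ h3 h4), hE₂]
          exact ⟨h3, hxS, h2⟩
      · rcases hx with hx | ⟨p, hp, rfl⟩
        · have h0 : s₁.arr .seen x = 0 := by
            by_contra h0
            rw [he.seen_eq] at h0
            exact hr (Or.inl ⟨hx.1, h0⟩)
          obtain ⟨-, p, hp1, hp2, hp3, hp4⟩ := ho.parent x hx.1 hx.2 h0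
          rw [he.lo_eq] at hp1
          have hpS := hmem p hp2
          rw [hp3, hl3 x hr hxS, hl2 _ (he.not_reached h hp1 hp2) hpS]
          refine ⟨Or.inr ⟨p, by rw [ho.a_eq]; exact hp2, by rw [ho.sol_eq]⟩, rfl, ?_⟩
          rw [exchangeGraph_adj_of_mem hpS, hE₁]
          exact ⟨⟨hx.1, hxS⟩, hp4⟩
        · rw [ho.a_eq, mem_Iio] at hp
          rw [ho.sol_eq] at hxS
          exact absurd (hmem p hp) hxS
  case lev_seen =>
    intro x _ _
    have := hl5 x
    omega
  case lev_sol =>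
    intro p hp
    rw [ho.a_eq] at hp
    rw [ho.sol_eq]
    have := hl4 _ (hmem p hp)
    omega
  case layer =>
    rw [ho.layer]
    ext x
    simp only [mem_ofPred_eq]
    constructor
    · rintro ⟨hx, hx2, hx1⟩
      have hxS := hnew x hx hx2
      have hr : ¬ s.Reached n x := fun hr => h.seen_of_reached hr hxS (by rwa [← he.seen_eq])
      exact ⟨hx, hx2, by rw [hl3 x hr hxS]; ring⟩
    · rintro ⟨hx, hx2, hxl⟩
      refine ⟨hx, hx2, ?_⟩
      by_contra h0
      rw [he.seen_eq] at h0
      have hr : s.Reached n x := Or.inl ⟨hx, h0⟩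
      rw [hl1 x hr] at hxl
      have := h.lev_le_of_reached hr
      omega
  case arc =>
    intro x y hx hxl hxy
    by_cases hxS : x ∈ S
    · rw [exchangeGraph_adj_of_mem hxS, hE₁] at hxy
      obtain ⟨⟨hyn, hyS⟩, hind⟩ := hxy
      rcases hx with hx | ⟨p, hp, rfl⟩
      · exact absurd hxS (hnew x hx.1 hx.2)
      rw [ho.a_eq, mem_Iio] at hp
      rw [ho.sol_eq] at hxS hind hxl ⊢
      have hys : s₂.arr .seen y ≠ 0 := by
        intro h0
        refine not_indep_insert_of_mem_closure (ho.closure y hyn hyS h0) ?_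
          (fun h => hyS h.1) hind
        rintro _ ⟨q, hq, rfl⟩
        refine ⟨he.represents.mem hq.2, fun hqp => ?_⟩
        have := he.represents.eq_of_sol_eq hq.2 (by omega) hqp
        have := hq.1
        omega
      refine ⟨Or.inl ⟨hyn, hys⟩, ?_⟩
      rcases lt_or_ge p (s.reg .a) with hpa | hpa
      · have hr : s.Reached n (s₁.arr .sol p) := Or.inr ⟨p, hpa, (he.sol_eq p hpa).symm⟩
        have hl := h.lev_sol p hpa
        rw [← he.sol_eq p hpa] at hl
        obtain ⟨h1, h2⟩ := h.arc _ y hr hl ((exchangeGraph_adj_of_mem hxS).2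
          ⟨⟨by rw [hE₁]; exact hyn, hyS⟩, hind⟩)
        rw [hl1 _ hr, hl1 _ h1]
        exact h2
      · rw [hl2 _ (he.not_reached h hpa hp) hxS]
        exact hl5 y
    · have hxy' := hxy
      rw [exchangeGraph_adj_of_notMem hxS] at hxy
      obtain ⟨-, hyS, hind⟩ := hxy
      have hr : s.Reached n x := by
        by_contra hr
        rw [hl3 x hr hxS] at hxl
        omega
      have hxn := h.lt_of_reached hr
      rcases (h.lev_le_of_reached hr).lt_or_eq with hl | hl
      · obtain ⟨h1, h2⟩ := h.arc x y hr hl hxy'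
        rw [hl1 _ hr, hl1 _ h1]
        exact ⟨hreach y h1, h2⟩
      · rw [hl1 x hr, hl]
        refine ⟨?_, hl4 y hyS⟩
        by_contra hny
        refine not_indep_insert_of_mem_closure (hlay x hxn (h.seen_of_reached hr hxS)) ?_
          (fun h => hxS h.1) hind
        rintro _ ⟨q, hq, rfl⟩
        refine ⟨hmem q hq, fun hqy => hny (Or.inr ?_)⟩
        rw [ho.a_eq, ho.sol_eq]
        exact ⟨q, hq, hqy⟩
  case closure₂ =>
    intro x hx hxs hxl
    rw [ho.a_eq, ho.sol_eq]
    have hr : s.Reached n x := by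
      by_contra hr
      rw [hl3 x hr (hnew x hx hxs)] at hxl
      omega
    exact hlay x hx (h.seen_of_reached hr (hnew x hx hxs))
  case closure₁ =>
    intro x hx hxS hx0
    rw [ho.a_eq, ho.sol_eq, ho.k_eq]
    exact ho.closure x hx hxS hx0
  case rank =>
    have hcount := he.represents.encard_le_of_closure hI₁ hI₂ (lo := s.reg .a) (a := s₁.reg .a)
      hlo (fun x hx hxS => ?_)
    · rw [hopt, Nat.cast_le, hk₁] at hcount
      have := h.rank
      have := h.a_le
      rw [ho.a_eq, ho.k_eq, hk₁, Nat.add_mul, Nat.add_mul]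
      omega
    · have hxn : x < n := by
        have := hI₁.subset_ground hx
        rwa [hE₁] at this
      by_cases h0 : s.arr .seen x = 0
      · refine Or.inr ?_
        rw [hk₁, he.image_Ico_eq h]
        exact h.closure₁ x hxn hxS h0
      · exact Or.inl (hlay x hxn h0)
  case le_add_one =>
    rw [ho.a_eq]
    omega
  case le_of_pos =>
    intro hm2
    rw [ho.a_eq]
    have : s₂.arr .lay 0 ∈ s₂.arr .lay '' Iio (s₂.reg .m) := ⟨0, hm2, rfl⟩
    rw [ho.layer] at this
    obtain ⟨h1, h2, h3⟩ := this
    obtain ⟨-, p, hp1, hp2, -⟩ := ho.parent _ h1 h2 h3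
    rw [he.lo_eq] at hp1
    omega

theorem SearchInvariant.layer_eq_empty (h : SearchInvariant N₁ N₂ n S opt lev j s)
    (hm : s.reg .m = 0) {x : ℕ} (hx : s.Reached n x) : lev x < 2 * j := by
  rcases hx with hx | ⟨p, hp, rfl⟩
  · refine lt_of_le_of_ne (h.lev_seen x hx.1 hx.2) fun hl => ?_
    have : x ∈ s.arr .lay '' Iio (s.reg .m) := by
      rw [h.layer]
      exact ⟨hx.1, hx.2, hl⟩
    simp [hm] at this
  · exact h.lev_sol p hp

/-- If no sink is found, the reached part of the graph proves that `S` has maximum size. -/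
theorem SearchInvariant.encard_le (h : SearchInvariant N₁ N₂ n S opt lev j s)
    (hm : s.reg .m = 0) (hE₁ : N₁.E = Iio n) (hI₁ : N₁.Indep I) (hI₂ : N₂.Indep I) :
    I.encard ≤ S.encard := by
  have := h.represents.encard_le_of_closure hI₁ hI₂ (le_refl (s.reg .a)) fun x hx hxS => ?_
  · rw [h.represents.encard]
    convert this using 2
    have := h.a_le
    omega
  · have hxn : x < n := by
      have := hI₁.subset_ground hx
      rwa [hE₁] at this
    by_cases h0 : s.arr .seen x = 0
    · exact Or.inr (h.closure₁ x hxn hxS h0)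
    · exact Or.inl (h.closure₂ x hxn h0 (h.layer_eq_empty hm (Or.inl ⟨hxn, h0⟩)))

/-- If no sink is found, there is no augmenting path, since the set of reached elements contains the
sources, is closed under arcs, and contains no sink. -/
theorem SearchInvariant.not_isAugmentingPath (h : SearchInvariant N₁ N₂ n S opt lev j s)
    (hm : s.reg .m = 0) (hE₁ : N₁.E = Iio n) (P : List ℕ) : ¬ IsAugmentingPath N₁ N₂ S P := by
  rintro ⟨hc, -, ⟨x, hx, hxs⟩, ⟨y, hy, hys⟩⟩
  have hxn : x < n := by
    have := hxs.2.subset_ground (mem_insert _ _)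
    rwa [hE₁] at this
  have key : ∀ (l : List ℕ) (a : ℕ), (a :: l).IsChain (exchangeGraph N₁ N₂ S).Adj →
      s.Reached n a → ∀ b ∈ (a :: l).getLast?, s.Reached n b := by
    intro l
    induction l with
    | nil =>
      intro a _ ha b hb
      obtain rfl : a = b := by simpa using hb
      exact ha
    | cons c l ih =>
      intro a hc ha b hb
      rw [List.isChain_cons_cons] at hc
      exact ih c hc.2 (h.arc a c ha (h.layer_eq_empty hm ha) hc.1).1 b (by simpa using hb)
  cases P with
  | nil => simp at hx
  | cons a l =>
    obtain rfl : a = x := by simpa using hx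
    have hr := key l a hc (Or.inl ⟨hxn, (h.source a hxs).1⟩) y hy
    have := h.closure₂ y (h.lt_of_reached hr) (h.seen_of_reached hr hys.1) (h.layer_eq_empty hm hr)
    exact not_indep_insert_of_mem_closure this
      (h.represents.image_subset (Iio_subset_Iio h.a_le)) hys.1 hys.2

end Search

/-! ### The breadth-first search -/

section RunSearch

open Algorithm

attribute [local simp] Exp.eval Exp.cost

variable {orc : Fin 2 → Set ℕ → Prop} {N₁ N₂ : Matroid ℕ} {n R opt : ℕ} {S I : Set ℕ}
  {s s' : State} {Q : State → ℕ → Prop}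

theorem State.card_seenBelow_le (s : State) (j : ℕ) : (s.seenBelow j).card ≤ j := by
  exact (Finset.card_filter_le _ _).trans (Finset.card_range j).le

theorem runs_processEvenLayer_step (ho : IsOracle orc N₁ N₂ n) {lev : ℕ → ℕ} {j : ℕ}
    (hs : SearchInvariant N₁ N₂ n S opt lev j s) (hR : s.reg .k < R) (hfound : s.reg .found = 0)
    (h : ∀ s' t, EvenLayerStep N₁ N₂ n S s s' →
      t ≤ 140 * R * (Nat.size (s.reg .k) + 1) * (s'.reg .a - s.reg .a + s.reg .m) + 20 → Q s' t) :
    Runs orc R processEvenLayer s Q := by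
  refine runs_processEvenLayer ho hs.represents hR hs.a_le hfound (fun i hi => ?_) hs.sink_iff ?_
  · have : s.arr .lay i ∈ s.arr .lay '' Iio (s.reg .m) := ⟨i, hi, rfl⟩
    rw [hs.layer] at this
    exact ⟨this.1, hs.notMem_of_seen _ this.1 this.2.1⟩
  · intro s' t h1 h2 h3 h4 h5 h6 h7 h8 h9 he ht
    exact h s' t ⟨h1, h2, h3, h4, he.reg _ (by decide), he.arr _ (by decide), he.arr _ (by decide),
      h5, h6, h7, h8, h9⟩ ht

theorem runs_processOddLayer_step (ho : IsOracle orc N₁ N₂ n) {s₁ : State} {lev : ℕ → ℕ} {j : ℕ}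
    (hs : SearchInvariant N₁ N₂ n S opt lev j s) (he : EvenLayerStep N₁ N₂ n S s s₁)
    (hR : s.reg .k < R)
    (h : ∀ s₂ t, OddLayerStep N₁ n S s₁ s₂ → s₂.reg .found = s₁.reg .found →
      t ≤ 100 * R * n + 140 * R * (Nat.size (s.reg .k) + 1) * s₂.reg .m + 20 → Q s₂ t) :
    Runs orc R processOddLayer s₁ Q := by
  refine runs_processOddLayer ho he.represents (by rwa [he.k_eq]) (by rw [he.lo_eq]; exact he.a_le)
    (by rw [he.k_eq]; exact he.a_le_k) (fun u hu huS hu0 => ?_) ?_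
  · rw [he.lo_eq, he.k_eq, he.image_Ico_eq hs]
    exact hs.closure₁ u hu huS (by rwa [← he.seen_eq])
  · intro s₂ t h1 h2 h3 h4 h5 h6 he2 ht
    rw [he.k_eq] at ht
    exact h s₂ t ⟨he2.reg _ (by decide), he2.reg _ (by decide), he2.reg _ (by decide),
      he2.arr _ (by decide), he2.arr _ (by decide), he2.arr _ (by decide), h1, h2, h3, h4, h5, h6⟩
      (he2.reg _ (by decide)) ht

/-- The search either finds a shortest augmenting path, or proves that `S` is optimal and that there
is no augmenting path.  If it explores `j` odd layers before it finds a sink, these have at least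
`opt - k` elements each, so that `j * (opt - k) ≤ k`.  Apart from the cost `O(R n)` for each layer,
the cost is that of `O(n)` binary searches, since each of them reaches an element or is the last one
for an element outside `S`. -/
theorem runs_search (ho : IsOracle orc N₁ N₂ n) (hs : Represents N₁ N₂ n S s)
    (hR : s.reg .k < R) (hI₁ : N₁.Indep I) (hI₂ : N₂.Indep I) (hopt : I.encard = opt)
    (h : ∀ s' t j, Represents N₁ N₂ n S s' → j ≤ s.reg .k + 1 →
      (s'.reg .found = 0 → (∀ J, N₁.Indep J → N₂.Indep J → J.encard ≤ S.encard) ∧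
        ∀ P, ¬ IsAugmentingPath N₁ N₂ S P) →
      (s'.reg .found ≠ 0 → (∃ lev, SearchTree N₁ N₂ n S lev (2 * j) s') ∧
        j * opt ≤ s.reg .k + j * s.reg .k) →
      State.EqExcept search.regs search.arrs s s' →
      t ≤ (j + 3) * (100 * R * n + 100) + 420 * R * (Nat.size (s.reg .k) + 1) * n → Q s' t) :
    Runs orc R search s Q := by
  suffices H : Runs orc R search s fun s' t => ∃ j, Represents N₁ N₂ n S s' ∧ j ≤ s.reg .k + 1 ∧
      (s'.reg .found = 0 → (∀ J, N₁.Indep J → N₂.Indep J → J.encard ≤ S.encard) ∧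
        ∀ P, ¬ IsAugmentingPath N₁ N₂ S P) ∧
      (s'.reg .found ≠ 0 → (∃ lev, SearchTree N₁ N₂ n S lev (2 * j) s') ∧
        j * opt ≤ s.reg .k + j * s.reg .k) ∧
      t ≤ (j + 3) * (100 * R * n + 100) + 420 * R * (Nat.size (s.reg .k) + 1) * n by
    refine (H.frame (by decide)).mono ?_
    rintro s' t ⟨⟨j, h1, h2, h3, h4, h5⟩, he⟩
    exact h s' t j h1 h2 h3 h4 he h5
  unfold search
  simp only [runs_block_cons, runs_set_iff, runs_block_nil]
  refine runs_findSourcesAndSinks ho (S := S) (hs.congr (by simp) (by simp) (by simp) (by simp))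
    (by simpa using hR) ?_
  intro s1 t1 h1 h2 h3 h4 h5 he ht1
  have ek1 : s1.reg .k = s.reg .k := by rw [he.reg _ (by decide)]; simp
  have ea1 : s1.reg .a = 0 := by rw [he.reg _ (by decide)]; simp
  have ef1 : s1.reg .found = 0 := by rw [he.reg _ (by decide)]; simp
  have hs1 : Represents N₁ N₂ n S s1 := hs.congr (by rw [he.reg _ (by decide)]; simp) ek1
    (by rw [he.arr _ (by decide)]; simp) (by rw [he.arr _ (by decide)]; simp)
  have hinit := SearchInvariant.initial (opt := opt) hs1 ho.ground₁ ea1 h1 h2 h3 h4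
  have hkn : s.reg .k ≤ n := hs.k_le
  generalize hA : 100 * R * n + 100 = A
  have hB : 420 * R * (Nat.size (s.reg .k) + 1) * n =
    3 * n * (140 * R * (Nat.size (s.reg .k) + 1)) := by ring
  rw [hB]
  generalize hB' : 140 * R * (Nat.size (s.reg .k) + 1) = B
  clear h1 h2 h3 h4 he hB
  -- in the loop, `A` bounds the cost of a layer apart from binary searches, and `B` the cost of a
  -- binary search; the search for an element of the current layer is paid for in advance
  refine Runs.loop (fun i s' t =>
    (s'.reg .found = 0 ∧ ∃ lev j, SearchInvariant N₁ N₂ n S opt lev j s' ∧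
      i = 2 * (n - (s'.seenBelow n).card) + 1 + min (s'.reg .m) 1 ∧
      t + B * s'.reg .m ≤ j * A + B * (s'.reg .a + 2 * (s'.seenBelow n).card)) ∨
    (s'.reg .found ≠ 0 ∧ i = 0 ∧ Represents N₁ N₂ n S s' ∧ ∃ lev j,
      SearchTree N₁ N₂ n S lev (2 * j) s' ∧ j * opt ≤ s.reg .k + j * s.reg .k ∧
      j ≤ s.reg .k ∧ t ≤ (j + 1) * A + 3 * n * B))
    (i := 2 * (n - (s1.seenBelow n).card) + 1 + min (s1.reg .m) 1) ?_ ?_ ?_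
  · refine Or.inl ⟨ef1, _, 0, hinit, rfl, ?_⟩
    rw [ea1, h5, Nat.zero_add, Nat.zero_add, Nat.zero_mul, Nat.zero_add]
    exact Nat.mul_le_mul_left B (by omega)
  · intro i s2 t hI hb
    rw [Exp.eval_and_ne_zero_iff, Exp.eval_eq_ne_zero_iff, Exp.eval_lt_ne_zero_iff] at hb
    obtain ⟨hf, hm⟩ := hb
    replace hf : s2.reg .found = 0 := by simpa using hf
    replace hm : 0 < s2.reg .m := by simpa using hm
    rcases hI with ⟨-, lev, j, hinv, hi, ht⟩ | ⟨hf', -⟩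
    swap
    · exact absurd hf hf'
    have ek2 : s2.reg .k = s.reg .k := hinv.represents.ncard.symm.trans hs.ncard
    have hcard2 := s2.card_seenBelow_le n
    rw [runs_block_cons]
    refine runs_processEvenLayer_step ho hinv (by rwa [ek2]) hf fun s3 t3 hst ht3 => ?_
    rw [ek2, hB'] at ht3
    rw [runs_block_cons, runs_ite_iff]
    have ha3 := hst.a_le
    have ha3' := hst.a_le_k
    constructor
    · intro hb
      have hf3 : s3.reg .found ≠ 0 := hb
      rw [runs_skip_iff, runs_block_nil]
      refine ⟨0, by omega, Or.inr ⟨hf3, rfl, hst.represents, ?_⟩⟩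
      obtain ⟨lev', htree⟩ := hinv.exists_searchTree hst ho.ground₁ hf3
      have hj := hinv.le_of_pos hm
      refine ⟨lev', j, htree, ?_, ?_, ?_⟩
      · have := hinv.rank
        have := hinv.a_le
        rw [ek2] at *
        omega
      · have := hinv.a_le
        omega
      · have e1 : B * (s2.reg .a + 2 * (s2.seenBelow n).card) + B * (s3.reg .a - s2.reg .a) ≤
            3 * n * B := by
          rw [← Nat.mul_add, Nat.mul_comm (3 * n)]
          exact Nat.mul_le_mul_left B (by omega)
        rw [Nat.mul_add] at ht3
        rw [Nat.add_mul]
        simp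
        omega
    · intro hb
      have hf3 : s3.reg .found = 0 := hb
      refine runs_processOddLayer_step ho hinv hst (by rwa [ek2]) fun s4 t4 hst4 hf4 ht4 => ?_
      rw [ek2, hB'] at ht4
      rw [runs_block_nil]
      obtain ⟨lev', hinv'⟩ := hinv.next hst hst4 ho.ground₁ ho.ground₂ hf3 hm hI₁ hI₂ hopt
      have hc := hst4.card
      have hsb : s3.seenBelow n = s2.seenBelow n := by
        simp only [State.seenBelow, hst.seen_eq]
      rw [hsb] at hc
      have hcard4 := s4.card_seenBelow_le n
      refine ⟨_, ?_, Or.inl ⟨by rw [hf4, hf3], lev', j + 1, hinv', rfl, ?_⟩⟩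
      · omega
      · rw [hst4.a_eq, ← hc]
        have e1 : B * (s3.reg .a + 2 * (s4.reg .m + (s2.seenBelow n).card)) =
            B * (s2.reg .a + 2 * (s2.seenBelow n).card) + B * (s3.reg .a - s2.reg .a) +
            B * s4.reg .m + B * s4.reg .m := by
          rw [← Nat.mul_add, ← Nat.mul_add, ← Nat.mul_add]
          congr 1
          omega
        rw [e1, Nat.add_mul j]
        rw [Nat.mul_add] at ht3
        simp
        omega
  · intro i s2 t hI hb
    rcases hI with ⟨hf, lev, j, hinv, hi, ht⟩ | ⟨hf, -, hs2, lev, j, htree, h6, h7, ht⟩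
    · have hm : s2.reg .m = 0 := by
        by_contra hm
        refine absurd hb ?_
        rw [← ne_eq, Exp.eval_and_ne_zero_iff, Exp.eval_eq_ne_zero_iff, Exp.eval_lt_ne_zero_iff]
        simp only [Exp.eval, hf, true_and]
        omega
      have ek2 : s2.reg .k = s.reg .k := hinv.represents.ncard.symm.trans hs.ncard
      have hj := hinv.le_add_one
      have ha := hinv.a_le
      refine ⟨j, hinv.represents, by omega, fun _ =>
        ⟨fun J hJ₁ hJ₂ => hinv.encard_le hm ho.ground₁ hJ₁ hJ₂,
        hinv.not_isAugmentingPath hm ho.ground₁⟩, fun h => absurd hf h, ?_⟩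
      have hcard := s2.card_seenBelow_le n
      have e1 : B * (s2.reg .a + 2 * (s2.seenBelow n).card) ≤ 3 * n * B := by
        rw [Nat.mul_comm (3 * n)]
        exact Nat.mul_le_mul_left B (by omega)
      rw [Nat.add_mul]
      simp
      omega
    · refine ⟨j, hs2, by omega, fun h => absurd h hf, fun _ => ⟨⟨lev, htree⟩, h6⟩, ?_⟩
      rw [Nat.add_mul] at *
      simp
      omega

end RunSearch

/-! ### Augmentation -/

section Augment

open Algorithm

attribute [local simp] Exp.eval Exp.cost

variable {orc : Fin 2 → Set ℕ → Prop} {N₁ N₂ : Matroid ℕ} {n R D j : ℕ} {S : Set ℕ}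
  {lev : ℕ → ℕ} {s s' : State} {Q : State → ℕ → Prop}

theorem SearchTree.lev_iterate (h : SearchTree N₁ N₂ n S lev D s) {i : ℕ} (hi : i ≤ D) :
    lev ((s.arr .par)^[i] (s.reg .v)) = D - i := by
  induction i with
  | zero => simpa using h.lev_v
  | succ i ih =>
    have ih' := ih (by omega)
    rw [Function.iterate_succ_apply']
    obtain ⟨-, h2, -⟩ := h.parent _ (by omega) (by omega : lev ((s.arr .par)^[i] (s.reg .v)) ≤ D)
    omega

/-- The path from a source to the sink in the register `v`, given by the parents. -/
def State.path (s : State) (D i : ℕ) : ℕ := (s.arr .par)^[D - i] (s.reg .v)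

theorem SearchTree.path_zero (h : SearchTree N₁ N₂ n S lev D s) :
    s.path D 0 ∈ extenders N₁ S :=
  (h.source_of_lev _ (by rw [State.path, h.lev_iterate (by omega)]; omega)).1

theorem SearchTree.path_last (h : SearchTree N₁ N₂ n S lev D s) :
    s.path D D ∈ extenders N₂ S := by
  simpa [State.path] using h.mem_sinks

theorem SearchTree.path_adj (h : SearchTree N₁ N₂ n S lev D s) :
    ∀ i < D, (exchangeGraph N₁ N₂ S).Adj (s.path D i) (s.path D (i + 1)) := by
  intro i hi
  have hl := h.lev_iterate (i := D - (i + 1)) (by omega)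
  have e : s.path D i = s.arr .par (s.path D (i + 1)) := by
    rw [State.path, State.path, ← Function.iterate_succ_apply' (s.arr .par)]
    congr 2
    omega
  rw [e]
  exact (h.parent _ (by rw [State.path]; omega) (by rw [State.path]; omega)).2.2

theorem SearchTree.augments (h : SearchTree N₁ N₂ n S lev D s) :
    Augments N₁ N₂ S (symmDiff S {x | x ∈ (List.range (D + 1)).map (s.path D)}) :=
  ⟨_, isShortestAugmentingPath_of_levels h.lev_source h.arc h.le_lev_sink h.path_zero h.path_last
    h.path_adj, rfl⟩

theorem SearchTree.iterate_mem_iff (h : SearchTree N₁ N₂ n S lev (2 * j) s) {i : ℕ}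
    (hi : i ≤ 2 * j) : (s.arr .par)^[i] (s.reg .v) ∈ S ↔ i % 2 = 1 := by
  have := path_mem_iff h.path_zero h.path_adj (2 * j - i) (by omega)
  rw [State.path, show 2 * j - (2 * j - i) = i by omega] at this
  rw [this]
  omega

/-- The array `inS` of `s'` is the characteristic function of `S`, toggled at the sink in the
register `v` of `s` and at its first `i` ancestors. -/
def State.Toggled (s : State) (n : ℕ) (S : Set ℕ) (i : ℕ) (s' : State) : Prop :=
  ∀ x < n, s'.arr .inS x ≠ 0 ↔
    (x ∈ S ∧ ∀ i' ≤ i, (s.arr .par)^[i'] (s.reg .v) ≠ x) ∨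
    (x ∉ S ∧ ∃ i' ≤ i, (s.arr .par)^[i'] (s.reg .v) = x)

theorem State.Toggled.succ {i : ℕ} {s₁ s₂ : State} (h : s.Toggled n S i s₁) {y w : ℕ}
    (hy : y = (s.arr .par)^[i + 1] (s.reg .v)) (hw : w ≠ 0 ↔ y ∉ S)
    (h2 : s₂.arr .inS = Function.update (s₁.arr .inS) y w) : s.Toggled n S (i + 1) s₂ := by
  intro x hx
  rw [h2]
  by_cases hxy : x = y
  · subst hxy
    rw [Function.update_self, hw]
    constructor
    · exact fun h => Or.inr ⟨h, i + 1, le_rfl, hy.symm⟩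
    · rintro (⟨-, h⟩ | ⟨h, -⟩)
      · exact absurd hy.symm (h (i + 1) le_rfl)
      · exact h
  · rw [Function.update_of_ne hxy, h x hx]
    have hne : (s.arr .par)^[i + 1] (s.reg .v) ≠ x := fun h => hxy (h.symm.trans hy.symm)
    refine or_congr (and_congr_right fun _ => ⟨fun h i' hi' => ?_, fun h i' hi' => h i' (by omega)⟩)
      (and_congr_right fun _ => ⟨fun ⟨i', hi', h⟩ => ⟨i', by omega, h⟩, fun ⟨i', hi', h⟩ => ?_⟩)
    · rcases Nat.lt_succ_iff_lt_or_eq.1 (Nat.lt_succ_of_le hi') with h' | rfl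
      · exact h i' (by omega)
      · exact hne
    · rcases Nat.lt_succ_iff_lt_or_eq.1 (Nat.lt_succ_of_le hi') with h' | rfl
      · exact ⟨i', by omega, h⟩
      · exact absurd h hne

theorem injOn_update_Iio_succ {f : ℕ → ℕ} {m x : ℕ} (hf : InjOn f (Iio m))
    (hx : x ∉ f '' Iio m) : InjOn (Function.update f m x) (Iio (m + 1)) := by
  have h : ∀ i < m + 1, i ≠ m → Function.update f m x i ≠ x := by
    intro i hi him h
    rw [Function.update_of_ne him] at h
    exact hx ⟨i, by rw [mem_Iio]; omega, h⟩
  intro a ha b hb hab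
  rw [mem_Iio] at ha hb
  by_cases hA : a = m
  · by_cases hB : b = m
    · rw [hA, hB]
    · rw [hA, Function.update_self] at hab
      exact absurd hab.symm (h b hb hB)
  · by_cases hB : b = m
    · rw [hB, Function.update_self] at hab
      exact absurd hab (h a ha hA)
    · rw [Function.update_of_ne hA, Function.update_of_ne hB] at hab
      exact hf (by rw [mem_Iio]; omega) (by rw [mem_Iio]; omega) hab

theorem setOf_mem_slice (s : State) (A : Arr) (k : ℕ) :
    {z | z ∈ s.slice A k} = s.arr A '' Iio k := by
  ext z
  simp [State.slice]

/-- The parents lead from the sink to a source, and toggling the membership of the elements on the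
way replaces `S` by the larger common independent set that arises from the shortest path. -/
theorem runs_augment (ho : IsOracle orc N₁ N₂ n) (hs : Represents N₁ N₂ n S s)
    (htree : SearchTree N₁ N₂ n S lev (2 * j) s)
    (h : ∀ s' t S' L, Represents N₁ N₂ n S' s' → Augments N₁ N₂ S S' → S'.ncard = S.ncard + 1 →
      s'.reg .more = s.reg .more → s'.out = s.out ++ [L] → {z | z ∈ L} = S' →
      t ≤ 40 * j + 40 * n + 40 → Q s' t) :
    Runs orc R augment s Q := by
  have hfin : S.Finite := (finite_Iio n).subset hs.subset
  obtain ⟨hS₁, hS₂, hcard⟩ := augment_of_levels hs.indep₁ hs.indep₂ hfin htree.lev_source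
    htree.arc htree.le_lev_sink htree.path_zero htree.path_last htree.path_adj
  have haug := htree.augments
  have hmem : ∀ x, x ∈ symmDiff S {x | x ∈ (List.range (2 * j + 1)).map (s.path (2 * j))} ↔
      (x ∈ S ∧ ∀ i' ≤ 2 * j, (s.arr .par)^[i'] (s.reg .v) ≠ x) ∨
      (x ∉ S ∧ ∃ i' ≤ 2 * j, (s.arr .par)^[i'] (s.reg .v) = x) := by
    intro x
    have : x ∈ (List.range (2 * j + 1)).map (s.path (2 * j)) ↔
        ∃ i' ≤ 2 * j, (s.arr .par)^[i'] (s.reg .v) = x := by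
      simp only [List.mem_map, List.mem_range, State.path]
      constructor
      · rintro ⟨i, hi, h⟩
        exact ⟨2 * j - i, by omega, h⟩
      · rintro ⟨i, hi, h⟩
        exact ⟨2 * j - i, by omega, by rwa [show 2 * j - (2 * j - i) = i by omega]⟩
    rw [mem_symmDiff, mem_ofPred_eq, this]
    push Not
    rw [and_comm (a := ∃ _, _)]
  generalize symmDiff S {x | x ∈ (List.range (2 * j + 1)).map (s.path (2 * j))} = S' at *
  have hS'n : S' ⊆ Iio n := by
    rw [← ho.ground₁]
    exact hS₁.subset_ground
  unfold augment
  rw [runs_block_cons, runs_store_iff, runs_block_cons]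
  refine Runs.loop_frame rfl (fun i s1 t => i ≤ j ∧ s1.reg .v =
    (s.arr .par)^[2 * (j - i)] (s.reg .v) ∧ s.Toggled n S (2 * (j - i)) s1 ∧
    t ≤ 40 * (j - i)) (i := j) ?_ ?_ ?_
  · refine ⟨le_rfl, by simp, ?_, by omega⟩
    intro x hx
    have hv := htree.mem_sinks.1
    by_cases hxv : x = s.reg .v
    · simp [hxv, hv]
    · have := hs.inS_iff x hx
      have hxv' : s.reg .v ≠ x := Ne.symm hxv
      simpa [hxv, hxv'] using this
  · rintro i s1 t ⟨hij, hv, htog, ht⟩ he hb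
    rw [Exp.eval_lt_ne_zero_iff] at hb
    have en : s1.reg .n = n := by rw [he.reg _ (by decide)]; simp [hs.n_eq]
    have ep : s1.arr .par = s.arr .par := by rw [he.arr _ (by decide)]; simp
    -- at a source the parent is `n`, which ends the loop
    have hi : 0 < i := by
      by_contra hi
      have hl := htree.lev_iterate (i := 2 * (j - i)) (by omega)
      have := (htree.source_of_lev _ (by rw [hl]; omega)).2
      simp only [Exp.eval, ep, en, hv, this, lt_irrefl] at hb
    have e1 : 2 * (j - (i - 1)) = 2 * (j - i) + 1 + 1 := by omega
    have hy : s.arr .par (s1.reg .v) = (s.arr .par)^[2 * (j - i) + 1] (s.reg .v) := by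
      rw [hv, Function.iterate_succ_apply']
    have hz : s.arr .par (s.arr .par (s1.reg .v)) =
        (s.arr .par)^[2 * (j - i) + 1 + 1] (s.reg .v) := by
      rw [hy, Function.iterate_succ_apply' _ (2 * (j - i) + 1)]
    simp only [runs_block_cons, runs_set_iff, runs_store_iff, runs_block_nil]
    refine ⟨i - 1, by omega, by omega, ?_, ?_, ?_⟩
    · simp [ep, e1, hz]
    · rw [e1]
      refine State.Toggled.succ (w := 1) (State.Toggled.succ (w := 0)
        (s₂ := (s1.setReg .y (s.arr .par (s1.reg .v))).setArr .inS (s.arr .par (s1.reg .v)) 0)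
        htog hy ?_ ?_) hz ?_ ?_
      · rw [hy, htree.iterate_mem_iff (by omega)]
        omega
      · simp
      · rw [hz, htree.iterate_mem_iff (by omega)]
        omega
      · simp [ep]
    · simp
      omega
  · rintro i s1 t ⟨hij, hv, htog, ht⟩ he hb
    have en : s1.reg .n = n := by rw [he.reg _ (by decide)]; simp [hs.n_eq]
    have ep : s1.arr .par = s.arr .par := by rw [he.arr _ (by decide)]; simp
    have em : s1.reg .more = s.reg .more := by rw [he.reg _ (by decide)]; simp
    have eo : s1.out = s.out := by rw [he.out]; simp
    have hi : i = 0 := by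
      by_contra hi
      have hl := htree.lev_iterate (i := 2 * (j - i)) (by omega)
      have := (htree.parent _ (by rw [hl]; omega) (by rw [hl]; omega)).1
      refine absurd hb ?_
      rw [← ne_eq, Exp.eval_lt_ne_zero_iff]
      simpa [ep, en, hv] using this
    subst hi
    have hS' : ∀ x < n, s1.arr .inS x ≠ 0 ↔ x ∈ S' := fun x hx => by
      rw [hmem]
      exact htog x hx
    rw [runs_block_cons, runs_set_iff, runs_block_cons]
    -- the new solution is read off from its characteristic function
    refine Runs.forAll rfl (by decide) (by decide) (by decide) (fun x s2 t =>
      s2.arr .sol '' Iio (s2.reg .k) = {z | z < x ∧ z ∈ S'} ∧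
      InjOn (s2.arr .sol) (Iio (s2.reg .k)) ∧ s2.reg .k ≤ x ∧ t ≤ 30 * x) ?_ ?_ ?_
    · simp
    · rintro s2 t2 ⟨h1, h2, h3, h4⟩ hx he2
      have ei : s2.arr .inS = s1.arr .inS := by rw [he2.arr _ (by decide)]; simp
      simp only [State.setReg_reg, reduceCtorEq, if_false, en] at hx
      generalize hxx : s2.reg .x = x at *
      rw [runs_ite_iff]
      constructor
      · intro hb
        have hxS : x ∈ S' := by
          rw [← hS' x hx, ← ei]
          simpa [hxx] using hb
        simp only [runs_block_cons, runs_set_iff, runs_store_iff, runs_block_nil]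
        refine ⟨?_, ?_, ?_, ?_⟩
        · simp only [State.setReg_arr, State.setArr_arr, State.setReg_reg, State.setArr_reg,
            Exp.eval, if_true, reduceCtorEq, if_false, hxx, image_update_Iio_succ, h1]
          ext z
          simp only [mem_insert_iff, mem_ofPred_eq]
          constructor
          · rintro (rfl | h)
            · exact ⟨by omega, hxS⟩
            · exact ⟨by omega, h.2⟩
          · rintro ⟨hz, hzS⟩
            rcases Nat.lt_succ_iff_lt_or_eq.1 hz with h | rfl
            · exact Or.inr ⟨h, hzS⟩
            · exact Or.inl rfl
        · simp only [State.setReg_arr, State.setArr_arr, State.setReg_reg, State.setArr_reg,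
            Exp.eval, if_true, reduceCtorEq, if_false, hxx]
          refine injOn_update_Iio_succ h2 ?_
          rw [h1]
          simp
        · simp
          omega
        · simp
          omega
      · intro hb
        have hxS : x ∉ S' := by
          rw [← hS' x hx, ← ei]
          simpa [hxx] using hb
        rw [runs_skip_iff]
        refine ⟨?_, by simpa using h2, by simp; omega, by simp; omega⟩
        simp only [State.setReg_arr, State.setReg_reg, reduceCtorEq, if_false, h1]
        ext z
        simp only [mem_ofPred_eq]
        constructor
        · exact fun h => ⟨by omega, h.2⟩
        · rintro ⟨hz, hzS⟩
          rcases Nat.lt_succ_iff_lt_or_eq.1 hz with h | rfl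
          · exact ⟨h, hzS⟩
          · exact absurd hzS hxS
    · rintro s2 t2 ⟨h1, h2, h3, h4⟩ he2
      have ei : s2.arr .inS = s1.arr .inS := by rw [he2.arr _ (by decide)]; simp
      have e2n : s2.reg .n = n := by rw [he2.reg _ (by decide)]; simp [en]
      have em2 : s2.reg .more = s.reg .more := by rw [he2.reg _ (by decide)]; simp [em]
      have eo2 : s2.out = s.out := by rw [he2.out]; simp [eo]
      simp only [State.setReg_reg, reduceCtorEq, if_false, en] at h1 h3 h4
      have himg : s2.arr .sol '' Iio (s2.reg .k) = S' := by
        rw [h1]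
        ext z
        exact ⟨fun h => h.2, fun h => ⟨hS'n h, h⟩⟩
      rw [runs_block_cons, runs_emit_iff, runs_block_nil]
      refine h _ _ S' _ ⟨e2n, ?_, h2, himg, hS'n, hS₁, hS₂⟩ haug hcard em2 (by rw [eo2]) ?_ ?_
      · intro x hx
        rw [← hS' x hx, ← ei]
      · rw [setOf_mem_slice]
        exact himg
      · simp
        omega

end Augment

/-! ### The whole algorithm -/

section PartialRun

variable {α : Type*} {M₁ M₂ : Matroid α} {S S' : Set α} {L : List (Set α)}

/-- The list of solutions of an unfinished run of the basic algorithm, whose current solution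
is `S`. -/
structure IsPartialRun (M₁ M₂ : Matroid α) (L : List (Set α)) (S : Set α) : Prop where
  start : L.head? = some ∅
  step : L.IsChain (Augments M₁ M₂)
  last : L.getLast? = some S
  indep : ∀ T ∈ L, M₁.Indep T

theorem IsPartialRun.initial : IsPartialRun M₁ M₂ [∅] ∅ :=
  ⟨rfl, .singleton _, rfl, by simp⟩

theorem IsPartialRun.concat (h : IsPartialRun M₁ M₂ L S) (hS : Augments M₁ M₂ S S')
    (hS' : M₁.Indep S') : IsPartialRun M₁ M₂ (L ++ [S']) S' := by
  refine ⟨?_, ?_, by simp, ?_⟩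
  · rw [List.head?_append, h.start]
    rfl
  · rw [List.isChain_append]
    refine ⟨h.step, .singleton _, fun x hx y hy => ?_⟩
    obtain rfl : S = x := by simpa [h.last] using hx
    obtain rfl : S' = y := by simpa using hy
    exact hS
  · intro T hT
    rcases List.mem_append.1 hT with hT | hT
    · exact h.indep T hT
    · rwa [List.mem_singleton.1 hT]

end PartialRun

section RunCunningham

open Algorithm

attribute [local simp] Exp.eval Exp.cost

variable {orc : Fin 2 → Set ℕ → Prop} {N₁ N₂ : Matroid ℕ} {n R opt : ℕ} {I : Set ℕ}
  {Q : State → ℕ → Prop}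

/-- The sets output so far. -/
def State.solutions (s : State) : List (Set ℕ) := s.out.map fun L => {z | z ∈ L}

/-- Bound, up to a factor `O(R n)`, for the cost of the iteration that augments a solution of
size `c`: the number of layers, and the length of the binary searches. -/
def iterationBound (opt c : ℕ) : ℕ := c / (opt - c) + Nat.size opt + 1

/-- The cost of one iteration: `t` for the search, `t'` for the augmentation, and `t''` for the
control structure. -/
theorem cost_iteration_le {t t' t'' j k L : ℕ} (hR : 0 < R)
    (ht : t ≤ (j + 3) * (100 * R * n + 100) + 420 * R * (Nat.size k + 1) * n)
    (ht' : t' ≤ 40 * j + 40 * n + 40) (ht'' : t'' ≤ 20) (hL : j + Nat.size k + 1 ≤ L) :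
    t + t' + t'' ≤ 1000 * R * (n + 1) * L := by
  have h1 : (j + 3) * (100 * R * n + 100) ≤ (j + 3) * (100 * (R * (n + 1))) := by
    refine Nat.mul_le_mul_left _ ?_
    nlinarith
  have h2 : 420 * R * (Nat.size k + 1) * n ≤ 420 * (Nat.size k + 1) * (R * (n + 1)) := by
    nlinarith [Nat.zero_le (R * (Nat.size k + 1))]
  have h3 : j + n + 1 ≤ (j + 1) * (R * (n + 1)) := by
    nlinarith [Nat.zero_le (j * n), Nat.mul_le_mul_left ((j + 1) * (n + 1)) hR]
  have h4 : 1 ≤ R * (n + 1) := Nat.mul_pos hR n.succ_pos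
  have h5 : 1000 * (R * (n + 1)) * (j + Nat.size k + 1) ≤ 1000 * R * (n + 1) * L := by
    rw [← mul_assoc]
    exact Nat.mul_le_mul_left _ hL
  generalize R * (n + 1) = A at *
  generalize Nat.size k = σ at *
  nlinarith [Nat.zero_le (j * A), Nat.zero_le (σ * A)]

/-- The algorithm performs a run of the basic algorithm.  Its cost is that of an iteration for each
size `c < opt` of the solution, and of the last search, which has at most `opt + 1` odd layers. -/
theorem runs_cunningham (ho : IsOracle orc N₁ N₂ n) (hI₁ : N₁.Indep I) (hI₂ : N₂.Indep I)
    (hopt : I.encard = opt) (hmax : ∀ J, N₁.Indep J → N₂.Indep J → J.encard ≤ I.encard)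
    (hR : opt < R)
    (h : ∀ s t S, IsPartialRun N₁ N₂ s.solutions S → N₂.Indep S →
      (∀ J, N₁.Indep J → N₂.Indep J → J.encard ≤ S.encard) →
      (∀ P, ¬ IsAugmentingPath N₁ N₂ S P) →
      t ≤ 1000 * R * (n + 1) *
        (∑ c ∈ Finset.range opt, iterationBound opt c + opt + Nat.size opt + 3) → Q s t) :
    Runs orc R cunningham (initState n) Q := by
  have hle : ∀ {S : Set ℕ} {s : State}, Represents N₁ N₂ n S s → s.reg .k ≤ opt := by
    intro S s hs
    have := hmax S hs.indep₁ hs.indep₂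
    rw [hs.encard, hopt] at this
    exact_mod_cast this
  have hRpos : 0 < R := by omega
  generalize hK : 1000 * R * (n + 1) = K at *
  have hKn : 1000 * (n + 1) ≤ K := by
    rw [← hK]
    nlinarith [Nat.mul_le_mul_left (1000 * (n + 1)) hRpos]
  unfold cunningham
  rw [runs_block_cons, runs_set_iff, runs_block_cons]
  refine Runs.forAll rfl (by decide) (by decide) (by decide) (fun x s t =>
    (∀ z < x, s.arr .inS z = 0) ∧ t ≤ 20 * x) ?_ ?_ ?_
  · simp
  · rintro s t ⟨h1, ht⟩ - -
    rw [runs_store_iff]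
    refine ⟨fun z hz => ?_, by simp; omega⟩
    rcases Nat.lt_succ_iff_lt_or_eq.1 hz with hz | rfl
    · simpa [hz.ne] using h1 z hz
    · simp
  rintro s t ⟨h1, ht⟩ he
  have en : s.reg .n = n := by rw [he.reg _ (by decide)]; simp [initState]
  have ek : s.reg .k = 0 := by rw [he.reg _ (by decide)]; simp
  have eo : s.out = [] := by rw [he.out]; simp [initState]
  simp only [State.setReg_reg, reduceCtorEq, if_false] at h1 ht
  have hn0 : (initState n).reg .n = n := by simp [initState]
  rw [hn0] at h1 ht
  simp only [runs_block_cons, runs_emit_iff, runs_set_iff, runs_block_nil]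
  -- each round enlarges `S`, except for the last one, which sets `more` to zero
  refine Runs.loop (fun i s t => ∃ S, Represents N₁ N₂ n S s ∧ i = opt - s.reg .k + s.reg .more ∧
    s.reg .more ≤ 1 ∧ IsPartialRun N₁ N₂ s.solutions S ∧
    (s.reg .more ≠ 0 → t ≤ K * ∑ c ∈ Finset.range (s.reg .k), iterationBound opt c) ∧
    (s.reg .more = 0 → (∀ J, N₁.Indep J → N₂.Indep J → J.encard ≤ S.encard) ∧
      (∀ P, ¬ IsAugmentingPath N₁ N₂ S P) ∧
      t ≤ K * (∑ c ∈ Finset.range (s.reg .k), iterationBound opt c + (opt + Nat.size opt + 2))))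
    (i := opt + 1) ?_ ?_ ?_
  · refine ⟨∅, ⟨by simp [en], by simpa using h1, by simp [ek], by simp [ek], by simp, by simp,
      by simp⟩, by simp [ek], by simp, ?_, by simp, by simp⟩
    simpa [State.solutions, eo, ek, State.slice] using IsPartialRun.initial
  · rintro i s1 t1 ⟨S, hs, hi, hm1, hrun, ht1, -⟩ hb
    have hm : s1.reg .more ≠ 0 := by simpa using hb
    have hk := hle hs
    specialize ht1 hm
    rw [runs_block_cons]
    refine runs_search ho hs (by omega) hI₁ hI₂ hopt fun s2 t2 j hs2 hj hf0 hf1 he2 ht2 => ?_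
    have ek2 : s2.reg .k = s1.reg .k := by rw [he2.reg _ (by decide)]
    have em2 : s2.reg .more = s1.reg .more := by rw [he2.reg _ (by decide)]
    have eo2 : s2.out = s1.out := he2.out
    simp only [runs_block_cons, runs_ite_iff, runs_set_iff, runs_block_nil]
    constructor
    · intro hb2
      obtain ⟨⟨lev, htree⟩, hjo⟩ := hf1 hb2
      refine runs_augment ho hs2 htree fun s3 t3 S' L hs3 haug hcard em3 eo3 hL ht3 => ?_
      have ek3 : s3.reg .k = s1.reg .k + 1 := by rw [← hs3.ncard, hcard, hs.ncard]
      have hk3 := hle hs3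
      refine ⟨opt - s3.reg .k + s3.reg .more, by omega, S', hs3, rfl, by omega, ?_, fun _ => ?_,
        fun h0 => absurd h0 (by omega)⟩
      · have : s3.solutions = s1.solutions ++ [S'] := by
          simp [State.solutions, eo3, eo2, hL]
        rw [this]
        exact hrun.concat haug hs3.indep₁
      · -- the odd layers of the search are disjoint subsets of `S` of size at least `opt - k`
        have hj' : j ≤ s1.reg .k / (opt - s1.reg .k) := by
          rw [Nat.le_div_iff_mul_le (by omega), Nat.mul_sub]
          omega
        have hsz : Nat.size (s1.reg .k) ≤ Nat.size opt := Nat.size_le_size hk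
        have := cost_iteration_le (n := n) (t'' := 20) (L := iterationBound opt (s1.reg .k)) hRpos
          ht2 ht3 le_rfl (by unfold iterationBound; omega)
        rw [ek3, Finset.sum_range_succ, Nat.mul_add]
        rw [hK] at this
        simp
        omega
    · intro hb2
      obtain ⟨hopt', hpath⟩ := hf0 hb2
      refine ⟨_, ?_, S, hs2.congr (by simp) (by simp) (by simp) (by simp), rfl, by simp, ?_,
        by simp, fun _ => ⟨hopt', hpath, ?_⟩⟩
      · simp
        omega
      · simpa [State.solutions, eo2] using hrun
      · have hsz : Nat.size (s1.reg .k) ≤ Nat.size opt := Nat.size_le_size hk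
        have := cost_iteration_le (n := n) (t' := 0) (t'' := 20) (L := opt + Nat.size opt + 2) hRpos
          ht2 (Nat.zero_le _) le_rfl (by omega)
        rw [hK] at this
        rw [Nat.mul_add]
        simp [ek2]
        omega
  · rintro i s1 t1 ⟨S, hs, hi, hm1, hrun, -, h0⟩ hb
    have hm : s1.reg .more = 0 := hb
    obtain ⟨hopt', hpath, ht1⟩ := h0 hm
    refine h s1 _ S hrun hs.indep₂ hopt' hpath ?_
    have hsum : K * ∑ c ∈ Finset.range (s1.reg .k), iterationBound opt c ≤
        K * ∑ c ∈ Finset.range opt, iterationBound opt c :=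
      Nat.mul_le_mul_left _ (Finset.sum_le_sum_of_subset (Finset.range_subset_range.2 (hle hs)))
    simp only [Nat.mul_add] at *
    simp [ek]
    omega

end RunCunningham

/-! ### The asymptotic bounds -/

section Estimates

theorem Nat.size_le_one_add_log_div {m : ℕ} {ρ : ℝ} (hm : (m : ℝ) ≤ ρ) (hρ : 1 ≤ ρ) :
    (Nat.size m : ℝ) ≤ 1 + Real.log ρ / Real.log 2 := by
  have h2 : 0 < Real.log 2 := Real.log_pos (by norm_num)
  rcases Nat.eq_zero_or_pos m with rfl | hm0
  · have := Real.log_nonneg hρ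
    simp only [Nat.size_zero, Nat.cast_zero]
    positivity
  have h1 : Nat.size m ≤ Nat.log 2 m + 1 :=
    Nat.size_le.2 (Nat.lt_pow_succ_log_self (by norm_num) m)
  have h3 : ((Nat.log 2 m : ℕ) : ℝ) ≤ Real.logb 2 m := by
    exact_mod_cast Real.natLog_le_logb m 2
  have h4 : Real.logb 2 m ≤ Real.log ρ / Real.log 2 := by
    rw [Real.logb]
    gcongr
  have h5 : (Nat.size m : ℝ) ≤ (Nat.log 2 m : ℕ) + 1 := by exact_mod_cast h1
  linarith

/-- The numbers of odd layers of all searches add up to a harmonic sum. -/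
theorem sum_div_sub_le {m : ℕ} {ρ : ℝ} (hm : (m : ℝ) ≤ ρ) (hρ : 1 ≤ ρ) :
    ∑ c ∈ Finset.range m, ((c / (m - c) : ℕ) : ℝ) ≤ ρ * (1 + Real.log ρ) := by
  have h1 : ∀ c ∈ Finset.range m, ((c / (m - c) : ℕ) : ℝ) ≤ m * ((m - 1 - c + 1 : ℕ) : ℝ)⁻¹ := by
    intro c hc
    have hc := Finset.mem_range.1 hc
    refine Nat.cast_div_le.trans ?_
    rw [div_eq_mul_inv, show m - 1 - c + 1 = m - c by omega]
    gcongr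
  refine (Finset.sum_le_sum h1).trans ?_
  rw [← Finset.mul_sum, Finset.sum_range_reflect (fun i => ((i + 1 : ℕ) : ℝ)⁻¹)]
  have h2 : ∑ i ∈ Finset.range m, ((i + 1 : ℕ) : ℝ)⁻¹ = (harmonic m : ℝ) := by
    simp [harmonic]
  rw [h2]
  have h3 : Real.log m ≤ Real.log ρ := by
    rcases Nat.eq_zero_or_pos m with rfl | hm0
    · simpa using Real.log_nonneg hρ
    · exact Real.log_le_log (by exact_mod_cast hm0) hm
  have h4 := harmonic_le_one_add_log m
  have h5 := Real.log_nonneg hρ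
  calc (m : ℝ) * harmonic m ≤ m * (1 + Real.log ρ) := by gcongr; linarith
    _ ≤ ρ * (1 + Real.log ρ) := by gcongr

theorem sum_iterationBound_le {m : ℕ} {ρ : ℝ} (hm : (m : ℝ) ≤ ρ) (hρ : 2 ≤ ρ) :
    ((∑ c ∈ Finset.range m, iterationBound m c + m + Nat.size m + 3 : ℕ) : ℝ) ≤
      23 * (ρ * Real.log ρ ^ 2) := by
  have hlog2 : (2 / 3 : ℝ) ≤ Real.log 2 := by linarith [Real.log_two_gt_d9]
  have hlog : (2 / 3 : ℝ) ≤ Real.log ρ := hlog2.trans (Real.log_le_log (by norm_num) hρ)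
  have h1 := sum_div_sub_le hm (by linarith)
  have h2 := Nat.size_le_one_add_log_div hm (by linarith)
  have h3 : Real.log ρ / Real.log 2 ≤ 3 / 2 * Real.log ρ := by
    rw [div_le_iff₀ (by linarith)]
    nlinarith
  have e : ((∑ c ∈ Finset.range m, iterationBound m c + m + Nat.size m + 3 : ℕ) : ℝ) =
      ∑ c ∈ Finset.range m, ((c / (m - c) : ℕ) : ℝ) + m * (Nat.size m + 1) + m + Nat.size m +
        3 := by
    simp only [iterationBound, add_assoc, Finset.sum_add_distrib, Finset.sum_const,
      Finset.card_range, smul_eq_mul]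
    push_cast
    ring
  rw [e]
  have h4 : (Nat.size m : ℝ) ≤ 3 * Real.log ρ := by linarith
  generalize Real.log ρ = ℓ at *
  have h5 : (m : ℝ) * (Nat.size m + 1) ≤ ρ * (3 * ℓ + 1) := by gcongr
  have h6 : 0 ≤ ρ * (ℓ - 2 / 3) := mul_nonneg (by linarith) (by linarith)
  have h7 : 0 ≤ ρ * ((ℓ - 2 / 3) * ℓ) :=
    mul_nonneg (by linarith) (mul_nonneg (by linarith) (by linarith))
  have h8 : 0 ≤ (ρ - 2) * ℓ := mul_nonneg (by linarith) (by linarith)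
  nlinarith

/-- With the weight `m + 1` for an oracle call, a single bound for the weighted cost of the program
bounds both the number of calls and, since `m + 1 ≤ 2 ρ`, the total running time. -/
theorem bounds_of_cost_le {w q n m B : ℕ} {ρ A : ℝ} (hn : 0 < n) (hm : (m : ℝ) ≤ ρ) (hρ : 2 ≤ ρ)
    (hB : (B : ℝ) ≤ 23 * A) (h : w + (m + 1) * q ≤ 1000 * (m + 1) * (n + 1) * B) :
    (q : ℝ) ≤ 100000 * (n * A) ∧
      ∀ T : ℝ, 0 ≤ T → totalTime T w q ≤ 100000 * (n * A * (T + ρ)) := by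
  have hq : q ≤ 2000 * (n * B) := by
    have : (m + 1) * q ≤ (m + 1) * (2000 * (n * B)) := by
      nlinarith [Nat.zero_le (m * B), Nat.mul_le_mul_left ((m + 1) * B) hn]
    exact Nat.le_of_mul_le_mul_left this m.succ_pos
  have hw : w ≤ (m + 1) * (2000 * (n * B)) := by
    nlinarith [Nat.zero_le (m * B), Nat.mul_le_mul_left ((m + 1) * B) hn]
  have hnB : (n : ℝ) * B ≤ 23 * (n * A) := by
    have : (n : ℝ) * B ≤ n * (23 * A) := by gcongr
    linarith
  have hnB0 : (0 : ℝ) ≤ n * B := by positivity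
  have hq' : (q : ℝ) ≤ 2000 * (n * B) := by exact_mod_cast hq
  have hw' : (w : ℝ) ≤ (m + 1) * (2000 * (n * B)) := by exact_mod_cast hw
  generalize (n : ℝ) * B = X at *
  generalize (n : ℝ) * A = Y at *
  refine ⟨by linarith, fun T hT => ?_⟩
  have h1 : ((m : ℝ) + 1) * (2000 * X) ≤ (2 * ρ) * (2000 * X) := by
    gcongr
    linarith
  have h2 : T * q ≤ T * (2000 * X) := by gcongr
  have h3 : (T + ρ) * X ≤ (T + ρ) * (23 * Y) := by gcongr
  have h4 : 0 ≤ T * X := by positivity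
  unfold totalTime
  nlinarith [mul_nonneg (add_nonneg hT (by linarith : 0 ≤ ρ)) (by linarith : 0 ≤ Y)]

end Estimates

/-! ### Results in terms of the original matroids -/

section Transfer

variable {α : Type*} {M₁ M₂ : Matroid α} {n : ℕ} {elt : ℕ → α} {S : Set ℕ} {L : List (Set ℕ)}

theorem isOracle_indepOracle (helt : BijOn elt (Iio n) M₁.E) :
    IsOracle (indepOracle M₁ M₂ elt) (M₁.comapOn (Iio n) elt) (M₂.comapOn (Iio n) elt) n := by
  refine ⟨rfl, rfl, fun Q hQ => ?_, fun Q hQ => ?_⟩ <;>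
    rw [comapOn_indep_iff_of_subset helt.injOn hQ] <;> simp [indepOracle]

theorem IsPartialRun.isCunninghamRun_image (helt : BijOn elt (Iio n) M₁.E) (hE : M₁.E = M₂.E)
    (h : IsPartialRun (M₁.comapOn (Iio n) elt) (M₂.comapOn (Iio n) elt) L S)
    (hS : ∀ P, ¬ IsAugmentingPath (M₁.comapOn (Iio n) elt) (M₂.comapOn (Iio n) elt) S P) :
    IsCunninghamRun M₁ M₂ (L.map (elt '' ·)) := by
  have hsub : ∀ T ∈ L, T ⊆ Iio n := fun T hT => (h.indep T hT).subset_ground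
  refine ⟨?_, ?_, elt '' S, ?_, fun Q hQ => ?_⟩
  · simp [h.start]
  · rw [List.isChain_map, List.isChain_iff_getElem]
    intro i hi
    exact (List.isChain_iff_getElem.1 h.step i hi).image helt hE (hsub _ (List.getElem_mem _))
  · simp [h.last]
  · obtain ⟨P, -, -, hP⟩ := hQ.exists_eq_map helt hE (hsub S (List.mem_of_getLast? h.last))
    exact hS P hP

theorem isMaxCommonIndep_image (helt : BijOn elt (Iio n) M₁.E)
    (h₁ : (M₁.comapOn (Iio n) elt).Indep S) (h₂ : (M₂.comapOn (Iio n) elt).Indep S)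
    (hmax : ∀ J, (M₁.comapOn (Iio n) elt).Indep J → (M₂.comapOn (Iio n) elt).Indep J →
      J.encard ≤ S.encard) : IsMaxCommonIndep M₁ M₂ (elt '' S) := by
  have hS : S ⊆ Iio n := h₁.subset_ground
  rw [comapOn_indep_iff_of_subset helt.injOn hS] at h₁ h₂
  refine ⟨h₁, h₂, fun I hI₁ hI₂ => ?_⟩
  obtain ⟨J, hJ, rfl⟩ := subset_image_iff.1 (helt.image_eq.symm ▸ hI₁.subset_ground)
  have := hmax J ((comapOn_indep_iff_of_subset helt.injOn hJ).2 hI₁)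
    ((comapOn_indep_iff_of_subset helt.injOn hJ).2 hI₂)
  rwa [(helt.injOn.mono hJ).encard_image, (helt.injOn.mono hS).encard_image]

theorem exists_maxCommonIndep {N₁ N₂ : Matroid ℕ} (h : N₁.E = Iio n) :
    ∃ I, N₁.Indep I ∧ N₂.Indep I ∧ (∃ m : ℕ, I.encard = m) ∧
      ∀ J, N₁.Indep J → N₂.Indep J → J.encard ≤ I.encard := by
  have hfin : {J | N₁.Indep J ∧ N₂.Indep J}.Finite :=
    (finite_Iio n).finite_subsets.subset fun J hJ => h ▸ hJ.1.subset_ground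
  obtain ⟨I, ⟨hI₁, hI₂⟩, hI⟩ := exists_max_image _ encard hfin
    ⟨∅, N₁.empty_indep, N₂.empty_indep⟩
  have hIfin : I.Finite := (finite_Iio n).subset (h ▸ hI₁.subset_ground)
  exact ⟨I, hI₁, hI₂, ⟨_, hIfin.cast_ncard_eq.symm⟩, fun J h₁ h₂ => hI J ⟨h₁, h₂⟩⟩

end Transfer

end MatroidIntersection

theorem mainTheorem1 :
    ∃ C : ℝ, ∀ (α : Type*) (M₁ M₂ : Matroid α) (n r : ℕ) (elt : ℕ → α),
      M₁.E = M₂.E → Set.BijOn elt (Set.Iio n) M₁.E → max M₁.eRank M₂.eRank = (r : ℕ∞) →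
      ∃ (s : State) (w q : ℕ),
        Exec (indepOracle M₁ M₂ elt) Algorithm.cunningham (initState n) s w q ∧
        IsCunninghamRun M₁ M₂ (s.out.map fun L => elt '' {z | z ∈ L}) ∧
        (∃ L ∈ s.out.getLast?, IsMaxCommonIndep M₁ M₂ (elt '' {z | z ∈ L})) ∧
        (0 < n →
          (q : ℝ) ≤ C * (n * max (r : ℝ) 2 * Real.log (max (r : ℝ) 2) ^ 2) ∧
          ∀ T : ℝ, 0 ≤ T →
            totalTime T w q ≤
              C * (n * max (r : ℝ) 2 * Real.log (max (r : ℝ) 2) ^ 2 * (T + max (r : ℝ) 2))) := by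
  refine ⟨100000, fun α M₁ M₂ n r elt hE helt hr => ?_⟩
  obtain ⟨I, hI₁, hI₂, ⟨opt, hopt⟩, hmax⟩ :=
    exists_maxCommonIndep (N₁ := M₁.comapOn (Set.Iio n) elt) (N₂ := M₂.comapOn (Set.Iio n) elt) rfl
  have hIn : I ⊆ Set.Iio n := hI₁.subset_ground
  have hoptr : opt ≤ r := by
    have h1 := ((comapOn_indep_iff_of_subset helt.injOn hIn).1 hI₁).encard_le_eRank
    rw [(helt.injOn.mono hIn).encard_image, hopt] at h1
    exact_mod_cast (h1.trans (le_max_left _ _)).trans hr.le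
  obtain ⟨s, w, q, hexec, S, hrun, hS₂, hSmax, hpath, ht⟩ := runs_cunningham (R := opt + 1)
    (Q := fun s t => ∃ S,
      IsPartialRun (M₁.comapOn (Set.Iio n) elt) (M₂.comapOn (Set.Iio n) elt) s.solutions S ∧
      (M₂.comapOn (Set.Iio n) elt).Indep S ∧
      (∀ J, (M₁.comapOn (Set.Iio n) elt).Indep J → (M₂.comapOn (Set.Iio n) elt).Indep J →
        J.encard ≤ S.encard) ∧
      (∀ P, ¬ IsAugmentingPath (M₁.comapOn (Set.Iio n) elt) (M₂.comapOn (Set.Iio n) elt) S P) ∧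
      t ≤ 1000 * (opt + 1) * (n + 1) *
        (∑ c ∈ Finset.range opt, iterationBound opt c + opt + Nat.size opt + 3))
    (isOracle_indepOracle (M₂ := M₂) helt) hI₁ hI₂ hopt hmax opt.lt_succ_self
    fun s t S h1 h2 h3 h4 h5 => ⟨S, h1, h2, h3, h4, h5⟩
  have hlast : ∃ L ∈ s.out.getLast?, {z | z ∈ L} = S := by
    simpa [State.solutions] using hrun.last
  refine ⟨s, w, q, hexec, ?_, ?_, fun hn => ?_⟩
  · simpa [State.solutions, Function.comp_def] using hrun.isCunninghamRun_image helt hE hpath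
  · obtain ⟨L, hL, rfl⟩ := hlast
    exact ⟨L, hL, isMaxCommonIndep_image helt (hrun.indep _ (List.mem_of_getLast? hrun.last))
      hS₂ hSmax⟩
  · have hoptρ : (opt : ℝ) ≤ max (r : ℝ) 2 := le_max_of_le_left (by exact_mod_cast hoptr)
    have := bounds_of_cost_le hn hoptρ (le_max_right _ _)
      (sum_iterationBound_le hoptρ (le_max_right _ _)) ht
    simpa only [mul_assoc] using this
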